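/- **Setting.** On a probability space $(\Omega,\mathcal H,\mathbb P_0)$ let $N$ be a homogeneous Poisson process of rate $\mu>0$, and let $\theta,\Lambda$ be random variables such that $\theta$, $\Lambda$ and $N$ are independent. Assume $\mathbb P_0\{\theta=0\}=\pi$ and $\mathbb P_0\{\theta>t\}=(1-\pi)e^{-\lambda t}$, $t\ge 0$, with $\pi\in[0,1)$, $\lambda>0$; the arrival rate $\Lambda$ is a.s. positive and its law $\nu$ has finite moments $m^{(k)}=\int(v-\mu)^k\,\nu(dv)$, $k\in\mathbb N_0$. Let $\mathbb F=(\mathcal F_t)$ be the right-continuous augmentation of the natural filtration of $N$ with $\mathbb P_0$-null sets, and $\mathcal G_t=\mathcal F_t\vee\sigma(\theta,\Lambda)$. With $h(t)=\mu 1_{\{t<\theta\}}+\Lambda 1_{\{t\ge\theta\}}$, the probability $\mathbb P$ is given on each $\mathcal G_t$ by $$\frac{d\mathbb P}{d\mathbb P_0}\Big|_{\mathcal G_t}=Z_t=\exp\Big\{\int_0^t\log\frac{h(s-)}{\mu}\,dN_s-\int_0^t(h(s)-\mu)\,ds\Big\}.$$ Let $\Pi_t=\mathbb P(\theta\le t\mid\mathcal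 F_t)$ and $$\Phi^{(k)}_t=\frac{\mathbb E[(\Lambda-\mu)^k1_{\{\theta\le t\}}\mid\mathcal F_t]}{1-\Pi_t},\qquad k\in\mathbb N_0,\ t\ge0 .$$ **Claim 1.** The processes $\Phi^{(k)}$ have $\mathbb F$-adapted versions with (a.s.) right-continuous paths with left limits, and, for any such versions, almost surely, for all $k\in\mathbb N_0$, $$d\Phi^{(k)}_t=\lambda\big(m^{(k)}+\Phi^{(k)}_t\big)dt+\frac1\mu\Phi^{(k+1)}_{t-}(dN_t-\mu\,dt),\ t>0,\qquad \Phi^{(k)}_0=\frac{\pi}{1-\pi}m^{(k)} .$$ **Claim 2.** Suppose $\nu(\{\lambda_1,\dots,\lambda_k\})=1$ for some positive numbers $\lambda_1,\dots,\lambda_k$, and write $\prod_{i=1}^k(v-\lambda_i+\mu)=v^k+\sum_{i=0}^{k-1}c_iv^i$. Then, for any such versions, almost surely, $\Phi^{(k)}_t=-\sum_{i=0}^{k-1}c_i\Phi^{(i)}_t$ for all $t\ge0$, and $Y=(\Phi^{(0)},\dots,\Phi^{(k-1)})$ is a $k$-dimensional Markovian sufficient statistic for the quickest detection of $\theta$.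 That is: 1. $Y$ is $\mathbb F$-adapted, and it is a time-homogeneous Markov process relative to $\mathbb F$, both under $\mathbb P_0$ and under $\mathbb P$ (for each of the two measures there are Markov kernels $\kappa_t$ on $\mathbb R^k$ such that the conditional probability of $\{Y_{s+t}\in B\}$ given $\mathcal F_s$ is $\kappa_t(Y_s,B)$ a.s.). 2. For every Borel set $B$ the posterior probabilities $\mathbb P(\theta\le t,\Lambda\in B\mid\mathcal F_t)$ and $\mathbb P(\theta>t,\Lambda\in B\mid\mathcal F_t)$ are a.s. Borel functions, not depending on $t$, of $Y_t$. 3. For every $c>0$ there is a Borel function $g$ on $\mathbb R^k$ such that for every $\mathbb F$-stopping time $\tau$ (with values in $[0,\infty]$) the Bayes risk satisfies $$\mathbb P\{\tau<\theta\}+c\,\mathbb E(\tau-\theta)^+=1-\pi+c(1-\pi)\,\mathbb E_0\Big[\int_0^\tau e^{-\lambda t}g(Y_t)\,dt\Big]$$ in $(-\infty,\infty]$, where $\mathbb E_0\int_0^\tau e^{-\lambda t}g(Y_t)^-dt<\infty$; for unbounded $\tau$, $\mathbb P\{\tau<\theta\}$ and $\mathbb E(\tau-\theta)^+$ are read as $\lim_n\mathbb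 P\{\tau<\theta\le n\}$ and $\lim_n\mathbb E(\tau\wedge n-\theta)^+$. -/

import Mathlib

open MeasureTheory ProbabilityTheory Filter Topology Polynomial
open scoped NNReal ENNReal

noncomputable section

namespace PoissonDisorder

/-- A right-continuous path with left limits. -/
def IsCadlag (f : ℝ≥0 → ℝ) : Prop :=
  ∀ t, ContinuousWithinAt f (Set.Ici t) t ∧ ∃ l, Tendsto f (𝓝[<] t) (𝓝 l)

/-- A homogeneous Poisson process with the given rate: it starts at zero, has independent
increments with Poisson laws, and its paths are almost surely nondecreasing and
right-continuous. -/
structure IsPoisson {Ω : Type*} [MeasurableSpace Ω] (N : ℝ≥0 → Ω → ℕ) (rate : ℝ)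
    (P : Measure Ω) : Prop where
  measurable : ∀ t, Measurable (N t)
  zero : ∀ᵐ ω ∂P, N 0 ω = 0
  indep : HasIndepIncrements N P
  law : ∀ s t, s ≤ t →
    P.map (fun ω => N t ω - N s ω) = poissonMeasure (rate.toNNReal * (t - s))
  mono : ∀ᵐ ω ∂P, Monotone fun t => N t ω
  rightCont : ∀ᵐ ω ∂P, ∀ t, ContinuousWithinAt (fun u => N u ω) (Set.Ici t) t

/-- The jump `n(s) - n(s-)` of a counting path at time `s`. -/
def jump (n : ℝ≥0 → ℕ) (s : ℝ≥0) : ℝ :=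
  (n s : ℝ) - Function.leftLim (fun u => (n u : ℝ)) s

/-- The pathwise integral `∫_(0,t] f dn` against a counting path `n`: the sum, over the finitely
many jump times of `n` in `(0, t]`, of `f` times the jump. -/
def jumpIntegral (f : ℝ≥0 → ℝ) (n : ℝ≥0 → ℕ) (t : ℝ≥0) : ℝ :=
  ∑ᶠ s ∈ Set.Ioc 0 t, f s * jump n s

/-- The data of the adaptive Poisson disorder problem under the reference probability measure
`P₀`: the observed process `N`, the disorder time `θ`, the post-disorder arrival rate `Λ`, the
pre-disorder rate `μ`, the disorder rate `lam` and the prior mass `π₀` of `θ = 0`. -/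
structure Model (Ω : Type*) [MeasurableSpace Ω] where
  P₀ : Measure Ω
  N : ℝ≥0 → Ω → ℕ
  θ : Ω → ℝ
  Λ : Ω → ℝ
  μ : ℝ
  lam : ℝ
  π₀ : ℝ
  isProb : IsProbabilityMeasure P₀
  mu_pos : 0 < μ
  lam_pos : 0 < lam
  pi_nonneg : 0 ≤ π₀
  pi_lt_one : π₀ < 1
  poisson : IsPoisson N μ P₀
  theta_meas : Measurable θ
  Lambda_meas : Measurable Λ
  /-- `θ`, `Λ` and the process `N` are mutually independent. -/
  indep_theta_Lambda : IndepFun θ Λ P₀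
  indep_N : IndepFun (fun ω => (θ ω, Λ ω)) (fun ω t => N t ω) P₀
  theta_zero : P₀ {ω | θ ω = 0} = ENNReal.ofReal π₀
  theta_tail : ∀ t : ℝ, 0 ≤ t →
    P₀ {ω | t < θ ω} = ENNReal.ofReal ((1 - π₀) * Real.exp (-lam * t))
  /-- An arrival rate is positive, so that `log (Λ / μ)` is meaningful. -/
  Lambda_pos : ∀ᵐ ω ∂P₀, 0 < Λ ω
  moments : ∀ k : ℕ, Integrable (fun v => (v - μ) ^ k) (P₀.map Λ)

namespace Model

variable {Ω : Type*} [mΩ : MeasurableSpace Ω] (M : Model Ω)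

/-- The law of the post-disorder arrival rate. -/
def ν : Measure ℝ := M.P₀.map M.Λ

/-- The `k`-th moment of `Λ - μ`. -/
def m (k : ℕ) : ℝ := ∫ v, (v - M.μ) ^ k ∂M.ν

/-- The filtration generated by `N` together with the `P₀`-null events. -/
def rawFiltration : Filtration ℝ≥0 mΩ where
  seq t := (⨆ s, ⨆ _ : s ≤ t, MeasurableSpace.comap (M.N s) ⊤) ⊔
    MeasurableSpace.generateFrom {A | MeasurableSet A ∧ M.P₀ A = 0}
  mono' _ _ hst := sup_le_sup_right (biSup_mono fun _ hu => hu.trans hst) _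
  le' _ := sup_le
    (iSup₂_le fun u _ => measurable_iff_comap_le.mp (M.poisson.measurable u))
    (MeasurableSpace.generateFrom_le fun _ hA => hA.1)

/-- The observation filtration `𝔽`: the right-continuous augmentation of the natural filtration
of `N`. -/
def F : Filtration ℝ≥0 mΩ := M.rawFiltration.rightCont

/-- The arrival rate `h(t)`, equal to `μ` before the disorder and to `Λ` from then on. -/
def h (t : ℝ≥0) (ω : Ω) : ℝ := if (t : ℝ) < M.θ ω then M.μ else M.Λ ω

/-- The density process
`Z_t = exp (∫_(0,t] log (h(s-)/μ) dN_s - ∫_0^t (h(s) - μ) ds)`. -/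
def Z (t : ℝ≥0) (ω : Ω) : ℝ :=
  Real.exp (jumpIntegral (fun s => Real.log (Function.leftLim (fun u => M.h u ω) s / M.μ))
      (fun u => M.N u ω) t
    - ∫ s in (0 : ℝ)..t, (M.h s.toNNReal ω - M.μ))

/-- The physical probability measure on events up to time `t`, that is on
`𝒢_t = 𝓕_t ∨ σ(θ, Λ)`: it has density `Z_t` with respect to `P₀`. By the martingale property of
`Z` these measures agree, for different horizons, on the events that both of them describe. -/
def P (t : ℝ≥0) : Measure Ω := M.P₀.withDensity fun ω => ENNReal.ofReal (M.Z t ω)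

/-- The posterior probability `Π_t = P(θ ≤ t | 𝓕_t)`. -/
def posterior (t : ℝ≥0) : Ω → ℝ := (M.P t)⟦{ω | M.θ ω ≤ t} | M.F t⟧

/-- The quotient `E[(Λ - μ)^k 1_{θ ≤ t} | 𝓕_t] / (1 - Π_t)`, determined up to a null event for
each fixed `t`. -/
def oddsRatio (k : ℕ) (t : ℝ≥0) (ω : Ω) : ℝ :=
  ((M.P t)[Set.indicator {ω | M.θ ω ≤ t} (fun ω => (M.Λ ω - M.μ) ^ k) | M.F t]) ω
    / (1 - M.posterior t ω)

/-- `Φ k`, `k = 0, 1, …`, are adapted, càdlàg versions of the weighted odds-ratio processes. -/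
structure IsOddsRatioFamily (Φ : ℕ → ℝ≥0 → Ω → ℝ) : Prop where
  adapted : ∀ k, Adapted M.F (Φ k)
  cadlag : ∀ᵐ ω ∂M.P₀, ∀ k, IsCadlag fun t => Φ k t ω
  version : ∀ k t, Φ k t =ᵐ[M.P t] M.oddsRatio k t

/-- The coupled jump equations
`dΦ^(k)_t = lam (m^(k) + Φ^(k)_t) dt + (1/μ) Φ^(k+1)_{t-} (dN_t - μ dt)`,
`Φ^(k)_0 = π₀/(1-π₀) m^(k)`, in integrated form, along one path. -/
def SolvesJumpEquations (Φ : ℕ → ℝ≥0 → Ω → ℝ) (ω : Ω) : Prop :=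
  ∀ (k : ℕ) (t : ℝ≥0),
    Φ k t ω = M.π₀ / (1 - M.π₀) * M.m k
      + (∫ s in (0 : ℝ)..t, M.lam * (M.m k + Φ k s.toNNReal ω))
      + 1 / M.μ *
        (jumpIntegral (Function.leftLim fun u => Φ (k + 1) u ω) (fun u => M.N u ω) t
          - M.μ * ∫ s in (0 : ℝ)..t, Function.leftLim (fun u => Φ (k + 1) u ω) s.toNNReal)

/-- `P(τ < θ)`, obtained as the increasing limit of the probabilities of `τ < θ ≤ n`, which are
events up to time `n`; here `θ < ∞` almost surely. -/
def falseAlarm (τ : Ω → ℝ≥0∞) : ℝ≥0∞ :=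
  ⨆ n : ℕ, M.P n {ω | τ ω < ENNReal.ofReal (M.θ ω) ∧ M.θ ω ≤ n}

/-- `E (τ - θ)⁺`, obtained as the increasing limit of `E (τ ∧ n - θ)⁺` (the subtraction in
`[0, ∞]` is truncated at zero). -/
def expectedDelay (τ : Ω → ℝ≥0∞) : ℝ≥0∞ :=
  ⨆ n : ℕ, ∫⁻ ω, (min (τ ω) n - ENNReal.ofReal (M.θ ω)) ∂M.P n

/-- The Bayes risk `P(τ < θ) + c E (τ - θ)⁺` of an alarm time. -/
def bayesRisk (c : ℝ) (τ : Ω → ℝ≥0∞) : ℝ≥0∞ :=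
  M.falseAlarm τ + ENNReal.ofReal c * M.expectedDelay τ

/-- `E₀ ∫_0^τ e^(-lam t) (g (Y_t))⁺ dt`, the positive part of a discounted running cost. -/
def discountedPosCost {E : Type*} (g : E → ℝ) (Y : ℝ≥0 → Ω → E)
    (τ : Ω → ℝ≥0∞) : ℝ≥0∞ :=
  ∫⁻ ω, (∫⁻ t in {t : ℝ | 0 ≤ t ∧ ENNReal.ofReal t < τ ω},
    ENNReal.ofReal (Real.exp (-M.lam * t) * g (Y t.toNNReal ω))) ∂M.P₀

/-- Time-homogeneous Markov property of `Y` relative to the observation filtration, when the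
events up to time `t` have the probabilities `Q t`. -/
def IsMarkov {d : ℕ} (Q : ℝ≥0 → Measure Ω) (Y : ℝ≥0 → Ω → Fin d → ℝ) : Prop :=
  ∃ κ : ℝ≥0 → Kernel (Fin d → ℝ) (Fin d → ℝ), (∀ t, IsMarkovKernel (κ t)) ∧
    ∀ (s t : ℝ≥0) (B : Set (Fin d → ℝ)), MeasurableSet B →
      (Q (s + t))⟦Y (s + t) ⁻¹' B | M.F s⟧ =ᵐ[Q (s + t)] fun ω => (κ t (Y s ω)).real B

/-- A `d`-dimensional Markovian sufficient statistic for the quickest detection problem. -/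
structure IsMarkovSufficientStatistic {d : ℕ} (Y : ℝ≥0 → Ω → Fin d → ℝ) : Prop where
  /-- It is computed from the observations. -/
  adapted : Adapted M.F Y
  /-- It is a Markov process under the reference measure. -/
  markov_ref : M.IsMarkov (fun _ => M.P₀) Y
  /-- It is a Markov process under the physical measure. -/
  markov : M.IsMarkov M.P Y
  /-- Its current value determines the posterior law of the unobserved regime
  `(1_{θ ≤ t}, Λ)`. -/
  posterior : ∀ B : Set ℝ, MeasurableSet B → ∃ q₁ q₀ : (Fin d → ℝ) → ℝ,
    Measurable q₁ ∧ Measurable q₀ ∧ ∀ t : ℝ≥0,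
      (M.P t)⟦{ω | M.θ ω ≤ t ∧ M.Λ ω ∈ B} | M.F t⟧ =ᵐ[M.P t] (fun ω => q₁ (Y t ω)) ∧
      (M.P t)⟦{ω | (t : ℝ) < M.θ ω ∧ M.Λ ω ∈ B} | M.F t⟧ =ᵐ[M.P t] (fun ω => q₀ (Y t ω))
  /-- Minimizing the Bayes risk is an optimal stopping problem for it, with discount rate `lam`:
  `R_τ = (1-π₀) + c (1-π₀) E₀ ∫_0^τ e^(-lam t) g (Y_t) dt` for every stopping time `τ`. The
  negative part of the cost, whose expectation is finite, stands on the left. -/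
  risk : ∀ c : ℝ, 0 < c → ∃ g : (Fin d → ℝ) → ℝ, Measurable g ∧
    ∀ τ : Ω → ℝ≥0∞, IsStoppingTime M.F τ →
      M.discountedPosCost (fun y => -g y) Y τ < ∞ ∧
      M.bayesRisk c τ
          + ENNReal.ofReal (c * (1 - M.π₀)) * M.discountedPosCost (fun y => -g y) Y τ
        = ENNReal.ofReal (1 - M.π₀)
          + ENNReal.ofReal (c * (1 - M.π₀)) * M.discountedPosCost g Y τ

/-- The polynomial `p(v) = ∏ᵢ (v - λᵢ + μ)`. -/
def ratePoly {k : ℕ} (rates : Fin k → ℝ) : ℝ[X] := ∏ i, (X - C (rates i) + C M.μ)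

end Model

end PoissonDisorder

end

noncomputable section

namespace PoissonDisorder

/-! Under `P₀` the path is independent of `(θ, Λ)`, so by Bayes' formula a conditional expectation
under the physical measure is a quotient of two integrals, over the prior law of `(θ, Λ)`, of the
likelihood ratio of the observed path. A disorder at time `u` with new rate `v` has likelihood ratio
`1` while `u > t`, and `exp (-(v - μ)(t - u)) (v/μ) ^ (N_t - N_u)` afterwards. The event `θ > t`
then contributes the survival probability `(1 - π₀) exp (-lam t)`. The event `θ ≤ t`, for fixed `v`,
contributes the same factor times `odds v t = weight_t (a + ∫_0^t lam / weight_s ds)` with `a = π₀ /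
(1 - π₀)`. Hence `Φ^(k)_t = ∫ (v - μ)^k odds v t ν(dv)`, which is `momentOdds`, and `1 - Π_t = 1 /
(1 + Φ^(0)_t)`. This explicit version is càdlàg by dominated convergence, and any two càdlàg
versions agree almost surely because they agree at countably many dense times.

For one rate `v` the odds ratio solves a linear equation along the path: right derivative `lam +
(lam - (v - μ)) odds`, and multiplication by `v/μ` at each jump, all jumps having size one almost
surely (`odds_eq`). Multiplying by `(v - μ)^k` and integrating over `ν` turns each factor `v - μ`
into a step from order `k` to order `k + 1`; this is the system of jump equations (`momentOdds_eq`).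

If `ν` lives on at most `k` points, every function of the rate is `ν`-a.e. a polynomial of degree
less than `k` in `v - μ`. So every integral `∫ φ(v) odds v t ν(dv)` is a linear form in `Y_t`, which
gives the posterior law; and the polynomial that vanishes on the support gives the linear relation.
The odds ratio at `s + t` is affine in the one at `s`, with coefficients depending on `v` and on the
increments after `s` (`odds_add`), so `Y_{s+t}` is a measurable function of `Y_s` and of a path
independent of `F_s`. This is the Markov property under `P₀`. Under the physical measure the
transition kernel is reweighted by `1 + Φ^(0)`, to which the conditional density is proportional
(`isMarkov_of_flow`).

For the risk, `τ < u` is decided before a disorder at `u` has any influence, so the false alarm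
probability may be computed under `P₀`, where it is `(1 - π₀)(1 - E₀ ∫_0^τ lam exp (-lam t) dt)`.
The expected delay is `∫ P(θ ≤ t < τ) dt = (1 - π₀) E₀ ∫_0^τ exp (-lam t) Φ^(0)_t dt`. Together they
give the running cost `g(y) = y_0 - lam / c`. -/

lemma tendsto_toNNReal_nhds (x : ℝ≥0) : Tendsto Real.toNNReal (𝓝 (x : ℝ)) (𝓝 x) := by
  have := continuous_real_toNNReal.tendsto (x : ℝ)
  rwa [Real.toNNReal_coe] at this

lemma tendsto_toNNReal_nhdsLT {x : ℝ≥0} (h0 : 0 < x) :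
    Tendsto Real.toNNReal (𝓝[<] (x : ℝ)) (𝓝[<] x) := by
  refine tendsto_nhdsWithin_iff.2 ⟨(tendsto_toNNReal_nhds x).mono_left nhdsWithin_le_nhds, ?_⟩
  filter_upwards [self_mem_nhdsWithin] with s hs
  have h := (Real.toNNReal_lt_toNNReal_iff (by exact_mod_cast h0)).2 (Set.mem_Iio.1 hs)
  rwa [Real.toNNReal_coe] at h

lemma tendsto_toNNReal_nhdsGT (x : ℝ≥0) : Tendsto Real.toNNReal (𝓝[>] (x : ℝ)) (𝓝[≥] x) := by
  refine tendsto_nhdsWithin_iff.2 ⟨(tendsto_toNNReal_nhds x).mono_left nhdsWithin_le_nhds, ?_⟩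
  filter_upwards [self_mem_nhdsWithin] with s hs
  exact NNReal.le_toNNReal_of_coe_le (le_of_lt hs)

/-! ### Counting paths and calculus along them -/

/-- A nondecreasing right-continuous counting path. -/
structure IsCountingPath (n : ℝ≥0 → ℕ) : Prop where
  mono : Monotone n
  rightCont : ∀ t, ContinuousWithinAt n (Set.Ici t) t

namespace IsCountingPath

variable {n : ℝ≥0 → ℕ} (hn : IsCountingPath n)
include hn

lemma eventually_right (t : ℝ≥0) : ∀ᶠ s in 𝓝[≥] t, n s = n t := by
  have := hn.rightCont t
  rwa [ContinuousWithinAt, nhds_discrete, tendsto_pure] at this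

lemma exists_right (t : ℝ≥0) : ∃ u, t < u ∧ ∀ s, t ≤ s → s < u → n s = n t := by
  have := hn.eventually_right t
  obtain ⟨u, hu, h⟩ := (mem_nhdsGE_iff_exists_Ico_subset' (lt_add_one t)).1 this
  exact ⟨u, hu, fun s h1 h2 => h ⟨h1, h2⟩⟩

lemma exists_left {t : ℝ≥0} (ht : 0 < t) :
    ∃ u, u < t ∧ ∀ s, u ≤ s → s < t → n s = Function.leftLim n t := by
  have := hn.mono.tendsto_leftLim t
  rw [nhds_discrete, tendsto_pure] at this
  obtain ⟨u, hu, h⟩ := (mem_nhdsLT_iff_exists_Ioo_subset' ht).1 this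
  obtain ⟨v, hv, hv'⟩ := exists_between (Set.mem_Iio.1 hu)
  exact ⟨v, hv', fun s h1 h2 => h ⟨hv.trans_le h1, h2⟩⟩

lemma leftLim_cast {t : ℝ≥0} (ht : 0 < t) :
    Function.leftLim (fun u => (n u : ℝ)) t = Function.leftLim n t := by
  have : (𝓝[<] t).NeBot := nhdsLT_neBot_of_exists_lt ⟨0, ht⟩
  refine leftLim_eq_of_tendsto ?_
  have := hn.mono.tendsto_leftLim t
  rw [nhds_discrete, tendsto_pure] at this
  exact tendsto_const_nhds.congr' (this.mono fun s hs => by simp only [hs])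

lemma jump_eq {t : ℝ≥0} (ht : 0 < t) :
    jump n t = (n t : ℝ) - (Function.leftLim n t : ℕ) := by
  rw [jump, hn.leftLim_cast ht]

lemma jump_eq_zero {u t : ℝ≥0} (hut : u < t) (h : n u = n t) : jump n t = 0 := by
  have h0 : 0 < t := lt_of_le_of_lt (zero_le) hut
  rw [hn.jump_eq h0]
  have h1 := hn.mono.leftLim_le (le_refl t)
  have h2 := hn.mono.le_leftLim hut
  have : Function.leftLim n t = n t := by omega
  rw [this, sub_self]

/-- The path takes different values at different jump times, and its values up to `t` are natural
numbers below `n t`. -/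
lemma finite_jumps (t : ℝ≥0) : {s | s ∈ Set.Ioc 0 t ∧ jump n s ≠ 0}.Finite := by
  refine Set.Finite.of_finite_image (f := n) ((Set.finite_Iic (n t)).subset ?_) ?_
  · rintro _ ⟨s, hs, rfl⟩
    exact hn.mono hs.1.2
  · have key : ∀ a b : ℝ≥0, a < b → jump n b ≠ 0 → n a ≠ n b := fun a b hab hb h =>
      hb (hn.jump_eq_zero hab h)
    intro a ha b hb hab
    rcases lt_trichotomy a b with h | h | h
    · exact absurd hab (key a b h hb.2)
    · exact h
    · exact absurd hab.symm (key b a h ha.2)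

lemma jumpIntegral_eq_add (c : ℝ≥0 → ℝ) {s t : ℝ≥0} (hst : s ≤ t) :
    jumpIntegral c n t = jumpIntegral c n s + ∑ᶠ u ∈ Set.Ioc s t, c u * jump n u := by
  rw [jumpIntegral, ← Set.Ioc_union_Ioc_eq_Ioc (zero_le (a := s)) hst]
  refine finsum_mem_union' (Set.disjoint_left.2 fun x hx hx' => absurd hx.2 (not_le.2 hx'.1)) ?_ ?_
  · refine (hn.finite_jumps s).subset fun x hx => ⟨hx.1, fun h => hx.2 ?_⟩
    simp [h]
  · refine (hn.finite_jumps t).subset fun x hx =>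
      ⟨⟨lt_of_le_of_lt zero_le hx.1.1, hx.1.2⟩, fun h => hx.2 ?_⟩
    simp [h]

lemma jumpIntegral_right (c : ℝ≥0 → ℝ) (t : ℝ≥0) :
    ∀ᶠ s in 𝓝[≥] t, jumpIntegral c n s = jumpIntegral c n t := by
  obtain ⟨u, hu, h⟩ := hn.exists_right t
  filter_upwards [Ico_mem_nhdsGE hu] with s hs
  rw [hn.jumpIntegral_eq_add c hs.1, finsum_mem_eq_zero_of_forall_eq_zero, add_zero]
  intro x hx
  rw [hn.jump_eq_zero hx.1 (h x hx.1.le (hx.2.trans_lt hs.2)).symm, mul_zero]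

lemma jumpIntegral_left (c : ℝ≥0 → ℝ) {t : ℝ≥0} (ht : 0 < t) :
    ∀ᶠ s in 𝓝[<] t, jumpIntegral c n s = jumpIntegral c n t - c t * jump n t := by
  obtain ⟨u, hu, h⟩ := hn.exists_left ht
  filter_upwards [Ico_mem_nhdsLT hu] with s hs
  rw [hn.jumpIntegral_eq_add c hs.2.le, eq_sub_iff_add_eq, add_right_inj]
  rw [← Set.Ioo_union_right hs.2, finsum_mem_union' (by simp), finsum_mem_singleton,
    finsum_mem_eq_zero_of_forall_eq_zero, zero_add]
  · intro x hx
    change c x * jump n x = 0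
    rw [hn.jump_eq_zero hx.1, mul_zero]
    rw [h s hs.1 hs.2, h x (hs.1.trans hx.1.le) hx.2]
  · refine (Set.finite_empty).subset fun x hx => hx.2 ?_
    have hx := hx.1
    change c x * jump n x = 0
    rw [hn.jump_eq_zero hx.1, mul_zero]
    rw [h s hs.1 hs.2, h x (hs.1.trans hx.1.le) hx.2]
  · exact (Set.finite_singleton t).subset fun x hx => hx.1

/-- Fundamental theorem of calculus for a path which is right-differentiable and jumps only with
the counting path `n`. -/
lemma eq_add_integral_add_jumpIntegral {f g c : ℝ≥0 → ℝ}
    (hder : ∀ t : ℝ≥0, HasDerivWithinAt (fun s : ℝ => f s.toNNReal) (g t) (Set.Ioi (t : ℝ)) t)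
    (hleft : ∀ t, 0 < t → Tendsto f (𝓝[<] t) (𝓝 (f t - c t * jump n t)))
    (hint : ∀ t : ℝ≥0, IntervalIntegrable (fun s => g s.toNNReal) volume 0 t) (t : ℝ≥0) :
    f t = f 0 + (∫ s in (0 : ℝ)..t, g s.toNNReal) + jumpIntegral c n t := by
  -- Subtracting the accumulated jumps leaves a continuous function with the same right derivative,
  -- to which the fundamental theorem for right derivatives applies.
  set H : ℝ → ℝ := fun s => f s.toNNReal - jumpIntegral c n s.toNNReal with hH
  have hderH : ∀ x : ℝ≥0, HasDerivWithinAt H (g x) (Set.Ioi (x : ℝ)) x := by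
    intro x
    have hJ : HasDerivWithinAt (fun s : ℝ => jumpIntegral c n s.toNNReal) 0
        (Set.Ioi (x : ℝ)) x := by
      refine (hasDerivWithinAt_const (x : ℝ) _ (jumpIntegral c n x)).congr_of_eventuallyEq ?_
        (by simp)
      exact (tendsto_toNNReal_nhdsGT x).eventually (hn.jumpIntegral_right c x)
    have := (hder x).sub hJ
    rwa [sub_zero] at this
  have hcont : ContinuousOn H (Set.Icc 0 t) := by
    intro x hx
    lift x to ℝ≥0 using hx.1
    have hR := (hderH x).continuousWithinAt
    rcases eq_or_lt_of_le (zero_le (a := x)) with h0 | h0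
    · refine ContinuousWithinAt.mono (t := Set.Ici (x : ℝ)) (continuousWithinAt_Ioi_iff_Ici.1 hR) ?_
      rw [← h0]
      exact fun y hy => hy.1
    · refine (continuousAt_iff_continuous_left'_right'.2 ⟨?_, hR⟩).continuousWithinAt
      have h1 := (hleft x h0).comp (tendsto_toNNReal_nhdsLT h0)
      have h2 : Tendsto (fun s : ℝ => jumpIntegral c n s.toNNReal) (𝓝[<] (x : ℝ))
          (𝓝 (jumpIntegral c n x - c x * jump n x)) :=
        tendsto_const_nhds.congr' (((tendsto_toNNReal_nhdsLT h0).eventually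
          (hn.jumpIntegral_left c h0)).mono
          fun s hs => hs.symm)
      have h3 := h1.sub h2
      rw [sub_sub_sub_cancel_right] at h3
      simpa [ContinuousWithinAt, hH] using h3
  have key := intervalIntegral.integral_eq_sub_of_hasDeriv_right_of_le (a := 0) (b := (t : ℝ))
    t.2 hcont (fun x hx => by
      lift x to ℝ≥0 using hx.1.le
      simpa using hderH x) (f' := fun s => g s.toNNReal) (hint t)
  have h0 : jumpIntegral c n 0 = 0 := by simp [jumpIntegral]
  simp only [hH, Real.toNNReal_coe, Real.toNNReal_zero, h0] at key
  linarith

lemma jumpIntegral_const (c : ℝ) (t : ℝ≥0) :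
    jumpIntegral (fun _ => c) n t = c * ((n t : ℝ) - n 0) := by
  have := hn.eq_add_integral_add_jumpIntegral (f := fun s => c * n s) (g := 0) (c := fun _ => c)
    (fun t => ?_) (fun t ht => ?_) (fun t => by simp) t
  · simp only [Pi.zero_apply, intervalIntegral.integral_zero] at this
    linarith
  · refine (hasDerivWithinAt_const (t : ℝ) _ (c * (n t : ℝ))).congr_of_eventuallyEq ?_ (by simp)
    have h : Tendsto Real.toNNReal (𝓝[>] (t : ℝ)) (𝓝[≥] t) := tendsto_toNNReal_nhdsGT t
    filter_upwards [h.eventually (hn.eventually_right t)] with s hs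
    rw [hs]
  · have h := hn.mono.tendsto_leftLim t
    rw [nhds_discrete, tendsto_pure] at h
    refine tendsto_const_nhds.congr' (h.mono fun s hs => ?_)
    simp only [hn.jump_eq ht, hs]
    ring

end IsCountingPath

/-! ### Regularization of paths and joint measurability -/

/-- The right-continuous nondecreasing regularization of a path: its infimum over the later times
of a countable dense set. -/
def reg (n : ℝ≥0 → ℕ) (t : ℝ≥0) : ℕ :=
  sInf {j | ∃ i, t < TopologicalSpace.denseSeq ℝ≥0 i ∧ n (TopologicalSpace.denseSeq ℝ≥0 i) = j}

lemma exists_denseSeq_btwn {s t : ℝ≥0} (hst : s < t) :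
    ∃ i, s < TopologicalSpace.denseSeq ℝ≥0 i ∧ TopologicalSpace.denseSeq ℝ≥0 i < t := by
  obtain ⟨_, hx, i, rfl⟩ := (TopologicalSpace.denseRange_denseSeq ℝ≥0).inter_open_nonempty
    _ isOpen_Ioo (Set.nonempty_Ioo.2 hst)
  exact ⟨i, hx.1, hx.2⟩

lemma reg_set_nonempty (n : ℝ≥0 → ℕ) (t : ℝ≥0) :
    {j | ∃ i, t < TopologicalSpace.denseSeq ℝ≥0 i ∧
      n (TopologicalSpace.denseSeq ℝ≥0 i) = j}.Nonempty := by
  obtain ⟨i, hi, -⟩ := exists_denseSeq_btwn (lt_add_one t)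
  exact ⟨_, i, hi, rfl⟩

lemma reg_le_iff {n : ℝ≥0 → ℕ} {t : ℝ≥0} {j : ℕ} :
    reg n t ≤ j ↔ ∃ i, t < TopologicalSpace.denseSeq ℝ≥0 i ∧
      n (TopologicalSpace.denseSeq ℝ≥0 i) ≤ j := by
  constructor
  · intro h
    obtain ⟨i, hi, h'⟩ := Nat.sInf_mem (reg_set_nonempty n t)
    exact ⟨i, hi, h'.trans_le h⟩
  · rintro ⟨i, hi, h⟩
    exact (Nat.sInf_le (s := {j | ∃ i, t < TopologicalSpace.denseSeq ℝ≥0 i ∧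
      n (TopologicalSpace.denseSeq ℝ≥0 i) = j}) ⟨i, hi, rfl⟩).trans h

lemma isCountingPath_reg (n : ℝ≥0 → ℕ) : IsCountingPath (reg n) := by
  have hm : Monotone (reg n) := by
    intro s t hst
    obtain ⟨i, hi, h⟩ := reg_le_iff.1 (le_refl (reg n t))
    exact reg_le_iff.2 ⟨i, hst.trans_lt hi, h⟩
  refine ⟨hm, fun t => ?_⟩
  obtain ⟨i, hi, h⟩ := reg_le_iff.1 (le_refl (reg n t))
  rw [ContinuousWithinAt, nhds_discrete, tendsto_pure]
  filter_upwards [Ico_mem_nhdsGE hi] with s hs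
  exact le_antisymm (reg_le_iff.2 ⟨i, hs.2, h⟩) (hm hs.1)

lemma IsCountingPath.reg_eq {n : ℝ≥0 → ℕ} (hn : IsCountingPath n) : reg n = n := by
  funext t
  apply le_antisymm
  · obtain ⟨u, hu, h⟩ := hn.exists_right t
    obtain ⟨i, hi, hi'⟩ := exists_denseSeq_btwn hu
    exact reg_le_iff.2 ⟨i, hi, (h _ hi.le hi').le⟩
  · obtain ⟨i, hi, h⟩ := reg_le_iff.1 (le_refl (reg n t))
    exact (hn.mono hi.le).trans h

/-- Evaluation of an arbitrary path at a varying time need not be jointly measurable for the product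
σ-algebra, whereas `reg_le_iff` writes the sublevel sets of `reg` as countable unions. Path
functionals are therefore evaluated at `reg n`, which equals `n` for counting paths. -/
lemma measurable_reg : Measurable fun p : ℝ≥0 × (ℝ≥0 → ℕ) => reg p.2 p.1 := by
  refine measurable_of_Iic fun j => ?_
  have : (fun p : ℝ≥0 × (ℝ≥0 → ℕ) => reg p.2 p.1) ⁻¹' Set.Iic j =
      ⋃ i, {p | p.1 < TopologicalSpace.denseSeq ℝ≥0 i} ∩
        {p | p.2 (TopologicalSpace.denseSeq ℝ≥0 i) ≤ j} := by
    ext p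
    simp [reg_le_iff]
  rw [this]
  refine MeasurableSet.iUnion fun i => MeasurableSet.inter ?_ ?_
  · exact measurableSet_lt measurable_fst measurable_const
  · exact measurableSet_le ((measurable_pi_apply _).comp measurable_snd) measurable_const

/-! ### The odds ratio of a known rate along one path -/

/-- The paths whose jumps have size one. -/
def UnitJumps (n : ℝ≥0 → ℕ) : Prop := ∀ t, 0 < t → n t ≤ Function.leftLim n t + 1

/-- The discounted likelihood ratio of a constant rate `v` against the rate `μ`, along a path. -/
def weight (μ lam v : ℝ) (n : ℝ≥0 → ℕ) (t : ℝ≥0) : ℝ :=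
  Real.exp ((lam - (v - μ)) * t) * (v / μ) ^ n t

/-- The odds ratio, given the path up to time `t`, of the hypotheses that the disorder with new
rate `v` has happened or not, when the prior odds are `a`. -/
def odds (μ lam a v : ℝ) (n : ℝ≥0 → ℕ) (t : ℝ≥0) : ℝ :=
  weight μ lam v n t * (a + ∫ s in (0 : ℝ)..t, lam / weight μ lam v n s.toNNReal)

section Measurability

variable (μ lam a : ℝ)

lemma measurable_weight :
    Measurable fun p : ℝ × ℝ≥0 × (ℝ≥0 → ℕ) => weight μ lam p.1 (reg p.2.2) p.2.1 := by
  have h : Measurable fun p : ℝ × ℝ≥0 × (ℝ≥0 → ℕ) => reg p.2.2 p.2.1 :=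
    measurable_reg.comp measurable_snd
  unfold weight
  exact (by fun_prop : Measurable fun p : ℝ × ℝ≥0 × (ℝ≥0 → ℕ) =>
    Real.exp ((lam - (p.1 - μ)) * p.2.1)).mul ((measurable_fst.div_const μ).pow h)

lemma measurable_odds :
    Measurable fun p : ℝ × ℝ≥0 × (ℝ≥0 → ℕ) => odds μ lam a p.1 (reg p.2.2) p.2.1 := by
  unfold odds
  refine (measurable_weight μ lam).mul (measurable_const.add ?_)
  have h : StronglyMeasurable (Function.uncurry fun (p : ℝ × ℝ≥0 × (ℝ≥0 → ℕ)) (s : ℝ) =>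
      {q : (ℝ × ℝ≥0 × (ℝ≥0 → ℕ)) × ℝ | 0 < q.2 ∧ q.2 ≤ q.1.2.1}.indicator
        (fun q => lam / weight μ lam q.1.1 (reg q.1.2.2) q.2.toNNReal) (p, s)) := by
    refine (Measurable.indicator ?_ ?_).stronglyMeasurable
    · exact measurable_const.div ((measurable_weight μ lam).comp
        (f := fun q : (ℝ × ℝ≥0 × (ℝ≥0 → ℕ)) × ℝ => (q.1.1, q.2.toNNReal, q.1.2.2)) (by fun_prop))
    · exact (measurableSet_lt measurable_const measurable_snd).inter
        (measurableSet_le measurable_snd (by fun_prop))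
  convert! (h.integral_prod_right (ν := volume)).measurable using 1
  funext p
  rw [intervalIntegral.integral_of_le (NNReal.coe_nonneg p.2.1),
    ← integral_indicator measurableSet_Ioc]
  rfl

end Measurability

section Path

variable {μ lam a v : ℝ} {n : ℝ≥0 → ℕ}

lemma IsCountingPath.intervalIntegrable_pow (hn : IsCountingPath n) {c : ℝ} (hc : 0 < c)
    (x y : ℝ) : IntervalIntegrable (fun s : ℝ => c ^ n s.toNNReal) volume x y := by
  rcases le_total 1 c with h | h
  · exact Monotone.intervalIntegrable fun s t hst =>
      pow_le_pow_right₀ h (hn.mono (Real.toNNReal_le_toNNReal hst))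
  · exact Antitone.intervalIntegrable fun s t hst =>
      pow_le_pow_of_le_one hc.le h (hn.mono (Real.toNNReal_le_toNNReal hst))

lemma weight_pos (hμ : 0 < μ) (hv : 0 < v) (t : ℝ≥0) : 0 < weight μ lam v n t := by
  unfold weight; positivity

lemma intervalIntegrable_weight (hn : IsCountingPath n) (hμ : 0 < μ) (hv : 0 < v) (x y : ℝ) :
    IntervalIntegrable (fun s : ℝ => weight μ lam v n s.toNNReal) volume x y := by
  unfold weight
  exact (hn.intervalIntegrable_pow (div_pos hv hμ) x y).continuousOn_mul (by fun_prop)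

lemma intervalIntegrable_div_weight (hn : IsCountingPath n) (hμ : 0 < μ) (hv : 0 < v) (x y : ℝ) :
    IntervalIntegrable (fun s : ℝ => lam / weight μ lam v n s.toNNReal) volume x y := by
  have := (hn.intervalIntegrable_pow (inv_pos.2 (div_pos hv hμ)) x y).continuousOn_mul
    (g := fun s : ℝ => lam * Real.exp (-((lam - (v - μ)) * s.toNNReal))) (by fun_prop)
  refine this.congr fun s _ => ?_
  simp only [weight, Real.exp_neg, div_eq_mul_inv, mul_inv]
  ring

lemma continuous_integral_div_weight (hn : IsCountingPath n) (hμ : 0 < μ) (hv : 0 < v) :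
    Continuous fun t : ℝ≥0 => a + ∫ s in (0 : ℝ)..t, lam / weight μ lam v n s.toNNReal :=
  continuous_const.add ((intervalIntegral.continuous_primitive
    (fun x y => intervalIntegrable_div_weight hn hμ hv x y) 0).comp NNReal.continuous_coe)

lemma intervalIntegrable_odds (hn : IsCountingPath n) (hμ : 0 < μ) (hv : 0 < v) (x y : ℝ) :
    IntervalIntegrable (fun s : ℝ => odds μ lam a v n s.toNNReal) volume x y := by
  unfold odds
  exact (intervalIntegrable_weight hn hμ hv x y).mul_continuousOn
    ((continuous_integral_div_weight hn hμ hv).comp continuous_real_toNNReal).continuousOn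

lemma odds_nonneg (hμ : 0 < μ) (hv : 0 < v) (hlam : 0 ≤ lam) (ha : 0 ≤ a) (t : ℝ≥0) :
    0 ≤ odds μ lam a v n t := by
  refine mul_nonneg (weight_pos hμ hv t).le (add_nonneg ha ?_)
  exact intervalIntegral.integral_nonneg t.2 fun s _ => div_nonneg hlam (weight_pos hμ hv _).le

/-- Just after `t` the path is constant, so `weight` is a plain exponential there; in the product
rule the derivative of the integral is multiplied by `weight` and leaves `lam`. -/
lemma hasDerivWithinAt_odds (hn : IsCountingPath n) (hμ : 0 < μ) (hv : 0 < v) (t : ℝ≥0) :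
    HasDerivWithinAt (fun s : ℝ => odds μ lam a v n s.toNNReal)
      (lam + (lam - (v - μ)) * odds μ lam a v n t) (Set.Ioi (t : ℝ)) t := by
  have h1 : HasDerivWithinAt (fun s : ℝ => Real.exp ((lam - (v - μ)) * s) * (v / μ) ^ n t)
      ((lam - (v - μ)) * weight μ lam v n t) (Set.Ioi (t : ℝ)) t := by
    have := (((hasDerivAt_id (t : ℝ)).const_mul (lam - (v - μ))).exp.mul_const
      ((v / μ) ^ n t)).hasDerivWithinAt (s := Set.Ioi (t : ℝ))
    convert! this using 1
    simp only [weight, id]; ring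
  have h2 : HasDerivWithinAt (fun u : ℝ => a + ∫ s in (0 : ℝ)..u,
      lam / weight μ lam v n s.toNNReal) (lam / weight μ lam v n t) (Set.Ioi (t : ℝ)) t := by
    refine HasDerivWithinAt.const_add a ?_
    have hint := intervalIntegrable_div_weight (lam := lam) hn hμ hv 0 t
    have hw : Tendsto (fun s : ℝ => lam / weight μ lam v n s.toNNReal) (𝓝[>] (t : ℝ))
        (𝓝 (lam / weight μ lam v n t)) := by
      have : ∀ᶠ s in 𝓝[>] (t : ℝ), lam / weight μ lam v n s.toNNReal =
          lam / (Real.exp ((lam - (v - μ)) * s) * (v / μ) ^ n t) := by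
        filter_upwards [(tendsto_toNNReal_nhdsGT t).eventually (hn.eventually_right t),
          self_mem_nhdsWithin] with s hs hs'
        rw [weight, hs, Real.coe_toNNReal _ (t.2.trans (le_of_lt hs'))]
      refine Tendsto.congr' (EventuallyEq.symm this) ?_
      have hc : ContinuousAt (fun s : ℝ =>
          lam / (Real.exp ((lam - (v - μ)) * s) * (v / μ) ^ n t)) t := by
        refine ContinuousAt.div (by fun_prop) (by fun_prop) ?_
        have := div_pos hv hμ
        positivity
      exact hc.tendsto.mono_left nhdsWithin_le_nhds
    have := intervalIntegral.integral_hasDerivWithinAt_right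
      (f := fun s : ℝ => lam / weight μ lam v n s.toNNReal) (s := Set.Ici (t : ℝ))
      (t := Set.Ioi (t : ℝ)) hint ?_ ?_
    · have := this.mono Set.Ioi_subset_Ici_self
      simpa using this
    · refine ⟨Set.Ioc t (t + 1), Ioc_mem_nhdsGT (by linarith), ?_⟩
      have := (intervalIntegrable_div_weight (lam := lam) hn hμ hv t (t + 1)).1
      exact this.aestronglyMeasurable
    · simpa [ContinuousWithinAt] using hw
  have h3 := h1.mul h2
  have hval : weight μ lam v n t = Real.exp ((lam - (v - μ)) * t) * (v / μ) ^ n t := rfl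
  have hw0 := (weight_pos (lam := lam) (n := n) hμ hv t).ne'
  refine (h3.congr_deriv ?_).congr_of_eventuallyEq ?_ ?_
  · rw [← hval, odds]
    field_simp
    ring
  · filter_upwards [(tendsto_toNNReal_nhdsGT t).eventually (hn.eventually_right t),
      self_mem_nhdsWithin] with s hs hs'
    simp only [odds, weight, hs, Pi.mul_apply, Real.coe_toNNReal _ (t.2.trans (le_of_lt hs'))]
  · simp [odds, weight]

lemma tendsto_odds_right (hn : IsCountingPath n) (hμ : 0 < μ) (hv : 0 < v) (t : ℝ≥0) :
    Tendsto (odds μ lam a v n) (𝓝[≥] t) (𝓝 (odds μ lam a v n t)) := by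
  unfold odds
  refine Tendsto.mul ?_ ((continuous_integral_div_weight hn hμ hv).tendsto t |>.mono_left
    nhdsWithin_le_nhds)
  have h : Tendsto (fun s : ℝ≥0 => Real.exp ((lam - (v - μ)) * s) * (v / μ) ^ n t) (𝓝[≥] t)
      (𝓝 (weight μ lam v n t)) :=
    (by fun_prop : Continuous fun s : ℝ≥0 =>
      Real.exp ((lam - (v - μ)) * s) * (v / μ) ^ n t).continuousWithinAt
  refine h.congr' ?_
  filter_upwards [hn.eventually_right t] with s hs
  rw [weight, hs]

lemma tendsto_odds_left (hn : IsCountingPath n) (hμ : 0 < μ) (hv : 0 < v) {t : ℝ≥0} :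
    Tendsto (odds μ lam a v n) (𝓝[<] t) (𝓝 (Real.exp ((lam - (v - μ)) * t) *
      (v / μ) ^ Function.leftLim n t *
        (a + ∫ s in (0 : ℝ)..t, lam / weight μ lam v n s.toNNReal))) := by
  unfold odds
  refine Tendsto.mul ?_ ((continuous_integral_div_weight hn hμ hv).tendsto t |>.mono_left
    nhdsWithin_le_nhds)
  have h : Tendsto (fun s : ℝ≥0 => Real.exp ((lam - (v - μ)) * s) *
      (v / μ) ^ Function.leftLim n t) (𝓝[<] t)
      (𝓝 (Real.exp ((lam - (v - μ)) * t) * (v / μ) ^ Function.leftLim n t)) :=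
    (by fun_prop : Continuous fun s : ℝ≥0 =>
      Real.exp ((lam - (v - μ)) * s) * (v / μ) ^ Function.leftLim n t).continuousWithinAt
  refine h.congr' ?_
  have h := hn.mono.tendsto_leftLim t
  rw [nhds_discrete, tendsto_pure] at h
  filter_upwards [h] with s hs
  rw [weight, hs]

lemma leftLim_odds (hn : IsCountingPath n) (hμ : 0 < μ) (hv : 0 < v) {t : ℝ≥0} (ht : 0 < t) :
    Function.leftLim (odds μ lam a v n) t = Real.exp ((lam - (v - μ)) * t) *
      (v / μ) ^ Function.leftLim n t *
        (a + ∫ s in (0 : ℝ)..t, lam / weight μ lam v n s.toNNReal) := by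
  have : (𝓝[<] t).NeBot := nhdsLT_neBot_of_exists_lt ⟨0, ht⟩
  exact leftLim_eq_of_tendsto (tendsto_odds_left hn hμ hv)

/-- The integral factor is continuous and a unit jump multiplies `weight` by `v / μ`. A larger jump
would bring in a higher power and destroy linearity, hence `UnitJumps`. -/
lemma odds_sub_jump (hn : IsCountingPath n) (hu : UnitJumps n) (hμ : 0 < μ) (hv : 0 < v)
    {t : ℝ≥0} (ht : 0 < t) :
    odds μ lam a v n t - (v / μ - 1) * Function.leftLim (odds μ lam a v n) t * jump n t
      = Function.leftLim (odds μ lam a v n) t := by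
  rw [leftLim_odds hn hμ hv ht, hn.jump_eq ht, odds, weight]
  have h1 := hn.mono.leftLim_le (le_refl t)
  have h2 := hu t ht
  rcases Nat.eq_or_lt_of_le h1 with h | h
  · rw [h]; ring
  · have : n t = Function.leftLim n t + 1 := by omega
    rw [this]; push_cast; ring

lemma odds_eq (hn : IsCountingPath n) (h0 : n 0 = 0) (hu : UnitJumps n) (hμ : 0 < μ) (hv : 0 < v)
    (t : ℝ≥0) :
    odds μ lam a v n t = a
      + (∫ s in (0 : ℝ)..t, (lam + (lam - (v - μ)) * odds μ lam a v n s.toNNReal))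
      + jumpIntegral (fun s => (v / μ - 1) * Function.leftLim (odds μ lam a v n) s) n t := by
  have := hn.eq_add_integral_add_jumpIntegral (f := odds μ lam a v n)
    (g := fun s => lam + (lam - (v - μ)) * odds μ lam a v n s)
    (c := fun s => (v / μ - 1) * Function.leftLim (odds μ lam a v n) s)
    (hasDerivWithinAt_odds hn hμ hv) (fun t ht => ?_) (fun t => ?_) t
  · rwa [show odds μ lam a v n 0 = a by simp [odds, weight, h0]] at this
  · rw [odds_sub_jump hn hu hμ hv ht, leftLim_odds hn hμ hv ht]
    exact tendsto_odds_left hn hμ hv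
  · exact intervalIntegrable_const.add ((intervalIntegrable_odds hn hμ hv 0 t).const_mul _)

/-- As `v > 0`, the exponential rate `lam - (v - μ)` is at most `lam + μ`, uniformly in `v`. What
remains is polynomial in `v`, so moments of `ν` suffice for domination. -/
lemma weight_div_le (hn : IsCountingPath n) (hμ : 0 < μ) (hlam : 0 ≤ lam) (hv : 0 < v)
    {u t T : ℝ≥0} (hut : u ≤ t) (htT : t ≤ T) :
    weight μ lam v n t / weight μ lam v n u
      ≤ Real.exp ((lam + μ) * T) * (1 + v / μ) ^ n T := by
  have hr := div_pos hv hμ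
  have h : weight μ lam v n t / weight μ lam v n u =
      Real.exp ((lam - (v - μ)) * (t - u)) * (v / μ) ^ (n t - n u) := by
    rw [weight, weight, pow_sub₀ _ hr.ne' (hn.mono hut), mul_sub, Real.exp_sub]
    field_simp
  rw [h]
  have hut' : (u : ℝ) ≤ t := by exact_mod_cast hut
  have htT' : (t : ℝ) ≤ T := by exact_mod_cast htT
  gcongr ?_ * ?_
  · refine Real.exp_le_exp.2 ?_
    calc (lam - (v - μ)) * ((t : ℝ) - u) ≤ (lam + μ) * ((t : ℝ) - u) :=
          mul_le_mul_of_nonneg_right (by linarith) (by linarith)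
      _ ≤ (lam + μ) * T := mul_le_mul_of_nonneg_left (by linarith [u.2]) (by linarith)
  · calc (v / μ) ^ (n t - n u) ≤ (1 + v / μ) ^ (n t - n u) := by gcongr; linarith
      _ ≤ (1 + v / μ) ^ n T :=
        pow_le_pow_right₀ (by linarith) ((Nat.sub_le _ _).trans (hn.mono htT))

lemma weight_le (hn : IsCountingPath n) (hμ : 0 < μ) (hlam : 0 ≤ lam) (hv : 0 < v)
    {t T : ℝ≥0} (htT : t ≤ T) :
    weight μ lam v n t ≤ Real.exp ((lam + μ) * T) * (1 + v / μ) ^ n T := by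
  have hr := div_pos hv hμ
  have htT' : (t : ℝ) ≤ T := by exact_mod_cast htT
  unfold weight
  gcongr ?_ * ?_
  · refine Real.exp_le_exp.2 ?_
    calc (lam - (v - μ)) * (t : ℝ) ≤ (lam + μ) * (t : ℝ) :=
          mul_le_mul_of_nonneg_right (by linarith) t.2
      _ ≤ (lam + μ) * T := mul_le_mul_of_nonneg_left htT' (by linarith)
  · calc (v / μ) ^ (n t) ≤ (1 + v / μ) ^ (n t) := by gcongr; linarith
      _ ≤ (1 + v / μ) ^ n T := pow_le_pow_right₀ (by linarith) (hn.mono htT)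

lemma odds_le (hn : IsCountingPath n) (hμ : 0 < μ) (hlam : 0 ≤ lam) (hv : 0 < v) (ha : 0 ≤ a)
    {t T : ℝ≥0} (htT : t ≤ T) :
    odds μ lam a v n t ≤ (a + lam * T) * (Real.exp ((lam + μ) * T) * (1 + v / μ) ^ n T) := by
  have htT' : (t : ℝ) ≤ T := by exact_mod_cast htT
  rw [odds, mul_add, add_mul, mul_comm _ a, ← intervalIntegral.integral_const_mul]
  refine add_le_add (mul_le_mul_of_nonneg_left (weight_le hn hμ hlam hv htT) ha) ?_
  have hr := div_pos hv hμ
  set C := Real.exp ((lam + μ) * T) * (1 + v / μ) ^ n T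
  have hC : 0 ≤ C := by positivity
  calc ∫ s in (0 : ℝ)..t, weight μ lam v n t * (lam / weight μ lam v n s.toNNReal)
      ≤ ∫ s in (0 : ℝ)..t, lam * C := by
        refine intervalIntegral.integral_mono_on t.2
          ((intervalIntegrable_div_weight hn hμ hv 0 t).const_mul _) intervalIntegrable_const ?_
        intro s hs
        rw [mul_div_left_comm]
        refine mul_le_mul_of_nonneg_left (weight_div_le hn hμ hlam hv ?_ htT) hlam
        exact Real.toNNReal_le_iff_le_coe.2 hs.2
    _ ≤ lam * T * C := by
        rw [intervalIntegral.integral_const, smul_eq_mul, sub_zero]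
        nlinarith [mul_nonneg hlam hC]

end Path

/-! ### Restarting a path -/

/-- The path after time `s`, started afresh at zero. -/
def shift (s : ℝ≥0) (n : ℝ≥0 → ℕ) (t : ℝ≥0) : ℕ := n (s + t) - n s

lemma IsCountingPath.shift {n : ℝ≥0 → ℕ} (hn : IsCountingPath n) (s : ℝ≥0) :
    IsCountingPath (shift s n) := by
  refine ⟨fun t u htu => Nat.sub_le_sub_right (hn.mono (by gcongr)) _, fun t => ?_⟩
  have h := hn.eventually_right (s + t)
  have h2 : Tendsto (fun u => s + u) (𝓝[≥] t) (𝓝[≥] (s + t)) :=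
    tendsto_nhdsWithin_iff.2 ⟨(continuous_const.add continuous_id).continuousWithinAt,
      eventually_mem_nhdsWithin.mono fun u hu => add_le_add_right (Set.mem_Ici.1 hu) s⟩
  rw [ContinuousWithinAt, nhds_discrete, tendsto_pure]
  filter_upwards [h2.eventually h] with u hu
  rw [PoissonDisorder.shift, hu, PoissonDisorder.shift]

section

variable {μ lam a v : ℝ} {n n' : ℝ≥0 → ℕ}

lemma odds_congr {t : ℝ≥0} (h : ∀ u ≤ t, n u = n' u) :
    odds μ lam a v n t = odds μ lam a v n' t := by
  unfold odds weight
  rw [h t le_rfl]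
  congr 2
  refine intervalIntegral.integral_congr fun s hs => ?_
  rw [Set.uIcc_of_le (NNReal.coe_nonneg t)] at hs
  simp only [h s.toNNReal (Real.toNNReal_le_iff_le_coe.2 hs.2)]

lemma weight_add (hn : IsCountingPath n) (s t : ℝ≥0) :
    weight μ lam v n (s + t) = weight μ lam v n s * weight μ lam v (shift s n) t := by
  have : n (s + t) = n s + shift s n t :=
    (Nat.add_sub_cancel' (hn.mono (le_self_add))).symm
  rw [weight, this, weight, weight, pow_add, NNReal.coe_add, mul_add, Real.exp_add]
  ring

/-- The odds at time `s` play the role of prior odds for the restarted path: they are carried on by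
the new weight, while disorders after `s` contribute the odds ratio with prior odds zero. Splitting
the integral at `s` gives the two terms. -/
lemma odds_add (hn : IsCountingPath n) (hμ : 0 < μ) (hv : 0 < v) (s t : ℝ≥0) :
    odds μ lam a v n (s + t) =
      weight μ lam v (shift s n) t * odds μ lam a v n s + odds μ lam 0 v (shift s n) t := by
  have h1 := intervalIntegral.integral_add_adjacent_intervals
    (intervalIntegrable_div_weight (lam := lam) hn hμ hv 0 s)
    (intervalIntegrable_div_weight (lam := lam) hn hμ hv s (s + t : ℝ≥0))
  have h2 : ∫ r in (s : ℝ)..(s + t : ℝ≥0), lam / weight μ lam v n r.toNNReal =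
      (∫ r in (0 : ℝ)..t, lam / weight μ lam v (shift s n) r.toNNReal) / weight μ lam v n s := by
    rw [← intervalIntegral.integral_div]
    have := intervalIntegral.integral_comp_add_left (a := 0) (b := (t : ℝ))
      (fun r : ℝ => lam / weight μ lam v n r.toNNReal) s
    rw [add_zero] at this
    rw [NNReal.coe_add, ← this]
    refine intervalIntegral.integral_congr fun r hr => ?_
    rw [Set.uIcc_of_le (NNReal.coe_nonneg t)] at hr
    have : ((s : ℝ) + r).toNNReal = s + r.toNNReal := by
      rw [Real.toNNReal_add (NNReal.coe_nonneg s) hr.1, Real.toNNReal_coe]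
    simp only [this, weight_add hn]
    rw [div_div, mul_comm]
  have hw := (weight_pos (lam := lam) (n := n) hμ hv s).ne'
  rw [odds, odds, odds, ← h1, h2, weight_add hn]
  field_simp
  ring

lemma measurable_odds_path (hn : IsCountingPath n) :
    Measurable fun p : ℝ × ℝ≥0 => odds μ lam a p.1 n p.2 := by
  have := (measurable_odds μ lam a).comp
    (by fun_prop : Measurable fun p : ℝ × ℝ≥0 => (p.1, p.2, n))
  simpa [Function.comp_def, hn.reg_eq] using this

/-- This form shows that the left limit is measurable in `v`. -/
lemma leftLim_odds_eq_div (hn : IsCountingPath n) (hμ : 0 < μ) (hv : 0 < v) {t : ℝ≥0}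
    (ht : 0 < t) :
    Function.leftLim (odds μ lam a v n) t =
      odds μ lam a v n t / (v / μ) ^ (n t - Function.leftLim n t) := by
  have hr := div_pos hv hμ
  rw [leftLim_odds hn hμ hv ht, odds, weight,
    ← Nat.add_sub_cancel' (hn.mono.leftLim_le (le_refl t)), Nat.add_sub_cancel_left, pow_add]
  field_simp

lemma leftLim_odds_nonneg (hn : IsCountingPath n) (hμ : 0 < μ) (hv : 0 < v) (hlam : 0 ≤ lam)
    (ha : 0 ≤ a) {t : ℝ≥0} (ht : 0 < t) : 0 ≤ Function.leftLim (odds μ lam a v n) t := by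
  have hr := div_pos hv hμ
  rw [leftLim_odds_eq_div hn hμ hv ht]
  exact div_nonneg (odds_nonneg hμ hv hlam ha t) (by positivity)

lemma leftLim_odds_le (hn : IsCountingPath n) (hμ : 0 < μ) (hlam : 0 ≤ lam) (hv : 0 < v)
    (ha : 0 ≤ a) {t T : ℝ≥0} (ht : 0 < t) (htT : t ≤ T) :
    Function.leftLim (odds μ lam a v n) t
      ≤ (a + lam * T) * (Real.exp ((lam + μ) * T) * (1 + v / μ) ^ n T) := by
  have : (𝓝[<] t).NeBot := nhdsLT_neBot_of_exists_lt ⟨0, ht⟩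
  have h := tendsto_odds_left (lam := lam) (a := a) hn hμ hv (t := t)
  rw [← leftLim_odds hn hμ hv ht] at h
  refine le_of_tendsto h ?_
  filter_upwards [self_mem_nhdsWithin] with s hs
  exact odds_le hn hμ hlam hv ha ((le_of_lt hs).trans htT)

lemma IsCountingPath.jumpIntegral_eq_sum (hn : IsCountingPath n) (c : ℝ≥0 → ℝ) (t : ℝ≥0) :
    jumpIntegral c n t = ∑ s ∈ (hn.finite_jumps t).toFinset, c s * jump n s := by
  refine finsum_mem_eq_sum_of_inter_support_eq _ ?_
  ext s
  simp only [Set.mem_inter_iff, Function.mem_support, Set.Finite.coe_toFinset, Set.mem_ofPred_eq]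
  constructor
  · rintro ⟨h1, h2⟩
    exact ⟨⟨h1, right_ne_zero_of_mul h2⟩, h2⟩
  · rintro ⟨h1, h2⟩
    exact ⟨h1.1, h2⟩

end

/-! ### Moments of the odds ratio and their jump equations -/

/-- The weighted odds ratio of order `k` along a path: the integral of `(v - μ) ^ k` times the odds
ratio of the rate `v` over the prior law of the rate. -/
def momentOdds (μ lam a : ℝ) (ν : Measure ℝ) (k : ℕ) (n : ℝ≥0 → ℕ) (t : ℝ≥0) : ℝ :=
  ∫ v, (v - μ) ^ k * odds μ lam a v n t ∂ν

section

variable {μ lam a : ℝ} {ν : Measure ℝ} {n : ℝ≥0 → ℕ}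

lemma integrable_eval (hm : ∀ k : ℕ, Integrable (fun v => (v - μ) ^ k) ν) (p : ℝ[X]) :
    Integrable (fun v => p.eval (v - μ)) ν := by
  simp only [Polynomial.eval_eq_sum_range]
  exact integrable_finsetSum _ fun i _ => (hm i).const_mul _

/-- Since `1 + v / μ = 2 + (v - μ) / μ`, this is the absolute value of a polynomial in `v - μ`
wherever `v > 0`. -/
lemma integrable_pow_mul_pow (hm : ∀ k : ℕ, Integrable (fun v => (v - μ) ^ k) ν) (hμ : 0 < μ)
    (hpos : ∀ᵐ v ∂ν, 0 < v) (k j : ℕ) :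
    Integrable (fun v => |v - μ| ^ k * (1 + v / μ) ^ j) ν := by
  refine (integrable_eval hm (X ^ k * (C 2 + C μ⁻¹ * X) ^ j)).norm.congr ?_
  filter_upwards [hpos] with v hv
  have h2 : 2 + μ⁻¹ * (v - μ) = 1 + v / μ := by field_simp; ring
  have hr := div_pos hv hμ
  simp only [eval_mul, eval_pow, eval_add, eval_C, eval_X, h2, norm_mul, norm_pow,
    Real.norm_eq_abs, abs_of_pos (by linarith : 0 < 1 + v / μ)]

/-- The dominating function for weighted odds ratios up to time `T`. -/
def oddsBound (μ lam a : ℝ) (k : ℕ) (n : ℝ≥0 → ℕ) (T : ℝ≥0) (v : ℝ) : ℝ :=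
  (a + lam * T) * Real.exp ((lam + μ) * T) * (|v - μ| ^ k * (1 + v / μ) ^ n T)

lemma integrable_oddsBound (hm : ∀ k : ℕ, Integrable (fun v => (v - μ) ^ k) ν) (hμ : 0 < μ)
    (hpos : ∀ᵐ v ∂ν, 0 < v) (k : ℕ) (T : ℝ≥0) : Integrable (oddsBound μ lam a k n T) ν :=
  (integrable_pow_mul_pow hm hμ hpos k (n T)).const_mul _

lemma norm_pow_mul_odds_le (hn : IsCountingPath n) (hμ : 0 < μ) (hlam : 0 ≤ lam) (ha : 0 ≤ a)
    {v : ℝ} (hv : 0 < v) (k : ℕ) {t T : ℝ≥0} (htT : t ≤ T) :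
    ‖(v - μ) ^ k * odds μ lam a v n t‖ ≤ oddsBound μ lam a k n T v := by
  rw [norm_mul, norm_pow, Real.norm_eq_abs, Real.norm_eq_abs,
    abs_of_nonneg (odds_nonneg hμ hv hlam ha t), oddsBound]
  calc _ ≤ |v - μ| ^ k * ((a + lam * T) * (Real.exp ((lam + μ) * T) * (1 + v / μ) ^ n T)) := by
        gcongr; exact odds_le hn hμ hlam hv ha htT
    _ = _ := by ring

lemma norm_pow_mul_leftLim_odds_le (hn : IsCountingPath n) (hμ : 0 < μ) (hlam : 0 ≤ lam)
    (ha : 0 ≤ a) {v : ℝ} (hv : 0 < v) (k : ℕ) {t T : ℝ≥0} (ht : 0 < t) (htT : t ≤ T) :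
    ‖(v - μ) ^ k * Function.leftLim (odds μ lam a v n) t‖ ≤ oddsBound μ lam a k n T v := by
  rw [norm_mul, norm_pow, Real.norm_eq_abs, Real.norm_eq_abs,
    abs_of_nonneg (leftLim_odds_nonneg hn hμ hv hlam ha ht), oddsBound]
  calc _ ≤ |v - μ| ^ k * ((a + lam * T) * (Real.exp ((lam + μ) * T) * (1 + v / μ) ^ n T)) := by
        gcongr; exact leftLim_odds_le hn hμ hlam hv ha ht htT
    _ = _ := by ring

section

variable (hn : IsCountingPath n) (hm : ∀ k : ℕ, Integrable (fun v => (v - μ) ^ k) ν) (hμ : 0 < μ)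
  (hpos : ∀ᵐ v ∂ν, 0 < v) (hlam : 0 ≤ lam) (ha : 0 ≤ a)
include hn hm hμ hpos hlam ha

omit hm hμ hpos hlam ha in
lemma aestronglyMeasurable_pow_mul_odds (k : ℕ) (t : ℝ≥0) :
    AEStronglyMeasurable (fun v => (v - μ) ^ k * odds μ lam a v n t) ν := by
  have := (measurable_odds_path (μ := μ) (lam := lam) (a := a) hn).comp
    (by fun_prop : Measurable fun v : ℝ => (v, t))
  exact ((by fun_prop : Measurable fun v : ℝ => (v - μ) ^ k).mul this).aestronglyMeasurable

lemma integrable_pow_mul_odds (k : ℕ) (t : ℝ≥0) :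
    Integrable (fun v => (v - μ) ^ k * odds μ lam a v n t) ν := by
  refine (integrable_oddsBound (lam := lam) (a := a) (n := n) hm hμ hpos k t).mono'
    (aestronglyMeasurable_pow_mul_odds hn k t) ?_
  filter_upwards [hpos] with v hv
  exact norm_pow_mul_odds_le hn hμ hlam ha hv k le_rfl

lemma integrable_pow_mul_leftLim_odds (k : ℕ) {t : ℝ≥0} (ht : 0 < t) :
    Integrable (fun v => (v - μ) ^ k * Function.leftLim (odds μ lam a v n) t) ν := by
  refine (integrable_oddsBound (lam := lam) (a := a) (n := n) hm hμ hpos k t).mono' ?_ ?_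
  · have h := (aestronglyMeasurable_pow_mul_odds (μ := μ) (lam := lam) (a := a) (ν := ν)
      hn k t).mul (by fun_prop : Measurable fun v : ℝ =>
        ((v / μ) ^ (n t - Function.leftLim n t))⁻¹).aestronglyMeasurable
    refine h.congr ?_
    filter_upwards [hpos] with v hv
    simp only [Pi.mul_apply]
    rw [leftLim_odds_eq_div hn hμ hv ht, ← mul_div_assoc]
    exact (div_eq_mul_inv _ _).symm
  · filter_upwards [hpos] with v hv
    exact norm_pow_mul_leftLim_odds_le hn hμ hlam ha hv k ht le_rfl

lemma tendsto_momentOdds_right (k : ℕ) (t : ℝ≥0) :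
    Tendsto (momentOdds μ lam a ν k n) (𝓝[≥] t) (𝓝 (momentOdds μ lam a ν k n t)) := by
  refine tendsto_integral_filter_of_dominated_convergence (oddsBound μ lam a k n (t + 1))
    (Eventually.of_forall fun s => aestronglyMeasurable_pow_mul_odds hn k s) ?_
    (integrable_oddsBound hm hμ hpos k _) ?_
  · filter_upwards [Ico_mem_nhdsGE (lt_add_one t)] with s hs
    filter_upwards [hpos] with v hv
    exact norm_pow_mul_odds_le hn hμ hlam ha hv k hs.2.le
  · filter_upwards [hpos] with v hv
    exact (tendsto_odds_right hn hμ hv t).const_mul _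

lemma tendsto_momentOdds_left (k : ℕ) {t : ℝ≥0} (ht : 0 < t) :
    Tendsto (momentOdds μ lam a ν k n) (𝓝[<] t)
      (𝓝 (∫ v, (v - μ) ^ k * Function.leftLim (odds μ lam a v n) t ∂ν)) := by
  refine tendsto_integral_filter_of_dominated_convergence (oddsBound μ lam a k n t)
    (Eventually.of_forall fun s => aestronglyMeasurable_pow_mul_odds hn k s) ?_
    (integrable_oddsBound hm hμ hpos k _) ?_
  · filter_upwards [self_mem_nhdsWithin] with s hs
    filter_upwards [hpos] with v hv
    exact norm_pow_mul_odds_le hn hμ hlam ha hv k (le_of_lt hs)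
  · filter_upwards [hpos] with v hv
    rw [leftLim_odds hn hμ hv ht]
    exact (tendsto_odds_left hn hμ hv).const_mul _

lemma leftLim_momentOdds (k : ℕ) {t : ℝ≥0} (ht : 0 < t) :
    Function.leftLim (momentOdds μ lam a ν k n) t =
      ∫ v, (v - μ) ^ k * Function.leftLim (odds μ lam a v n) t ∂ν := by
  have : (𝓝[<] t).NeBot := nhdsLT_neBot_of_exists_lt ⟨0, ht⟩
  exact leftLim_eq_of_tendsto (tendsto_momentOdds_left hn hm hμ hpos hlam ha k ht)

lemma isCadlag_momentOdds (k : ℕ) : IsCadlag (momentOdds μ lam a ν k n) := by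
  refine fun t => ⟨tendsto_momentOdds_right hn hm hμ hpos hlam ha k t, ?_⟩
  rcases eq_or_lt_of_le (zero_le (a := t)) with h0 | h0
  -- There are no times before zero, so any number is a left limit there.
  · refine ⟨0, ?_⟩
    have : Set.Iio t = ∅ := by ext x; simp [← h0]
    rw [this, nhdsWithin_empty]
    exact tendsto_bot
  · exact ⟨_, tendsto_momentOdds_left hn hm hμ hpos hlam ha k h0⟩

lemma integrable_prod_pow_mul_odds (k : ℕ) (t : ℝ≥0) :
    Integrable (Function.uncurry fun (s : ℝ) (v : ℝ) =>
      (v - μ) ^ k * odds μ lam a v n s.toNNReal)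
      ((volume.restrict (Set.Ioc 0 (t : ℝ))).prod ν) := by
  have hb := (integrable_const (μ := volume.restrict (Set.Ioc 0 (t : ℝ))) (1 : ℝ)).mul_prod
    (integrable_oddsBound (lam := lam) (a := a) (n := n) hm hμ hpos k t)
  refine hb.mono' ?_ ?_
  · have := (measurable_odds_path (μ := μ) (lam := lam) (a := a) hn).comp
      (by fun_prop : Measurable fun p : ℝ × ℝ => (p.2, p.1.toNNReal))
    exact ((by fun_prop : Measurable fun p : ℝ × ℝ => (p.2 - μ) ^ k).mul this).aestronglyMeasurable
  · have h1 : ∀ᵐ p ∂(volume.restrict (Set.Ioc 0 (t : ℝ))).prod ν, p.1 ∈ Set.Ioc 0 (t : ℝ) :=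
      Measure.quasiMeasurePreserving_fst.ae (ae_restrict_mem measurableSet_Ioc)
    have h2 : ∀ᵐ p ∂(volume.restrict (Set.Ioc 0 (t : ℝ))).prod ν, 0 < p.2 :=
      Measure.quasiMeasurePreserving_snd.ae hpos
    filter_upwards [h1, h2] with p hp hv
    rw [one_mul]
    exact norm_pow_mul_odds_le hn hμ hlam ha hv k (Real.toNNReal_le_iff_le_coe.2 hp.2)

variable [SFinite ν]

lemma integral_momentOdds (k : ℕ) (t : ℝ≥0) :
    ∫ s in (0 : ℝ)..t, momentOdds μ lam a ν k n s.toNNReal =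
      ∫ v, (v - μ) ^ k * (∫ s in (0 : ℝ)..t, odds μ lam a v n s.toNNReal) ∂ν := by
  simp only [intervalIntegral.integral_of_le (NNReal.coe_nonneg t), momentOdds]
  rw [integral_integral_swap (integrable_prod_pow_mul_odds hn hm hμ hpos hlam ha k t)]
  simp only [integral_const_mul]

lemma intervalIntegrable_momentOdds (k : ℕ) (t : ℝ≥0) :
    IntervalIntegrable (fun s : ℝ => momentOdds μ lam a ν k n s.toNNReal) volume 0 t := by
  rw [intervalIntegrable_iff_integrableOn_Ioc_of_le (NNReal.coe_nonneg t)]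
  exact (integrable_prod_pow_mul_odds hn hm hμ hpos hlam ha k t).integral_prod_left

/-- Integrate `odds_eq` against `(v - μ)^k`. The drift coefficient `-(v - μ)` and the jump
coefficient `v / μ - 1 = (v - μ) / μ` each raise the order by one. Fubini exchanges the time
integral with `ν`, and the jump integral is a finite sum. -/
lemma momentOdds_eq (h0 : n 0 = 0) (hu : UnitJumps n) (k : ℕ) (t : ℝ≥0) :
    momentOdds μ lam a ν k n t = a * (∫ v, (v - μ) ^ k ∂ν)
      + (∫ s in (0 : ℝ)..t, lam * ((∫ v, (v - μ) ^ k ∂ν) + momentOdds μ lam a ν k n s.toNNReal))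
      + 1 / μ * (jumpIntegral (Function.leftLim (momentOdds μ lam a ν (k + 1) n)) n t
          - μ * ∫ s in (0 : ℝ)..t,
              Function.leftLim (momentOdds μ lam a ν (k + 1) n) s.toNNReal) := by
  have hI := integral_momentOdds hn hm hμ hpos hlam ha
  have hJ : ∀ k, Integrable (fun v => (v - μ) ^ k *
      ∫ s in (0 : ℝ)..t, odds μ lam a v n s.toNNReal) ν := by
    intro k
    have := (integrable_prod_pow_mul_odds hn hm hμ hpos hlam ha k t).integral_prod_right
    simpa only [Function.uncurry, integral_const_mul,
      intervalIntegral.integral_of_le (NNReal.coe_nonneg t)] using this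
  -- Values and left limits differ only at the finitely many jump times, a Lebesgue null set.
  have hL : ∫ s in (0 : ℝ)..t, Function.leftLim (momentOdds μ lam a ν (k + 1) n) s.toNNReal =
      ∫ s in (0 : ℝ)..t, momentOdds μ lam a ν (k + 1) n s.toNNReal := by
    refine intervalIntegral.integral_congr_ae ?_
    have hfin : ∀ᵐ s : ℝ, s ∉ (fun u : ℝ≥0 => (u : ℝ)) '' {s | s ∈ Set.Ioc 0 t ∧ jump n s ≠ 0} :=
      measure_eq_zero_iff_ae_notMem.1 (((hn.finite_jumps t).image _).measure_zero volume)
    filter_upwards [hfin] with s hs hst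
    rw [Set.uIoc_of_le (NNReal.coe_nonneg t)] at hst
    have hs0 : 0 < s.toNNReal := Real.toNNReal_pos.2 hst.1
    have hj : jump n s.toNNReal = 0 := by
      by_contra hj
      exact hs ⟨s.toNNReal, ⟨⟨hs0, Real.toNNReal_le_iff_le_coe.2 hst.2⟩, hj⟩,
        Real.coe_toNNReal _ hst.1.le⟩
    rw [leftLim_momentOdds hn hm hμ hpos hlam ha _ hs0, momentOdds]
    refine integral_congr_ae ?_
    filter_upwards [hpos] with v hv
    have := odds_sub_jump (lam := lam) (a := a) hn hu hμ hv hs0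
    rw [hj, mul_zero, sub_zero] at this
    rw [this]
  have hS : jumpIntegral (Function.leftLim (momentOdds μ lam a ν (k + 1) n)) n t =
      ∫ v, (v - μ) ^ (k + 1) * jumpIntegral (Function.leftLim (odds μ lam a v n)) n t ∂ν := by
    simp only [hn.jumpIntegral_eq_sum, Finset.mul_sum, ← mul_assoc]
    rw [integral_finsetSum]
    · refine Finset.sum_congr rfl fun s hs => ?_
      rw [Set.Finite.mem_toFinset] at hs
      rw [leftLim_momentOdds hn hm hμ hpos hlam ha _ hs.1.1, integral_mul_const]
    · intro s hs
      rw [Set.Finite.mem_toFinset] at hs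
      exact (integrable_pow_mul_leftLim_odds hn hm hμ hpos hlam ha _ hs.1.1).mul_const _
  have hSi : Integrable (fun v => (v - μ) ^ (k + 1) *
      jumpIntegral (Function.leftLim (odds μ lam a v n)) n t) ν := by
    simp only [hn.jumpIntegral_eq_sum, Finset.mul_sum, ← mul_assoc]
    refine integrable_finsetSum _ fun s hs => ?_
    rw [Set.Finite.mem_toFinset] at hs
    exact (integrable_pow_mul_leftLim_odds hn hm hμ hpos hlam ha _ hs.1.1).mul_const _
  have hR : ∫ s in (0 : ℝ)..t, lam * ((∫ v, (v - μ) ^ k ∂ν) +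
      momentOdds μ lam a ν k n s.toNNReal) =
      lam * t * (∫ v, (v - μ) ^ k ∂ν) +
        lam * ∫ s in (0 : ℝ)..t, momentOdds μ lam a ν k n s.toNNReal := by
    rw [intervalIntegral.integral_const_mul, intervalIntegral.integral_add intervalIntegrable_const
      (intervalIntegrable_momentOdds hn hm hμ hpos hlam ha k t), intervalIntegral.integral_const]
    simp only [sub_zero, smul_eq_mul]
    ring
  have key : momentOdds μ lam a ν k n t = ∫ v, ((a + lam * t) * (v - μ) ^ k +
      lam * ((v - μ) ^ k * ∫ s in (0 : ℝ)..t, odds μ lam a v n s.toNNReal) -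
      (v - μ) ^ (k + 1) * (∫ s in (0 : ℝ)..t, odds μ lam a v n s.toNNReal) +
      1 / μ * ((v - μ) ^ (k + 1) *
        jumpIntegral (Function.leftLim (odds μ lam a v n)) n t)) ∂ν := by
    refine integral_congr_ae ?_
    filter_upwards [hpos] with v hv
    rw [odds_eq hn h0 hu hμ hv, intervalIntegral.integral_add intervalIntegrable_const
      ((intervalIntegrable_odds hn hμ hv 0 t).const_mul _), intervalIntegral.integral_const,
      intervalIntegral.integral_const_mul]
    have : jumpIntegral (fun s => (v / μ - 1) * Function.leftLim (odds μ lam a v n) s) n t =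
        (v / μ - 1) * jumpIntegral (Function.leftLim (odds μ lam a v n)) n t := by
      simp only [hn.jumpIntegral_eq_sum, Finset.mul_sum, mul_assoc]
    rw [this, show v / μ - 1 = 1 / μ * (v - μ) by field_simp]
    simp only [sub_zero, smul_eq_mul]
    ring
  rw [key, integral_add, integral_sub, integral_add, integral_const_mul, integral_const_mul,
    integral_const_mul, ← hI, ← hI, ← hS, hR, hL]
  · field_simp
    ring
  · exact (hm k).const_mul _
  · exact (hJ k).const_mul _
  · exact ((hm k).const_mul _).add ((hJ k).const_mul _)
  · exact hJ _
  · exact (((hm k).const_mul _).add ((hJ k).const_mul _)).sub (hJ _)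
  · exact hSi.const_mul _

end

end

/-! ### Poisson processes: stationarity, independence of past and future, unit jumps -/

lemma sum_Ico_tsub {f : ℕ → ℕ} (hf : Monotone f) (p q : ℕ) :
    ∑ j ∈ Finset.Ico p q, (f (j + 1) - f j) = f q - f p := by
  induction q with
  | zero => simpa using (Nat.sub_eq_zero_of_le (hf (Nat.zero_le p))).symm
  | succ q ih =>
    have h3 := hf (Nat.le_succ q)
    simp only [Nat.succ_eq_add_one] at h3
    rcases le_or_gt p q with h | h
    · rw [Finset.sum_Ico_succ_top h, ih]
      have h2 := hf h
      omega
    · rw [Finset.Ico_eq_empty (by omega), Finset.sum_empty]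
      exact (Nat.sub_eq_zero_of_le (hf h)).symm

/-- The index set is fixed and the cut-off `q` enters through a condition, so that the values at
several times are all functions of one vector of increments. -/
lemma sum_coe_Ico_tsub {f : ℕ → ℕ} (hf : Monotone f) {p q m : ℕ} (hqm : q ≤ m) :
    ∑ j : Finset.Ico p m, (if (j : ℕ) < q then f (j + 1) - f j else 0) = f q - f p := by
  rw [Finset.sum_coe_sort (Finset.Ico p m) (fun j => if j < q then f (j + 1) - f j else 0),
    ← sum_Ico_tsub hf p q, ← Finset.sum_filter]
  congr 1
  ext j
  simp only [Finset.mem_filter, Finset.mem_Ico]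
  omega

/-- Finitely many times lie on a nondecreasing sequence that starts at zero. -/
lemma exists_monotone_enum (K : Finset ℝ≥0) :
    ∃ (t : ℕ → ℝ≥0) (m : ℕ), Monotone t ∧ t 0 = 0 ∧ ∀ x ∈ K, ∃ i ≤ m, t i = x := by
  set K' := insert 0 K with hK'
  have hc : 0 < K'.card := Finset.card_pos.2 ⟨0, Finset.mem_insert_self _ _⟩
  set e := K'.orderEmbOfFin rfl
  have he : ∀ x ∈ K', ∃ i, e i = x := fun x hx => by
    have := Finset.range_orderEmbOfFin K' rfl
    have hx' : x ∈ Set.range e := by rw [this]; exact hx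
    exact hx'
  refine ⟨fun i => e ⟨min i (K'.card - 1), by omega⟩, K'.card - 1, ?_, ?_, fun x hx => ?_⟩
  · exact fun i j hij => e.monotone (by simp only [Fin.mk_le_mk]; omega)
  · obtain ⟨i, hi⟩ := he 0 (Finset.mem_insert_self _ _)
    refine le_antisymm ?_ zero_le
    rw [← hi]
    exact e.monotone (by simp [Fin.le_def])
  · obtain ⟨i, hi⟩ := he x (Finset.mem_insert_of_mem hx)
    refine ⟨i, by omega, ?_⟩
    rw [← hi]
    exact congrArg e (Fin.ext (min_eq_left (Nat.le_pred_of_lt i.2)))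

lemma lintegral_pow_poissonMeasure (r : ℝ≥0) {x : ℝ} (hx : 0 ≤ x) :
    ∫⁻ j, ENNReal.ofReal (x ^ j) ∂poissonMeasure r = ENNReal.ofReal (Real.exp (r * (x - 1))) := by
  have hs : HasSum (fun j : ℕ => Real.exp (-r) * r ^ j / j.factorial * x ^ j)
      (Real.exp (r * (x - 1))) := by
    convert! (NormedSpace.expSeries_div_hasSum_exp ((r : ℝ) * x)).mul_left (Real.exp (-r)) using 1
    · funext j
      rw [mul_pow]
      ring
    · rw [← Real.exp_eq_exp_ℝ, ← Real.exp_add]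
      congr 1
      ring
  have hi : Integrable (fun j : ℕ => x ^ j) (poissonMeasure r) := by
    rw [integrable_poissonMeasure_iff]
    refine hs.summable.congr fun j => ?_
    rw [Real.norm_of_nonneg (pow_nonneg hx j)]
  rw [← ofReal_integral_eq_lintegral_ofReal hi (ae_of_all _ fun j => pow_nonneg hx j)]
  congr 1
  exact (hasSum_integral_poissonMeasure hi).unique (by simpa only [smul_eq_mul] using hs)

/-- From `exp (-r) ≥ 1 - r` follows `1 - exp (-r) (1 + r) ≤ 1 - (1 - r)(1 + r) = r ^ 2`. -/
lemma poissonMeasure_two_le (r : ℝ≥0) :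
    poissonMeasure r {j | 2 ≤ j} ≤ ENNReal.ofReal ((r : ℝ) ^ 2) := by
  have h : {j : ℕ | 2 ≤ j} = ({0, 1} : Set ℕ)ᶜ := by
    ext j
    simp only [Set.mem_ofPred_eq, Set.mem_compl_iff, Set.mem_insert_iff, Set.mem_singleton_iff]
    omega
  have h2 : (poissonMeasure r).real ({0, 1} : Set ℕ) = Real.exp (-r) * (1 + r) := by
    rw [show ({0, 1} : Set ℕ) = {0} ∪ {1} from rfl, measureReal_union (by simp) (by measurability),
      poissonMeasure_real_singleton, poissonMeasure_real_singleton]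
    simp
    ring
  rw [← ofReal_measureReal (measure_ne_top _ _), h, probReal_compl_eq_one_sub (by measurability),
    h2]
  refine ENNReal.ofReal_le_ofReal ?_
  have h3 := Real.add_one_le_exp (-(r : ℝ))
  nlinarith [r.2, mul_le_mul_of_nonneg_right h3 (by positivity : 0 ≤ 1 + (r : ℝ))]

namespace IsPoisson

variable {Ω : Type*} [MeasurableSpace Ω] {N : ℝ≥0 → Ω → ℕ} {rate : ℝ} {P : Measure Ω}
  [IsProbabilityMeasure P]

omit [IsProbabilityMeasure P] in
lemma ae_isCountingPath (hN : IsPoisson N rate P) :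
    ∀ᵐ ω ∂P, IsCountingPath (fun t => N t ω) ∧ N 0 ω = 0 := by
  filter_upwards [hN.mono, hN.rightCont, hN.zero] with ω h1 h2 h3
  exact ⟨⟨h1, h2⟩, h3⟩

omit [IsProbabilityMeasure P] in
lemma measurable_path (hN : IsPoisson N rate P) : Measurable fun ω t => N t ω :=
  measurable_pi_lambda _ hN.measurable

omit [IsProbabilityMeasure P] in
lemma measurable_shift (hN : IsPoisson N rate P) (s : ℝ≥0) :
    Measurable fun ω => shift s (fun t => N t ω) :=
  measurable_pi_lambda _ fun t => (hN.measurable (s + t)).sub (hN.measurable s)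

omit [IsProbabilityMeasure P] in
lemma shift_add (hN : IsPoisson N rate P) (s : ℝ≥0) :
    HasIndepIncrements (fun t ω => N (s + t) ω) P := fun n t ht =>
  hN.indep n (fun i => s + t i) fun _ _ hij => add_le_add_right (ht hij) s

lemma map_increments (hN : IsPoisson N rate P) (s : ℝ≥0) {t : ℕ → ℝ≥0} (ht : Monotone t) (m : ℕ) :
    P.map (fun ω (i : Fin m) => N (s + t (i + 1)) ω - N (s + t i) ω) =
      Measure.pi fun i : Fin m => poissonMeasure (rate.toNNReal * (t (i + 1) - t i)) := by
  have h := ((hN.shift_add s).nat ht).precomp (Fin.val_injective (n := m))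
  have hmeas : ∀ i : Fin m, Measurable fun ω => N (s + t (i + 1)) ω - N (s + t i) ω :=
    fun i => (hN.measurable _).sub (hN.measurable _)
  rw [(iIndepFun_iff_map_fun_eq_pi_map fun i => (hmeas i).aemeasurable).1 h]
  congr 1
  funext i
  rw [hN.law _ _ (add_le_add_right (ht (Nat.le_succ i)) s), add_tsub_add_eq_tsub_left]

/-- A finite-dimensional vector of the restarted path is a function, not depending on `s`, of the
increments over a translated grid, and the joint law of these increments depends only on the lengths
of the cells. -/
lemma map_shift (hN : IsPoisson N rate P) (s : ℝ≥0) :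
    P.map (fun ω => shift s (fun t => N t ω)) = P.map (fun ω t => N t ω) := by
  have key : ∀ J : Finset ℝ≥0, ∃ (m : ℕ) (t : ℕ → ℝ≥0) (g : (Fin m → ℕ) → J → ℕ), Monotone t ∧
      ∀ s : ℝ≥0, (fun ω => J.restrict (shift s (fun t => N t ω))) =ᵐ[P]
        g ∘ fun ω (i : Fin m) => N (s + t (i + 1)) ω - N (s + t i) ω := by
    intro J
    obtain ⟨t, m, ht, h0, hJ⟩ := exists_monotone_enum J
    choose! idx hidx hidx' using hJ
    refine ⟨m, t, fun e r => ∑ i : Fin m, if (i : ℕ) < idx r then e i else 0, ht, fun s => ?_⟩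
    filter_upwards [hN.mono] with ω hω
    funext r
    have hf : Monotone fun i => N (s + t i) ω := fun i j hij => hω (add_le_add_right (ht hij) s)
    have := sum_coe_Ico_tsub hf (p := 0) (hidx r r.2)
    simp only [h0, add_zero, hidx' r r.2] at this
    simp only [Finset.restrict, shift, Function.comp_apply]
    rw [← this, Finset.sum_coe_sort (Finset.Ico 0 m)
      (fun j => if j < idx r then N (s + t (j + 1)) ω - N (s + t j) ω else 0),
      Fin.sum_univ_eq_sum_range
      (fun j => if j < idx r then N (s + t (j + 1)) ω - N (s + t j) ω else 0),
      Finset.range_eq_Ico]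
  have h0 : P.map (fun ω t => N t ω) = P.map (fun ω => shift 0 (fun t => N t ω)) := by
    refine Measure.map_congr ?_
    filter_upwards [hN.zero] with ω hω
    funext t
    simp [shift, hω]
  rw [h0]
  refine (map_eq_iff_forall_finset_map_restrict_eq (X := fun t ω => shift s (fun t => N t ω) t)
    (Y := fun t ω => shift 0 (fun t => N t ω) t) (hN.measurable_shift s).aemeasurable
    (hN.measurable_shift 0).aemeasurable).2 fun J => ?_
  obtain ⟨m, t, g, ht, hg⟩ := key J
  have hmeas : ∀ s, Measurable fun ω (i : Fin m) => N (s + t (i + 1)) ω - N (s + t i) ω :=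
    fun s => measurable_pi_lambda _ fun i => (hN.measurable _).sub (hN.measurable _)
  rw [Measure.map_congr (hg s), Measure.map_congr (hg 0),
    ← Measure.map_map .of_discrete (hmeas s), ← Measure.map_map .of_discrete (hmeas 0),
    hN.map_increments s ht, hN.map_increments 0 ht]

/-- On a grid that contains `s`, finitely many past values are sums of increments before `s`, and
finitely many values of the restarted path are sums of increments after `s`; the two blocks are
independent. -/
lemma indepFun_past_shift (hN : IsPoisson N rate P) (s : ℝ≥0) :
    IndepFun (fun ω (u : Set.Iic s) => N u ω) (fun ω => shift s (fun t => N t ω)) P := by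
  refine IndepFun.process_indepFun_process (X := fun (u : Set.Iic s) ω => N u ω)
    (Y := fun r ω => shift s (fun t => N t ω) r) (fun u => hN.measurable u)
    (fun r => (hN.measurable (s + r)).sub (hN.measurable s)) fun I J => ?_
  obtain ⟨t, m, ht, h0, hK⟩ := exists_monotone_enum
    (insert s (I.image Subtype.val ∪ J.image fun r => s + r))
  choose! idx hidx hidx' using hK
  have hs : idx s ≤ m ∧ t (idx s) = s :=
    ⟨hidx s (Finset.mem_insert_self _ _), hidx' s (Finset.mem_insert_self _ _)⟩
  have hI : ∀ u : I, t (idx u) = u := fun u => hidx' _ (Finset.mem_insert_of_mem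
    (Finset.mem_union_left _ (Finset.mem_image_of_mem _ u.2)))
  have hJ : ∀ r : J, idx (s + r) ≤ m ∧ t (idx (s + r)) = s + r := fun r =>
    have h := Finset.mem_insert_of_mem (Finset.mem_union_right _
      (Finset.mem_image_of_mem (fun r => s + r) r.2))
    ⟨hidx _ h, hidx' _ h⟩
  have hind := (hN.indep.nat ht).indepFun_finset (Finset.Ico 0 (idx s)) (Finset.Ico (idx s) m)
    (Finset.disjoint_left.2 fun i hi hi' => by
      rw [Finset.mem_Ico] at hi hi'
      omega) (fun i => (hN.measurable _).sub (hN.measurable _))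
  refine (hind.comp (φ := fun e (u : I) => ∑ j : Finset.Ico 0 (idx s),
      if (j : ℕ) < min (idx u) (idx s) then e j else 0)
    (ψ := fun e (r : J) => ∑ j : Finset.Ico (idx s) m,
      if (j : ℕ) < idx (s + r) then e j else 0) .of_discrete .of_discrete).congr ?_ ?_
  · filter_upwards [hN.mono, hN.zero] with ω hω hω0
    funext u
    have hf : Monotone fun i => N (t i) ω := fun i j hij => hω (ht hij)
    have := sum_coe_Ico_tsub hf (p := 0) (min_le_right (idx u) (idx s))
    simp only [h0, hω0, Nat.sub_zero] at this
    refine this.trans ?_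
    -- If the index of `u` is not below that of `s`, monotonicity of the grid forces `u = s`, so
    -- truncating the index at `idx s` changes nothing.
    rcases le_total (idx u) (idx s) with h | h
    · rw [min_eq_left h, hI]
    · rw [min_eq_right h, hs.2]
      have h1 := ht h
      rw [hI, hs.2] at h1
      rw [le_antisymm u.1.2 h1]
  · filter_upwards [hN.mono] with ω hω
    funext r
    have hf : Monotone fun i => N (t i) ω := fun i j hij => hω (ht hij)
    have := sum_coe_Ico_tsub hf (p := idx s) (hJ r).1
    simp only [hs.2, (hJ r).2] at this
    exact this

omit [IsProbabilityMeasure P] in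
lemma lintegral_pow_sub (hN : IsPoisson N rate P) (hrate : 0 < rate) {v : ℝ} (hv : 0 < v)
    {s t : ℝ≥0} (hst : s ≤ t) :
    ∫⁻ ω, ENNReal.ofReal ((v / rate) ^ (N t ω - N s ω)) ∂P =
      ENNReal.ofReal (Real.exp ((v - rate) * (t - s))) := by
  have h := lintegral_map (μ := P) (f := fun j => ENNReal.ofReal ((v / rate) ^ j))
    (g := fun ω => N t ω - N s ω) .of_discrete ((hN.measurable t).sub (hN.measurable s))
  rw [← h, hN.law s t hst, lintegral_pow_poissonMeasure _ (by positivity)]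
  congr 2
  rw [NNReal.coe_mul, NNReal.coe_sub hst, Real.coe_toNNReal _ hrate.le]
  field_simp

-- Cut `[0, T]` into `T (m + 1)` cells of length `1 / (m + 1)`. A jump of size two or more makes
-- some increment over a cell at least two, for every `m`; by `poissonMeasure_two_le` the
-- probability of this is of order `1 / m`.
omit [IsProbabilityMeasure P] in
lemma ae_unitJumps (hN : IsPoisson N rate P) : ∀ᵐ ω ∂P, UnitJumps fun t => N t ω := by
  have key : ∀ T : ℕ, ∀ᵐ ω ∂P, ∀ t : ℝ≥0, 0 < t → t ≤ T →
      N t ω ≤ Function.leftLim (fun t => N t ω) t + 1 := by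
    intro T
    set B : ℕ → ℕ → Set Ω := fun m i =>
      {ω | 2 ≤ N ((i + 1 : ℝ≥0) / (m + 1)) ω - N ((i : ℝ≥0) / (m + 1)) ω}
    have hB : ∀ m i, P (B m i) ≤ ENNReal.ofReal ((rate.toNNReal / (m + 1)) ^ 2) := by
      intro m i
      have h1 : (i : ℝ≥0) / (m + 1) ≤ (i + 1 : ℝ≥0) / (m + 1) := by gcongr; exact le_self_add
      have h2 := hN.law _ _ h1
      have h3 : P (B m i) = P.map (fun ω => N ((i + 1 : ℝ≥0) / (m + 1)) ω -
          N ((i : ℝ≥0) / (m + 1)) ω) {j | 2 ≤ j} :=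
        (Measure.map_apply ((hN.measurable _).sub (hN.measurable _)) .of_discrete).symm
      rw [h3, h2]
      refine (poissonMeasure_two_le _).trans_eq ?_
      rw [NNReal.coe_mul, NNReal.coe_sub h1]
      congr 2
      push_cast
      ring
    have hU : ∀ m, P (⋃ i ∈ Finset.range (T * (m + 1)), B m i) ≤
        ENNReal.ofReal (T * rate.toNNReal ^ 2 / (m + 1)) := by
      intro m
      refine (measure_biUnion_finset_le _ _).trans ((Finset.sum_le_sum fun i _ => hB m i).trans ?_)
      rw [Finset.sum_const, Finset.card_range, nsmul_eq_mul, ← ENNReal.ofReal_natCast,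
        ← ENNReal.ofReal_mul (by positivity)]
      refine ENNReal.ofReal_le_ofReal (le_of_eq ?_)
      push_cast
      field_simp
    have hlim : Tendsto (fun m : ℕ => ENNReal.ofReal (T * rate.toNNReal ^ 2 / ((m : ℝ) + 1))) atTop
        (𝓝 0) := by
      rw [← ENNReal.ofReal_zero]
      refine ENNReal.tendsto_ofReal ?_
      simpa [div_eq_mul_inv] using (tendsto_one_div_add_atTop_nhds_zero_nat (𝕜 := ℝ)).const_mul
        (T * (rate.toNNReal : ℝ) ^ 2)
    have hnull : P (⋂ m, ⋃ i ∈ Finset.range (T * (m + 1)), B m i) = 0 :=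
      le_antisymm (ge_of_tendsto' hlim fun m =>
        (measure_mono (Set.iInter_subset _ m)).trans (hU m)) zero_le
    filter_upwards [measure_eq_zero_iff_ae_notMem.1 hnull, hN.mono] with ω hω hmono t ht htT
    by_contra! hj
    refine hω (Set.mem_iInter.2 fun m => ?_)
    have hm : (0 : ℝ≥0) < m + 1 := by positivity
    -- The half-open cell `(i / (m + 1), (i + 1) / (m + 1)]` is the one containing `t`; since `t >
    -- 0` the subtraction is not truncated.
    set i := ⌈t * (m + 1)⌉₊ - 1
    have hpos : 0 < ⌈t * (m + 1)⌉₊ := Nat.ceil_pos.2 (mul_pos ht hm)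
    have hi1 : (i : ℝ≥0) + 1 = ⌈t * (m + 1)⌉₊ := by
      have : i + 1 = ⌈t * (m + 1)⌉₊ := by omega
      exact_mod_cast this
    have hle : t ≤ (i + 1 : ℝ≥0) / (m + 1) := by
      rw [le_div_iff₀ hm, hi1]
      exact Nat.le_ceil _
    have hlt : (i : ℝ≥0) / (m + 1) < t := by
      rw [div_lt_iff₀ hm]
      exact Nat.lt_ceil.1 (by omega)
    have hiT : i < T * (m + 1) := by
      have : ⌈t * (m + 1)⌉₊ ≤ T * (m + 1) := by
        refine Nat.ceil_le.2 ?_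
        push_cast
        gcongr
      omega
    refine Set.mem_iUnion₂.2 ⟨i, Finset.mem_range.2 hiT, ?_⟩
    have h1 := hmono hle
    have h2 := hmono.le_leftLim hlt
    simp only at h1 h2
    change 2 ≤ _
    omega
  filter_upwards [ae_all_iff.2 key] with ω hω t ht
  obtain ⟨T, hT⟩ := exists_nat_ge t
  exact hω T t ht hT

end IsPoisson

/-! ### Observation filtration and likelihood ratio martingales -/

/-- The likelihood ratio up to time `t`, along a path, of the rate `v` from the time `u` on, against
the rate `μ` throughout. -/
def likelihoodRatio (μ u v : ℝ) (t : ℝ≥0) (n : ℝ≥0 → ℕ) : ℝ :=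
  if u ≤ t then Real.exp (-((v - μ) * (t - u))) * (v / μ) ^ (n t - n u.toNNReal) else 1

lemma likelihoodRatio_pos {μ v : ℝ} (hμ : 0 < μ) (hv : 0 < v) (u : ℝ) (t : ℝ≥0) (n : ℝ≥0 → ℕ) :
    0 < likelihoodRatio μ u v t n := by
  unfold likelihoodRatio
  split_ifs <;> positivity

lemma measurable_likelihoodRatio (μ : ℝ) (t : ℝ≥0) :
    Measurable fun p : (ℝ × ℝ) × (ℝ≥0 → ℕ) => likelihoodRatio μ p.1.1 p.1.2 t (reg p.2) := by
  unfold likelihoodRatio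
  refine Measurable.ite (measurableSet_le (by fun_prop) measurable_const) ?_ measurable_const
  refine Measurable.mul (by fun_prop) (Measurable.pow (by fun_prop) (Measurable.sub ?_ ?_))
  · exact measurable_reg.comp (by fun_prop : Measurable fun p : (ℝ × ℝ) × (ℝ≥0 → ℕ) => (t, p.2))
  · exact measurable_reg.comp
      (by fun_prop : Measurable fun p : (ℝ × ℝ) × (ℝ≥0 → ℕ) => (p.1.1.toNNReal, p.2))

namespace Model

variable {Ω : Type*} [mΩ : MeasurableSpace Ω] (M : Model Ω)

instance : IsProbabilityMeasure M.P₀ := M.isProb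

/-- The observed path. -/
def path (ω : Ω) (t : ℝ≥0) : ℕ := M.N t ω

lemma measurable_path : Measurable M.path := M.poisson.measurable_path

lemma ae_path : ∀ᵐ ω ∂M.P₀, IsCountingPath (M.path ω) ∧ M.path ω 0 = 0 :=
  M.poisson.ae_isCountingPath

lemma ae_reg_path : ∀ᵐ ω ∂M.P₀, reg (M.path ω) = M.path ω :=
  M.ae_path.mono fun _ h => h.1.reg_eq

/-- The law of the observed path under the reference measure. -/
def pathLaw : Measure (ℝ≥0 → ℕ) := M.P₀.map M.path

instance : IsProbabilityMeasure M.pathLaw :=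
  Measure.isProbabilityMeasure_map M.measurable_path.aemeasurable

lemma F_eq (t : ℝ≥0) : M.F t = ⨅ u > t, M.rawFiltration u := M.rawFiltration.rightCont_eq t

lemma raw_le_F (t : ℝ≥0) : M.rawFiltration t ≤ M.F t := M.rawFiltration.le_rightCont t

lemma measurableSet_F_of_null {A : Set Ω} (hA : MeasurableSet A) (h0 : M.P₀ A = 0) (t : ℝ≥0) :
    MeasurableSet[M.F t] A :=
  M.raw_le_F t A ((le_sup_right : _ ≤ (M.rawFiltration t : MeasurableSpace Ω)) A
    (MeasurableSpace.measurableSet_generateFrom ⟨hA, h0⟩))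

lemma measurableSet_F_of_ae_eq {A B : Set Ω} {t : ℝ≥0} (hA : MeasurableSet A)
    (hB : MeasurableSet[M.F t] B) (h : A =ᵐ[M.P₀] B) : MeasurableSet[M.F t] A := by
  have hB' := M.F.le t B hB
  have h1 : MeasurableSet[M.F t] (A \ B) :=
    M.measurableSet_F_of_null (hA.diff hB') (ae_le_set.1 h.le) t
  have h2 : MeasurableSet[M.F t] (B \ A) :=
    M.measurableSet_F_of_null (hB'.diff hA) (ae_le_set.1 h.symm.le) t
  have : A = (B \ (B \ A)) ∪ (A \ B) := by
    ext x
    simp only [Set.mem_union, Set.mem_sdiff]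
    tauto
  rw [this]
  exact (hB.diff h2).union h1

lemma measurable_F_of_ae_eq {α : Type*} [MeasurableSpace α] {f g : Ω → α} {t : ℝ≥0}
    (hf : Measurable f) (hg : Measurable[M.F t] g) (h : f =ᵐ[M.P₀] g) : Measurable[M.F t] f :=
  fun s hs => M.measurableSet_F_of_ae_eq (hf hs) (hg hs) (h.preimage s)

lemma measurable_N_F {s t : ℝ≥0} (hst : s ≤ t) : Measurable[M.F t] (M.N s) := by
  refine Measurable.mono ?_ (M.raw_le_F t) le_rfl
  refine Measurable.mono (comap_measurable (M.N s)) ?_ le_rfl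
  exact le_sup_of_le_left (le_iSup₂_of_le s hst le_rfl)

lemma raw_le_eventually (t : ℝ≥0) : M.rawFiltration t ≤
    eventuallyMeasurableSpace (MeasurableSpace.comap (fun ω (u : Set.Iic t) => M.N u ω) .pi)
      (ae M.P₀) := by
  refine sup_le (le_trans (iSup₂_le fun s hs => ?_) le_eventuallyMeasurableSpace)
    (MeasurableSpace.generateFrom_le fun A hA => ?_)
  · have h : Measurable[MeasurableSpace.comap (fun ω (u : Set.Iic t) => M.N u ω) .pi] (M.N s) :=
      (measurable_pi_apply (⟨s, hs⟩ : Set.Iic t)).comp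
        (comap_measurable (fun ω (u : Set.Iic t) => M.N u ω))
    exact h.comap_le
  · exact ⟨∅, @MeasurableSet.empty Ω (MeasurableSpace.comap _ .pi), ae_eq_empty.2 hA.2⟩

/-- Events of the observation filtration are events of the path, up to null events. -/
lemma exists_ae_eq_preimage {t : ℝ≥0} {A : Set Ω} (hA : MeasurableSet[M.F t] A) :
    ∃ C, MeasurableSet C ∧ A =ᵐ[M.P₀] M.path ⁻¹' C := by
  rw [F_eq] at hA
  have h1 : MeasurableSet[M.rawFiltration (t + 1)] A :=
    (iInf₂_le (t + 1) (lt_add_one t) : (⨅ u > t, M.rawFiltration u : MeasurableSpace Ω) ≤ _) A hA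
  obtain ⟨_, ⟨C, hC, rfl⟩, h⟩ := M.raw_le_eventually _ A h1
  refine ⟨(fun n (u : Set.Iic (t + 1)) => n u) ⁻¹' C, ?_, h⟩
  exact (measurable_pi_lambda _ fun u => measurable_pi_apply _) hC

lemma measure_raw_inter_shift {s : ℝ≥0} {A : Set Ω} (hA : MeasurableSet[M.rawFiltration s] A)
    {C : Set (ℝ≥0 → ℕ)} (hC : MeasurableSet C) :
    M.P₀ (A ∩ (fun ω => shift s (M.path ω)) ⁻¹' C) = M.P₀ A * M.pathLaw C := by
  obtain ⟨_, ⟨B, hB, rfl⟩, h⟩ := M.raw_le_eventually _ A hA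
  have h1 : M.P₀ (A ∩ (fun ω => shift s (M.path ω)) ⁻¹' C) =
      M.P₀ (((fun ω (u : Set.Iic s) => M.N u ω) ⁻¹' B) ∩ (fun ω => shift s (M.path ω)) ⁻¹' C) :=
    measure_congr (ae_eq_set_inter h (ae_eq_refl _))
  have h2 : M.P₀ A = M.P₀ ((fun ω (u : Set.Iic s) => M.N u ω) ⁻¹' B) := measure_congr h
  rw [h1, h2, pathLaw,
    show M.path = fun ω t => M.N t ω from rfl, ← M.poisson.map_shift s,
    Measure.map_apply (M.poisson.measurable_shift s) hC]
  exact (M.poisson.indepFun_past_shift s).measure_inter_preimage_eq_mul _ _ hB hC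

/-- An event of `M.F s` lies in the raw σ-algebra at every later time `s + ε`, where independence of
the restarted path is known. As `ε → 0`, right-continuity makes finitely many coordinates of the
restarted path eventually equal to those at `s`. -/
lemma measure_F_inter_shift {s : ℝ≥0} {A : Set Ω} (hA : MeasurableSet[M.F s] A) (I : Finset ℝ≥0)
    {C : Set (I → ℕ)} (hC : MeasurableSet C) :
    M.P₀ (A ∩ (fun ω => I.restrict (shift s (M.path ω))) ⁻¹' C) =
      M.P₀ A * M.pathLaw (I.restrict ⁻¹' C) := by
  have hmeas : ∀ s, Measurable fun ω => I.restrict (shift s (M.path ω)) := fun s =>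
    (Finset.measurable_restrict I).comp (M.poisson.measurable_shift s)
  set ε : ℕ → ℝ≥0 := fun m => 1 / ((m : ℝ≥0) + 1) with hε
  have hε0 : ∀ m, 0 < ε m := fun m => by positivity
  have hεlim : Tendsto ε atTop (𝓝 0) := tendsto_one_div_add_atTop_nhds_zero_nat
  have hA' := hA
  rw [F_eq] at hA'
  have h1 : ∀ m, M.P₀ (A ∩ (fun ω => I.restrict (shift (s + ε m) (M.path ω))) ⁻¹' C) =
      M.P₀ A * M.pathLaw (I.restrict ⁻¹' C) := fun m =>
    M.measure_raw_inter_shift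
      ((iInf₂_le (s + ε m) (lt_add_of_pos_right s (hε0 m)) :
        (⨅ u > s, M.rawFiltration u : MeasurableSpace Ω) ≤ _) A hA')
      (Finset.measurable_restrict I hC)
  have h2 := tendsto_measure_of_ae_tendsto_indicator_of_isFiniteMeasure (μ := M.P₀) (L := atTop)
    (A := A ∩ (fun ω => I.restrict (shift s (M.path ω))) ⁻¹' C)
    (As := fun m => A ∩ (fun ω => I.restrict (shift (s + ε m) (M.path ω))) ⁻¹' C)
    ((M.F.le s A hA).inter (hmeas s hC)) (fun m => (M.F.le s A hA).inter (hmeas _ hC)) ?_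
  · simp only [h1] at h2
    exact (tendsto_nhds_unique tendsto_const_nhds h2).symm
  · filter_upwards [M.ae_path] with ω hω
    have hr : ∀ r : ℝ≥0, ∀ᶠ m in atTop, M.path ω (s + ε m + r) = M.path ω (s + r) := by
      intro r
      have ht : Tendsto (fun m => s + ε m + r) atTop (𝓝[≥] (s + r)) := by
        refine tendsto_nhdsWithin_iff.2 ⟨?_, Eventually.of_forall fun m => ?_⟩
        · simpa using (hεlim.const_add s).add_const r
        · exact add_le_add_left le_self_add r
      exact ht.eventually (hω.1.eventually_right (s + r))
    have hall : ∀ᶠ m in atTop, ∀ r : I, M.path ω (s + ε m + r) = M.path ω (s + r) :=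
      eventually_all.2 fun r => hr r
    filter_upwards [hall, hr 0] with m hm hm0
    have : I.restrict (shift (s + ε m) (M.path ω)) = I.restrict (shift s (M.path ω)) := by
      funext r
      simp only [add_zero] at hm0
      simp only [Finset.restrict, shift, hm r, hm0]
    simp only [Set.mem_inter_iff, Set.mem_preimage, this]

/-- The path after time `s` is independent of the observations up to time `s`. -/
lemma indepFun_shift {α : Type*} [MeasurableSpace α] {U : Ω → α} {s : ℝ≥0}
    (hU : Measurable[M.F s] U) : IndepFun U (fun ω => shift s (M.path ω)) M.P₀ := by
  -- The identity map into `Ω` with the σ-algebra `M.F s` carries all observations up to time `s`;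
  -- every observable `U` factors through it.
  have h : @IndepFun Ω Ω _ mΩ (M.F s) _ id (fun ω => shift s (M.path ω)) M.P₀ := by
    refine @IndepFun.indepFun_process _ Ω mΩ M.P₀ Ω _ (M.F s) _ id
      (fun r ω => shift s (M.path ω) r) (measurable_id.mono (M.F.le s) le_rfl)
      (fun r => (M.poisson.measurable (s + r)).sub (M.poisson.measurable s)) (fun I => ?_) _
    rw [indepFun_iff_measure_inter_preimage_eq_mul]
    intro A C hA hC
    have h1 := M.measure_F_inter_shift hA I hC
    have h2 := M.measure_F_inter_shift (MeasurableSet.univ (α := Ω)) (s := s) I hC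
    rw [measure_univ, one_mul, Set.univ_inter] at h2
    rw [← h2] at h1
    exact h1
  exact h.comp hU measurable_id

lemma map_shift_path (s : ℝ≥0) : M.P₀.map (fun ω => shift s (M.path ω)) = M.pathLaw :=
  M.poisson.map_shift s

lemma lintegral_shift {α : Type*} [MeasurableSpace α] {U : Ω → α} {s : ℝ≥0}
    (hU : Measurable[M.F s] U) {f : α × (ℝ≥0 → ℕ) → ℝ≥0∞} (hf : Measurable f) :
    ∫⁻ ω, f (U ω, shift s (M.path ω)) ∂M.P₀ =
      ∫⁻ ω, ∫⁻ n, f (U ω, n) ∂M.pathLaw ∂M.P₀ := by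
  have hU' : Measurable U := hU.mono (M.F.le s) le_rfl
  have hsh : Measurable fun ω => shift s (M.path ω) := M.poisson.measurable_shift s
  have h := (indepFun_iff_map_prod_eq_prod_map_map hU'.aemeasurable hsh.aemeasurable).1
    (M.indepFun_shift hU)
  rw [← lintegral_map hf (hU'.prodMk hsh), h, map_shift_path, lintegral_prod _ hf.aemeasurable,
    lintegral_map hf.lintegral_prod_right' hU']

lemma measurable_F_likelihoodRatio_path (u v : ℝ) (t : ℝ≥0) :
    Measurable[M.F t] fun ω => likelihoodRatio M.μ u v t (M.path ω) := by
  unfold likelihoodRatio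
  by_cases h : u ≤ t
  · simp only [h, if_true]
    exact measurable_const.mul (measurable_const.pow ((M.measurable_N_F le_rfl).sub
      (M.measurable_N_F (Real.toNNReal_le_iff_le_coe.2 h))))
  · simp only [h, if_false]
    exact measurable_const

/-- The likelihood ratio process is a martingale of the observation filtration. -/
lemma setLIntegral_likelihoodRatio {u v : ℝ} (hv : 0 < v) {s t : ℝ≥0} (hst : s ≤ t)
    {A : Set Ω} (hA : MeasurableSet[M.F s] A) :
    ∫⁻ ω in A, ENNReal.ofReal (likelihoodRatio M.μ u v t (M.path ω)) ∂M.P₀ =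
      ∫⁻ ω in A, ENNReal.ofReal (likelihoodRatio M.μ u v s (M.path ω)) ∂M.P₀ := by
  have hst' : (s : ℝ) ≤ t := by exact_mod_cast hst
  rcases lt_or_ge (t : ℝ) u with hu | hu
  · simp [likelihoodRatio, not_le.2 hu, not_le.2 (hst'.trans_lt hu)]
  -- Nothing happens to the likelihood ratio before `u`, so its growth from `s` to `t` involves only
  -- the increment after `r`, which is independent of `A`.
  set r : ℝ≥0 := max s u.toNNReal with hr
  have hrt : r ≤ t := max_le hst (Real.toNNReal_le_iff_le_coe.2 hu)
  have hsr : s ≤ r := le_max_left _ _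
  set c := Real.exp (-((v - M.μ) * (t - r))) with hc
  have hc0 : 0 < c := Real.exp_pos _
  set U : Ω → ℝ≥0∞ :=
    A.indicator fun ω => ENNReal.ofReal (likelihoodRatio M.μ u v s (M.path ω)) with hU
  have hUm : Measurable[M.F r] U :=
    ((M.measurable_F_likelihoodRatio_path u v s).ennreal_ofReal.indicator hA).mono
      (M.F.mono hsr) le_rfl
  set f : ℝ≥0∞ × (ℝ≥0 → ℕ) → ℝ≥0∞ :=
    fun p => p.1 * ENNReal.ofReal (c * (v / M.μ) ^ p.2 (t - r)) with hf
  have hfm : Measurable f :=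
    measurable_fst.mul (measurable_const.mul (measurable_const.pow
      ((measurable_pi_apply (t - r)).comp measurable_snd))).ennreal_ofReal
  have hone : ∫⁻ n, ENNReal.ofReal (c * (v / M.μ) ^ n (t - r)) ∂M.pathLaw = 1 := by
    have h1 := M.poisson.lintegral_pow_sub M.mu_pos hv (zero_le (a := t - r))
    have h2 : ∫⁻ ω, ENNReal.ofReal (c * (v / M.μ) ^ M.path ω (t - r)) ∂M.P₀ = 1 := by
      simp only [ENNReal.ofReal_mul hc0.le]
      rw [lintegral_const_mul' _ _ ENNReal.ofReal_ne_top]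
      rw [lintegral_congr_ae (g := fun ω => ENNReal.ofReal
        ((v / M.μ) ^ (M.N (t - r) ω - M.N 0 ω))) ?_, h1, ← ENNReal.ofReal_mul hc0.le, hc,
        ← Real.exp_add, NNReal.coe_sub hrt]
      · simp
      · filter_upwards [M.poisson.zero] with ω hω
        rw [hω, Nat.sub_zero, path]
    rw [← h2, pathLaw, lintegral_map ?_ M.measurable_path]
    exact (measurable_const.mul (measurable_const.pow
      (measurable_pi_apply (t - r)))).ennreal_ofReal
  have h := M.lintegral_shift hUm hfm
  have hinner : ∀ ω, ∫⁻ n, f (U ω, n) ∂M.pathLaw = U ω := by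
    intro ω
    simp only [hf]
    rw [lintegral_const_mul, hone, mul_one]
    exact (measurable_const.mul (measurable_const.pow
      (measurable_pi_apply (t - r)))).ennreal_ofReal
  simp only [hinner] at h
  rw [← lintegral_indicator (M.F.le s A hA), ← lintegral_indicator (M.F.le s A hA), ← hU, ← h]
  refine lintegral_congr_ae ?_
  filter_upwards [M.ae_path] with ω hω
  by_cases hωA : ω ∈ A
  · simp only [hU, hf, Set.indicator_of_mem hωA]
    rw [← ENNReal.ofReal_mul (likelihoodRatio_pos M.mu_pos hv u s _).le]
    congr 1
    have hsh : shift r (M.path ω) (t - r) = M.path ω t - M.path ω r := by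
      rw [shift, add_tsub_cancel_of_le hrt]
    have hmr := hω.1.mono hrt
    rw [hsh, likelihoodRatio, if_pos hu, likelihoodRatio, hc]
    split_ifs with hus
    · have hrs : r = s := max_eq_left (Real.toNNReal_le_iff_le_coe.2 hus)
      have hmu := hω.1.mono (Real.toNNReal_le_iff_le_coe.2 hus : u.toNNReal ≤ s)
      rw [hrs] at hmr ⊢
      have h1 : M.path ω t - M.path ω u.toNNReal =
          (M.path ω s - M.path ω u.toNNReal) + (M.path ω t - M.path ω s) := by omega
      have h2 : -((v - M.μ) * (t - u)) =
          -((v - M.μ) * (s - u)) + -((v - M.μ) * ((t : ℝ) - s)) := by ring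
      rw [h1, h2, pow_add, Real.exp_add]
      ring
    · have hsu := not_le.1 hus
      have hru : r = u.toNNReal := max_eq_right (NNReal.le_toNNReal_of_coe_le hsu.le)
      rw [hru, one_mul, Real.coe_toNNReal _ (s.2.trans hsu.le)]
  · simp [hU, hf, Set.indicator_of_notMem hωA]

lemma lintegral_likelihoodRatio {u v : ℝ} (hu : 0 ≤ u) (hv : 0 < v) (t : ℝ≥0) :
    ∫⁻ ω, ENNReal.ofReal (likelihoodRatio M.μ u v t (M.path ω)) ∂M.P₀ = 1 := by
  have h := M.setLIntegral_likelihoodRatio (u := u) hv (zero_le (a := t))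
    (MeasurableSet.univ (α := Ω))
  rw [Measure.restrict_univ] at h
  rw [h]
  have : ∀ ω, likelihoodRatio M.μ u v 0 (M.path ω) = 1 := by
    intro ω
    rw [likelihoodRatio]
    split_ifs with h0
    · have : u = 0 := le_antisymm h0 hu
      simp [this]
    · rfl
  simp [this]

end Model

/-- Prior density times likelihood splits into a factor in `t` and a factor in `u`. Integrating out
`u` therefore produces the shape of `odds`: a weight times an integral of reciprocal weights. -/
lemma likelihoodRatio_eq_weight_div {μ lam u v : ℝ} (hμ : 0 < μ) (hv : 0 < v) {n : ℝ≥0 → ℕ}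
    (hn : IsCountingPath n) {t : ℝ≥0} (hu0 : 0 ≤ u) (hut : u ≤ t) :
    lam * Real.exp (-(lam * u)) * likelihoodRatio μ u v t n =
      Real.exp (-(lam * t)) * weight μ lam v n t * (lam / weight μ lam v n u.toNNReal) := by
  have hr := div_pos hv hμ
  rw [likelihoodRatio, if_pos hut, weight, weight,
    pow_sub₀ _ hr.ne' (hn.mono (Real.toNNReal_le_iff_le_coe.2 hut)), Real.coe_toNNReal _ hu0]
  have h : Real.exp (-(lam * u)) * Real.exp (-((v - μ) * (t - u))) =
      Real.exp (-(lam * t)) * Real.exp ((lam - (v - μ)) * t) *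
        (Real.exp ((lam - (v - μ)) * u))⁻¹ := by
    rw [← Real.exp_neg, ← Real.exp_add, ← Real.exp_add, ← Real.exp_add]
    congr 1
    ring
  calc _ = lam * (Real.exp (-(lam * u)) * Real.exp (-((v - μ) * (t - u)))) *
        ((v / μ) ^ n t * ((v / μ) ^ n u.toNNReal)⁻¹) := by ring
    _ = _ := by
      rw [h, div_eq_mul_inv lam, mul_inv]
      ring

lemma likelihoodRatio_zero {μ v : ℝ} (lam : ℝ) {n : ℝ≥0 → ℕ} (h0 : n 0 = 0) (t : ℝ≥0) :
    likelihoodRatio μ 0 v t n = Real.exp (-(lam * t)) * weight μ lam v n t := by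
  rw [likelihoodRatio, if_pos (NNReal.coe_nonneg t), weight, ← mul_assoc, ← Real.exp_add,
    Real.toNNReal_zero, h0]
  congr 2
  ring

/-! ### Averaging the likelihood ratio over the prior -/

namespace Model

variable {Ω : Type*} [mΩ : MeasurableSpace Ω] (M : Model Ω)

instance : IsProbabilityMeasure M.ν :=
  Measure.isProbabilityMeasure_map M.Lambda_meas.aemeasurable

/-- The law of the disorder time. -/
def thetaLaw : Measure ℝ := M.P₀.map M.θ

instance : IsProbabilityMeasure M.thetaLaw :=
  Measure.isProbabilityMeasure_map M.theta_meas.aemeasurable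

/-- The joint law of the disorder time and the post-disorder rate. -/
def prior : Measure (ℝ × ℝ) := M.P₀.map fun ω => (M.θ ω, M.Λ ω)

instance : IsProbabilityMeasure M.prior :=
  Measure.isProbabilityMeasure_map (M.theta_meas.prodMk M.Lambda_meas).aemeasurable

lemma prior_eq : M.prior = M.thetaLaw.prod M.ν :=
  (indepFun_iff_map_prod_eq_prod_map_map M.theta_meas.aemeasurable
    M.Lambda_meas.aemeasurable).1 M.indep_theta_Lambda

lemma map_prior_path :
    M.P₀.map (fun ω => ((M.θ ω, M.Λ ω), M.path ω)) = M.prior.prod M.pathLaw :=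
  (indepFun_iff_map_prod_eq_prod_map_map (M.theta_meas.prodMk M.Lambda_meas).aemeasurable
    M.measurable_path.aemeasurable).1 M.indep_N

lemma ae_ν_pos : ∀ᵐ v ∂M.ν, 0 < v :=
  (ae_map_iff M.Lambda_meas.aemeasurable measurableSet_Ioi).2 M.Lambda_pos

lemma one_sub_pi_pos : 0 < 1 - M.π₀ := by linarith [M.pi_lt_one]

lemma measure_theta_le {a : ℝ} (ha : 0 ≤ a) :
    M.P₀ {ω | M.θ ω ≤ a} = ENNReal.ofReal (1 - (1 - M.π₀) * Real.exp (-M.lam * a)) := by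
  have h : {ω | M.θ ω ≤ a} = {ω | a < M.θ ω}ᶜ := by ext; simp
  rw [h, prob_compl_eq_one_sub (measurableSet_lt measurable_const M.theta_meas),
    M.theta_tail a ha, ENNReal.ofReal_sub, ENNReal.ofReal_one]
  have := M.one_sub_pi_pos
  positivity

/-- The tail formula at time zero gives `{θ ≤ 0}` the mass `π₀`, which `{θ = 0}` already exhausts.
-/
lemma ae_theta_nonneg : ∀ᵐ ω ∂M.P₀, 0 ≤ M.θ ω := by
  have h1 := M.measure_theta_le le_rfl
  rw [mul_zero, Real.exp_zero, mul_one, sub_sub_cancel, ← M.theta_zero] at h1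
  have h2 : M.P₀ ({ω | M.θ ω ≤ 0} \ {ω | M.θ ω = 0}) = 0 := by
    have hsub : {ω | M.θ ω = 0} ⊆ {ω | M.θ ω ≤ 0} := fun ω (hω : M.θ ω = 0) => hω.le
    rw [measure_sdiff hsub (measurableSet_eq_fun M.theta_meas measurable_const).nullMeasurableSet
      (measure_ne_top _ _),
      h1, tsub_self]
  filter_upwards [measure_eq_zero_iff_ae_notMem.1 h2] with ω hω
  by_contra! h
  exact hω ⟨h.le, h.ne⟩

lemma ae_thetaLaw_nonneg : ∀ᵐ u ∂M.thetaLaw, 0 ≤ u :=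
  (ae_map_iff M.theta_meas.aemeasurable measurableSet_Ici).2 M.ae_theta_nonneg

lemma thetaLaw_eq : M.thetaLaw = ENNReal.ofReal M.π₀ • Measure.dirac 0 +
    ENNReal.ofReal (1 - M.π₀) • expMeasure M.lam := by
  have := isProbabilityMeasure_expMeasure M.lam_pos
  refine Measure.ext_of_Iic _ _ fun a => ?_
  have h1 : M.thetaLaw (Set.Iic a) = M.P₀ {ω | M.θ ω ≤ a} :=
    Measure.map_apply M.theta_meas measurableSet_Iic
  rw [h1, Measure.add_apply, Measure.smul_apply, Measure.smul_apply,
    ← ofReal_cdf (expMeasure M.lam),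
    cdf_expMeasure_eq M.lam_pos, Measure.dirac_apply' _ measurableSet_Iic, smul_eq_mul, smul_eq_mul]
  split_ifs with ha
  · rw [M.measure_theta_le ha, Set.indicator_of_mem (Set.mem_Iic.2 ha), Pi.one_apply, mul_one,
      ← ENNReal.ofReal_mul M.one_sub_pi_pos.le, ← ENNReal.ofReal_add M.pi_nonneg]
    · congr 1
      rw [neg_mul]
      ring
    · refine mul_nonneg M.one_sub_pi_pos.le ?_
      rw [sub_nonneg, Real.exp_le_one_iff, neg_nonpos]
      exact mul_nonneg M.lam_pos.le ha
  · rw [Set.indicator_of_notMem (by simpa using ha), mul_zero, ENNReal.ofReal_zero, mul_zero,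
      add_zero]
    have := M.ae_theta_nonneg
    rw [ae_iff] at this
    refine measure_mono_null (fun ω hω => ?_) this
    have hω : M.θ ω ≤ a := hω
    simp only [Set.mem_ofPred_eq, not_le]
    linarith

/-- The prior odds of the event that the disorder is already present at time zero. -/
def priorOdds : ℝ := M.π₀ / (1 - M.π₀)

lemma priorOdds_nonneg : 0 ≤ M.priorOdds := div_nonneg M.pi_nonneg M.one_sub_pi_pos.le

/-- The survival probability `P₀(θ > t)`. -/
def survival (t : ℝ≥0) : ℝ := (1 - M.π₀) * Real.exp (-(M.lam * t))

lemma survival_pos (t : ℝ≥0) : 0 < M.survival t :=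
  mul_pos M.one_sub_pi_pos (Real.exp_pos _)

/-- The atom at zero yields the prior odds term and the exponential part yields the integral term;
the factor `exp (-lam t)` of both joins `1 - π₀` to form the survival probability. -/
lemma lintegral_likelihoodRatio_thetaLaw {v : ℝ} (hv : 0 < v) {n : ℝ≥0 → ℕ}
    (hn : IsCountingPath n) (h0 : n 0 = 0) (t : ℝ≥0) :
    ∫⁻ u in Set.Iic (t : ℝ), ENNReal.ofReal (likelihoodRatio M.μ u v t n) ∂M.thetaLaw =
      ENNReal.ofReal (M.survival t * odds M.μ M.lam M.priorOdds v n t) := by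
  have hμ := M.mu_pos
  have hmeas : Measurable fun u => ENNReal.ofReal (likelihoodRatio M.μ u v t n) := by
    have := ((measurable_likelihoodRatio M.μ t).comp
      (by fun_prop : Measurable fun u : ℝ => ((u, v), n))).ennreal_ofReal
    simpa only [Function.comp_def, hn.reg_eq] using this
  have hw := weight_pos (lam := M.lam) (n := n) hμ hv t
  have hE : ∫⁻ u in Set.Iic (t : ℝ), ENNReal.ofReal (likelihoodRatio M.μ u v t n)
      ∂expMeasure M.lam = ENNReal.ofReal (Real.exp (-(M.lam * t)) * weight M.μ M.lam v n t *
        ∫ s in (0 : ℝ)..t, M.lam / weight M.μ M.lam v n s.toNNReal) := by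
    have hpdf : Measurable (exponentialPDF M.lam) :=
      (measurable_exponentialPDFReal M.lam).ennreal_ofReal
    rw [← lintegral_indicator measurableSet_Iic, show expMeasure M.lam =
      volume.withDensity (exponentialPDF M.lam) from rfl,
      lintegral_withDensity_eq_lintegral_mul _ hpdf
        (hmeas.indicator measurableSet_Iic),
      ← intervalIntegral.integral_const_mul,
      intervalIntegral.integral_of_le (NNReal.coe_nonneg t), ← integral_Icc_eq_integral_Ioc,
      ofReal_integral_eq_lintegral_ofReal, ← lintegral_indicator measurableSet_Icc]
    · refine lintegral_congr fun u => ?_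
      by_cases hu : u ∈ Set.Icc (0 : ℝ) t
      · rw [Set.indicator_of_mem hu, Pi.mul_apply, Set.indicator_of_mem (Set.mem_Iic.2 hu.2),
          exponentialPDF_of_nonneg hu.1, ← ENNReal.ofReal_mul (by have := M.lam_pos; positivity),
          likelihoodRatio_eq_weight_div hμ hv hn hu.1 hu.2]
      · rw [Set.indicator_of_notMem hu, Pi.mul_apply]
        rcases lt_or_ge u 0 with h | h
        · rw [exponentialPDF_of_neg h, zero_mul]
        · have h' : u ∉ Set.Iic (t : ℝ) := fun h' => hu ⟨h, h'⟩
          rw [Set.indicator_of_notMem h', mul_zero]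
    · change IntegrableOn _ (Set.Icc (0 : ℝ) t) volume
      rw [integrableOn_Icc_iff_integrableOn_Ioc,
        ← intervalIntegrable_iff_integrableOn_Ioc_of_le (NNReal.coe_nonneg t)]
      exact (intervalIntegrable_div_weight hn hμ hv 0 t).const_mul _
    · exact ae_of_all _ fun u => mul_nonneg (by positivity)
        (div_nonneg M.lam_pos.le (weight_pos hμ hv _).le)
  have hI : 0 ≤ ∫ s in (0 : ℝ)..t, M.lam / weight M.μ M.lam v n s.toNNReal :=
    intervalIntegral.integral_nonneg t.2 fun s _ =>
      div_nonneg M.lam_pos.le (weight_pos hμ hv _).le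
  have h1 := M.one_sub_pi_pos
  rw [thetaLaw_eq, Measure.restrict_add, lintegral_add_measure, Measure.restrict_smul,
    Measure.restrict_smul, lintegral_smul_measure, lintegral_smul_measure, hE,
    ← lintegral_indicator measurableSet_Iic, lintegral_dirac' _ (hmeas.indicator measurableSet_Iic),
    Set.indicator_of_mem (Set.mem_Iic.2 (NNReal.coe_nonneg t)), likelihoodRatio_zero M.lam h0,
    smul_eq_mul, smul_eq_mul, ← ENNReal.ofReal_mul M.pi_nonneg, ← ENNReal.ofReal_mul h1.le,
    ← ENNReal.ofReal_add (mul_nonneg M.pi_nonneg (by positivity)) (by positivity)]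
  congr 1
  rw [odds, survival, priorOdds]
  field_simp

lemma integral_likelihoodRatio_thetaLaw {v : ℝ} (hv : 0 < v) {n : ℝ≥0 → ℕ}
    (hn : IsCountingPath n) (h0 : n 0 = 0) (t : ℝ≥0) :
    ∫ u in Set.Iic (t : ℝ), likelihoodRatio M.μ u v t n ∂M.thetaLaw =
      M.survival t * odds M.μ M.lam M.priorOdds v n t := by
  have hmeas : Measurable fun u => likelihoodRatio M.μ u v t n := by
    have := (measurable_likelihoodRatio M.μ t).comp
      (by fun_prop : Measurable fun u : ℝ => ((u, v), n))
    simpa only [Function.comp_def, hn.reg_eq] using this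
  rw [integral_eq_lintegral_of_nonneg_ae
    (ae_of_all _ fun u => (likelihoodRatio_pos M.mu_pos hv u t n).le)
    hmeas.aestronglyMeasurable, M.lintegral_likelihoodRatio_thetaLaw hv hn h0,
    ENNReal.toReal_ofReal]
  exact mul_nonneg (M.survival_pos t).le
    (odds_nonneg M.mu_pos hv M.lam_pos.le M.priorOdds_nonneg t)

lemma thetaLaw_Ioi (t : ℝ≥0) : M.thetaLaw (Set.Ioi (t : ℝ)) = ENNReal.ofReal (M.survival t) := by
  rw [thetaLaw, Measure.map_apply M.theta_meas measurableSet_Ioi, survival, ← neg_mul]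
  exact M.theta_tail t t.2

/-- Functions of the disorder time and the rate that are dominated by an integrable function of the
rate are integrable with respect to the likelihood ratio. -/
lemma integrable_mul_likelihoodRatio {f : ℝ × ℝ → ℝ} (hf : Measurable f) {g : ℝ → ℝ}
    (hg : Integrable g M.ν) (hfg : ∀ u v, |f (u, v)| ≤ |g v|) (t : ℝ≥0) :
    Integrable (fun p : (ℝ × ℝ) × (ℝ≥0 → ℕ) =>
      f p.1 * likelihoodRatio M.μ p.1.1 p.1.2 t (reg p.2)) (M.prior.prod M.pathLaw) := by
  have hL := measurable_likelihoodRatio M.μ t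
  have hm : Measurable fun p : (ℝ × ℝ) × (ℝ≥0 → ℕ) =>
      f p.1 * likelihoodRatio M.μ p.1.1 p.1.2 t (reg p.2) := (hf.comp measurable_fst).mul hL
  have hfi : Integrable f M.prior := by
    have : Integrable (fun p : ℝ × ℝ => g p.2) M.prior := by
      rw [prior_eq]; exact hg.comp_snd _
    exact this.mono hf.aestronglyMeasurable (ae_of_all _ fun p => hfg p.1 p.2)
  have hpos : ∀ᵐ x ∂M.prior, 0 ≤ x.1 ∧ 0 < x.2 := by
    rw [prior_eq]
    filter_upwards [Measure.quasiMeasurePreserving_fst.ae M.ae_thetaLaw_nonneg,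
      Measure.quasiMeasurePreserving_snd.ae M.ae_ν_pos] with x h1 h2
    exact ⟨h1, h2⟩
  refine ⟨hm.aestronglyMeasurable, ?_⟩
  rw [hasFiniteIntegral_iff_enorm, lintegral_prod _ hm.enorm.aemeasurable]
  refine lt_of_le_of_lt (lintegral_mono_ae ?_) (hasFiniteIntegral_iff_enorm.1 hfi.2)
  filter_upwards [hpos] with x hx
  have hm' : Measurable fun n : ℝ≥0 → ℕ => likelihoodRatio M.μ x.1 x.2 t (reg n) :=
    hL.comp (by fun_prop : Measurable fun n : ℝ≥0 → ℕ => (x, n))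
  -- Each likelihood ratio has mean one under the path law, so only the integrability of `f` under
  -- the prior matters.
  have h1 : ∫⁻ n, ENNReal.ofReal (likelihoodRatio M.μ x.1 x.2 t (reg n)) ∂M.pathLaw = 1 := by
    rw [pathLaw, lintegral_map hm'.ennreal_ofReal M.measurable_path,
      ← M.lintegral_likelihoodRatio hx.1 hx.2 t]
    refine lintegral_congr_ae ?_
    filter_upwards [M.ae_reg_path] with ω hω
    rw [hω]
  have h2 : ∀ n, ‖f x * likelihoodRatio M.μ x.1 x.2 t (reg n)‖ₑ =
      ‖f x‖ₑ * ENNReal.ofReal (likelihoodRatio M.μ x.1 x.2 t (reg n)) := fun n => by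
    rw [enorm_mul, Real.enorm_of_nonneg (likelihoodRatio_pos M.mu_pos hx.2 _ _ _).le]
  simp only [h2]
  rw [lintegral_const_mul _ hm'.ennreal_ofReal, h1, mul_one]

lemma ae_integrable_mul_likelihoodRatio {f : ℝ × ℝ → ℝ} (hf : Measurable f) {g : ℝ → ℝ}
    (hg : Integrable g M.ν) (hfg : ∀ u v, |f (u, v)| ≤ |g v|) (t : ℝ≥0) :
    ∀ᵐ ω ∂M.P₀, Integrable (fun x : ℝ × ℝ =>
      f x * likelihoodRatio M.μ x.1 x.2 t (M.path ω)) M.prior := by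
  have h := (M.integrable_mul_likelihoodRatio hf hg hfg t).prod_left_ae
  filter_upwards [ae_of_ae_map M.measurable_path.aemeasurable h, M.ae_reg_path] with ω h1 h2
  simpa only [h2] using h1

/-- The unnormalized posterior mean of a function of the rate on the event `θ ≤ t`. -/
lemma integral_mul_likelihoodRatio_le {g : ℝ → ℝ} (hgm : Measurable g) (hg : Integrable g M.ν)
    (t : ℝ≥0) : ∀ᵐ ω ∂M.P₀,
    ∫ x, (Set.Iic (t : ℝ)).indicator (fun _ => g x.2) x.1 *
        likelihoodRatio M.μ x.1 x.2 t (M.path ω) ∂M.prior =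
      M.survival t * ∫ v, g v * odds M.μ M.lam M.priorOdds v (M.path ω) t ∂M.ν := by
  have hfm : Measurable fun x : ℝ × ℝ => (Set.Iic (t : ℝ)).indicator (fun _ => g x.2) x.1 :=
    (hgm.comp measurable_snd).indicator (measurable_fst measurableSet_Iic)
  have hfg : ∀ u v, |(Set.Iic (t : ℝ)).indicator (fun _ => g v) u| ≤ |g v| := fun u v => by
    by_cases h : u ∈ Set.Iic (t : ℝ)
    · rw [Set.indicator_of_mem h]
    · rw [Set.indicator_of_notMem h, abs_zero]; exact abs_nonneg _
  filter_upwards [M.ae_integrable_mul_likelihoodRatio hfm hg hfg t, M.ae_path] with ω hω hp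
  rw [prior_eq] at hω ⊢
  rw [integral_prod_symm _ hω, ← integral_const_mul]
  refine integral_congr_ae ?_
  filter_upwards [M.ae_ν_pos] with v hv
  have h1 : ∀ u, (Set.Iic (t : ℝ)).indicator (fun _ => g v) u *
      likelihoodRatio M.μ u v t (M.path ω) =
      g v * (Set.Iic (t : ℝ)).indicator (fun u => likelihoodRatio M.μ u v t (M.path ω)) u := by
    intro u
    by_cases h : u ∈ Set.Iic (t : ℝ)
    · rw [Set.indicator_of_mem h, Set.indicator_of_mem h]
    · rw [Set.indicator_of_notMem h, Set.indicator_of_notMem h, zero_mul, mul_zero]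
  simp only [h1]
  rw [integral_const_mul, integral_indicator measurableSet_Iic,
    M.integral_likelihoodRatio_thetaLaw hv hp.1 hp.2]
  ring

/-- The unnormalized posterior mean of a function of the rate on the event `θ > t`. -/
lemma integral_mul_likelihoodRatio_gt (g : ℝ → ℝ) (t : ℝ≥0) (n : ℝ≥0 → ℕ) :
    ∫ x, (Set.Ioi (t : ℝ)).indicator (fun _ => g x.2) x.1 *
        likelihoodRatio M.μ x.1 x.2 t n ∂M.prior = M.survival t * ∫ v, g v ∂M.ν := by
  have h1 : ∀ x : ℝ × ℝ, (Set.Ioi (t : ℝ)).indicator (fun _ => g x.2) x.1 *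
        likelihoodRatio M.μ x.1 x.2 t n = (Set.Ioi (t : ℝ)).indicator 1 x.1 * g x.2 := by
    intro x
    by_cases h : x.1 ∈ Set.Ioi (t : ℝ)
    · rw [Set.indicator_of_mem h, Set.indicator_of_mem h, likelihoodRatio,
        if_neg (not_le.2 h)]
      simp
    · rw [Set.indicator_of_notMem h, Set.indicator_of_notMem h, zero_mul, zero_mul]
  simp only [h1]
  rw [prior_eq, integral_prod_mul, integral_indicator_one measurableSet_Ioi, measureReal_def,
    thetaLaw_Ioi, ENNReal.toReal_ofReal (M.survival_pos t).le]

end Model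

/-! ### Bayes' formula and the physical measure -/

/-- Bayes' formula for conditional expectations under a change of measure. -/
lemma condExp_withDensity {Ω : Type*} {m m₀ : MeasurableSpace Ω} {P : Measure[m₀] Ω}
    [IsFiniteMeasure P] (hm : m ≤ m₀) {D : Ω → ℝ} (hD : Measurable D) (hDi : Integrable D P)
    (hD0 : 0 ≤ᵐ[P] D) {f : Ω → ℝ}
    (hf : Integrable f (P.withDensity fun ω => ENNReal.ofReal (D ω))) :
    (fun ω => ((P.withDensity fun ω => ENNReal.ofReal (D ω))[f | m]) ω * (P[D | m]) ω)
      =ᵐ[P] P[fun ω => D ω * f ω | m] := by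
  set Q := P.withDensity fun ω => ENNReal.ofReal (D ω) with hQ
  have : IsFiniteMeasure Q := isFiniteMeasure_withDensity_ofReal hDi.2
  have hreal : ∀ g : Ω → ℝ, (fun ω => (ENNReal.ofReal (D ω)).toReal • g ω) =ᵐ[P]
      fun ω => D ω * g ω := fun g => by
    filter_upwards [hD0] with ω hω
    rw [ENNReal.toReal_ofReal hω, smul_eq_mul]
  have hint : ∀ g : Ω → ℝ, Integrable g Q → Integrable (fun ω => D ω * g ω) P := fun g hg =>
    ((integrable_withDensity_iff_integrable_smul' hD.ennreal_ofReal
      (ae_of_all _ fun _ => ENNReal.ofReal_lt_top)).1 hg).congr (hreal g)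
  have hset : ∀ (g : Ω → ℝ) (s : Set Ω), MeasurableSet[m₀] s →
      ∫ ω in s, g ω ∂Q = ∫ ω in s, D ω * g ω ∂P := fun g s hs => by
    rw [hQ, setIntegral_withDensity_eq_setIntegral_toReal_smul hD.ennreal_ofReal
      (ae_of_all _ fun _ => ENNReal.ofReal_lt_top) _ hs]
    exact integral_congr_ae (ae_restrict_of_ae (hreal g))
  have hY : Integrable (Q[f | m]) Q := integrable_condExp
  -- The candidate is itself a `P`-conditional expectation, by pulling `Q[f | m]` out; this also
  -- supplies its integrability.
  have hpull : P[fun ω => (Q[f | m]) ω * D ω | m] =ᵐ[P] fun ω => (Q[f | m]) ω * (P[D | m]) ω :=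
    condExp_mul_of_aestronglyMeasurable_left stronglyMeasurable_condExp.aestronglyMeasurable
      ((hint _ hY).congr (ae_of_all _ fun ω => mul_comm _ _)) hDi
  have hmulint : Integrable (fun ω => (Q[f | m]) ω * (P[D | m]) ω) P :=
    integrable_condExp.congr hpull
  refine ae_eq_condExp_of_forall_setIntegral_eq hm (hint f hf) (fun s _ _ => hmulint.integrableOn)
    (fun s hs _ => ?_) ?_
  · rw [← setIntegral_congr_ae (hm s hs) (hpull.mono fun ω h _ => h),
      setIntegral_condExp hm ((hint _ hY).congr (ae_of_all _ fun ω => mul_comm _ _)) hs,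
      ← hset f s (hm s hs), ← setIntegral_condExp hm hf hs, hset _ s (hm s hs)]
    simp only [mul_comm]
  · exact (stronglyMeasurable_condExp.mul stronglyMeasurable_condExp).aestronglyMeasurable

namespace Model

variable {Ω : Type*} [mΩ : MeasurableSpace Ω] (M : Model Ω)

/-- At `s = θ` the left limit is still `μ`, so a jump at the disorder time is not reweighted, in
accordance with the exponent `n t - n u` of `likelihoodRatio`. -/
lemma leftLim_h {s : ℝ≥0} (hs : 0 < s) (ω : Ω) :
    Function.leftLim (fun u => M.h u ω) s = if (s : ℝ) ≤ M.θ ω then M.μ else M.Λ ω := by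
  have : (𝓝[<] s).NeBot := nhdsLT_neBot_of_exists_lt ⟨0, hs⟩
  refine leftLim_eq_of_tendsto (tendsto_const_nhds.congr' ?_)
  split_ifs with h
  · filter_upwards [self_mem_nhdsWithin] with u hu
    have : (u : ℝ) < M.θ ω := lt_of_lt_of_le (by exact_mod_cast hu) h
    rw [Model.h, if_pos this]
  · have h1 : ∀ᶠ u : ℝ≥0 in 𝓝[<] s, M.θ ω < u :=
      nhdsWithin_le_nhds (NNReal.continuous_coe.tendsto s (Ioi_mem_nhds (not_le.1 h)))
    filter_upwards [h1] with u hu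
    rw [Model.h, if_neg (not_lt.2 hu.le)]

lemma integral_h_sub {ω : Ω} (hθ : 0 ≤ M.θ ω) (t : ℝ≥0) :
    ∫ s in (0 : ℝ)..t, (M.h s.toNNReal ω - M.μ) =
      if M.θ ω ≤ t then (M.Λ ω - M.μ) * (t - M.θ ω) else 0 := by
  have hfun : ∀ s : ℝ, 0 ≤ s → M.h s.toNNReal ω - M.μ =
      if s < M.θ ω then 0 else M.Λ ω - M.μ := fun s hs => by
    rw [Model.h, Real.coe_toNNReal _ hs]
    split_ifs <;> ring
  have hbefore : ∀ r : ℝ, 0 ≤ r → r ≤ M.θ ω →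
      ∫ s in (0 : ℝ)..r, (M.h s.toNNReal ω - M.μ) = 0 := fun r h0 hr => by
    refine (intervalIntegral.integral_congr_ae (g := fun _ => (0 : ℝ)) ?_).trans (by simp)
    filter_upwards [measure_eq_zero_iff_ae_notMem.1 (measure_singleton (μ := volume) (M.θ ω))]
      with s hs hsr
    rw [Set.uIoc_of_le h0] at hsr
    rw [hfun s hsr.1.le, if_pos (lt_of_le_of_ne (hsr.2.trans hr) hs)]
  split_ifs with h
  · have hafter : Set.EqOn (fun _ => M.Λ ω - M.μ) (fun s : ℝ => M.h s.toNNReal ω - M.μ)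
        (Set.uIcc (M.θ ω) t) := fun s hs => by
      rw [Set.uIcc_of_le h] at hs
      simp only [hfun s (hθ.trans hs.1), if_neg (not_lt.2 hs.1)]
    have hi1 : IntervalIntegrable (fun s : ℝ => M.h s.toNNReal ω - M.μ) volume 0 (M.θ ω) := by
      refine (intervalIntegrable_const (c := (0 : ℝ))).congr_ae ?_
      rw [Set.uIoc_of_le hθ]
      filter_upwards [ae_restrict_mem measurableSet_Ioc, ae_restrict_of_ae
        (measure_eq_zero_iff_ae_notMem.1 (measure_singleton (μ := volume) (M.θ ω)))] with s hs hs'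
      rw [hfun s hs.1.le, if_pos (lt_of_le_of_ne hs.2 hs')]
    have hi2 : IntervalIntegrable (fun s : ℝ => M.h s.toNNReal ω - M.μ) volume (M.θ ω) t :=
      (intervalIntegrable_const (c := M.Λ ω - M.μ)).congr
        (hafter.mono Set.uIoc_subset_uIcc)
    rw [← intervalIntegral.integral_add_adjacent_intervals hi1 hi2, hbefore _ hθ le_rfl, zero_add,
      ← intervalIntegral.integral_congr hafter, intervalIntegral.integral_const, smul_eq_mul]
    ring
  · exact hbefore t t.2 (not_le.1 h).le

lemma jumpIntegral_log_h {ω : Ω} (hθ : 0 ≤ M.θ ω) (hn : IsCountingPath (M.path ω)) (t : ℝ≥0) :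
    jumpIntegral (fun s => Real.log (Function.leftLim (fun u => M.h u ω) s / M.μ))
      (M.path ω) t = if M.θ ω ≤ t then Real.log (M.Λ ω / M.μ) *
        ((M.path ω t : ℝ) - M.path ω (M.θ ω).toNNReal) else 0 := by
  have hlog : ∀ s : ℝ≥0, 0 < s →
      Real.log (Function.leftLim (fun u => M.h u ω) s / M.μ) =
        if (s : ℝ) ≤ M.θ ω then 0 else Real.log (M.Λ ω / M.μ) := fun s hs => by
    rw [M.leftLim_h hs]
    split_ifs
    · rw [div_self M.mu_pos.ne', Real.log_one]
    · rfl
  have hbefore : ∀ r : ℝ≥0, (r : ℝ) ≤ M.θ ω →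
      jumpIntegral (fun s => Real.log (Function.leftLim (fun u => M.h u ω) s / M.μ))
        (M.path ω) r = 0 := fun r hr => by
    refine finsum_mem_eq_zero_of_forall_eq_zero fun s hs => ?_
    have : (s : ℝ) ≤ M.θ ω := le_trans (by exact_mod_cast hs.2) hr
    simp only [hlog s hs.1, if_pos this, zero_mul]
  split_ifs with h
  · have hle : (M.θ ω).toNNReal ≤ t := Real.toNNReal_le_iff_le_coe.2 h
    have hc := hn.jumpIntegral_eq_add (fun _ => Real.log (M.Λ ω / M.μ)) hle
    rw [hn.jumpIntegral_const, hn.jumpIntegral_const] at hc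
    rw [hn.jumpIntegral_eq_add _ hle, hbefore _ (Real.coe_toNNReal _ hθ).le, zero_add]
    have : ∑ᶠ u ∈ Set.Ioc (M.θ ω).toNNReal t,
        Real.log (Function.leftLim (fun u => M.h u ω) u / M.μ) * jump (M.path ω) u =
        ∑ᶠ u ∈ Set.Ioc (M.θ ω).toNNReal t, Real.log (M.Λ ω / M.μ) * jump (M.path ω) u := by
      refine finsum_mem_congr rfl fun s hs => ?_
      rw [hlog s (lt_of_le_of_lt zero_le hs.1), if_neg]
      rw [not_le, ← Real.coe_toNNReal _ hθ]
      exact_mod_cast hs.1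
    rw [this]
    linarith
  · exact hbefore t (not_le.1 h).le

/-- The density of the physical measure up to time `t`. -/
def density (t : ℝ≥0) (ω : Ω) : ℝ :=
  likelihoodRatio M.μ (M.θ ω) (M.Λ ω) t (reg (M.path ω))

lemma measurable_density (t : ℝ≥0) : Measurable (M.density t) :=
  (measurable_likelihoodRatio M.μ t).comp
    ((M.theta_meas.prodMk M.Lambda_meas).prodMk M.measurable_path)

lemma density_pos (t : ℝ≥0) : ∀ᵐ ω ∂M.P₀, 0 < M.density t ω :=
  M.Lambda_pos.mono fun _ h => likelihoodRatio_pos M.mu_pos h _ _ _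

lemma Z_eq_density (t : ℝ≥0) : M.Z t =ᵐ[M.P₀] M.density t := by
  filter_upwards [M.ae_path, M.ae_theta_nonneg, M.Lambda_pos] with ω hn hθ hΛ
  rw [Z, density, hn.1.reg_eq, likelihoodRatio, M.integral_h_sub hθ]
  have := M.jumpIntegral_log_h hθ hn.1 t
  change Real.exp (jumpIntegral _ (M.path ω) t - _) = _
  rw [this]
  split_ifs with h
  · have hr := div_pos hΛ M.mu_pos
    have hle := hn.1.mono (Real.toNNReal_le_iff_le_coe.2 h : (M.θ ω).toNNReal ≤ t)
    rw [sub_eq_add_neg, Real.exp_add, mul_comm, ← Nat.cast_sub hle, mul_comm (Real.log _),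
      Real.exp_nat_mul, Real.exp_log hr]
  · simp

lemma P_eq (t : ℝ≥0) : M.P t = M.P₀.withDensity fun ω => ENNReal.ofReal (M.density t ω) :=
  withDensity_congr_ae ((M.Z_eq_density t).fun_comp ENNReal.ofReal)

/-- The density is almost surely positive, so the measures are equivalent and almost sure statements
pass between them. -/
lemma ae_P (t : ℝ≥0) : ae (M.P t) = ae M.P₀ := by
  rw [P_eq]
  refine le_antisymm (withDensity_absolutelyContinuous _ _).ae_le
    (withDensity_absolutelyContinuous' (M.measurable_density t).ennreal_ofReal.aemeasurable
      ?_).ae_le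
  filter_upwards [M.density_pos t] with ω hω
  exact (ENNReal.ofReal_pos.2 hω).ne'

lemma integrable_mul_density {f : ℝ × ℝ → ℝ} (hf : Measurable f) {g : ℝ → ℝ}
    (hg : Integrable g M.ν) (hfg : ∀ u v, |f (u, v)| ≤ |g v|) (t : ℝ≥0) :
    Integrable (fun ω => f (M.θ ω, M.Λ ω) * M.density t ω) M.P₀ := by
  have h := M.integrable_mul_likelihoodRatio hf hg hfg t
  rw [← map_prior_path] at h
  exact h.comp_measurable ((M.theta_meas.prodMk M.Lambda_meas).prodMk M.measurable_path)

lemma integrable_density (t : ℝ≥0) : Integrable (M.density t) M.P₀ := by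
  simpa using M.integrable_mul_density (f := fun _ => 1) measurable_const
    (integrable_const (1 : ℝ)) (fun _ _ => le_rfl) t

instance (t : ℝ≥0) : IsFiniteMeasure (M.P t) := by
  rw [P_eq]; exact isFiniteMeasure_withDensity_ofReal (M.integrable_density t).2

lemma integrable_P {f : ℝ × ℝ → ℝ} (hf : Measurable f) {g : ℝ → ℝ}
    (hg : Integrable g M.ν) (hfg : ∀ u v, |f (u, v)| ≤ |g v|) (t : ℝ≥0) :
    Integrable (fun ω => f (M.θ ω, M.Λ ω)) (M.P t) := by
  rw [P_eq, integrable_withDensity_iff_integrable_smul' (M.measurable_density t).ennreal_ofReal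
    (ae_of_all _ fun _ => ENNReal.ofReal_lt_top)]
  refine (M.integrable_mul_density hf hg hfg t).congr ?_
  filter_upwards [M.density_pos t] with ω hω
  rw [ENNReal.toReal_ofReal hω.le, smul_eq_mul, mul_comm]

/-- Conditional expectations given the observations are integrals over the prior law. -/
lemma condExp_mul_density {f : ℝ × ℝ → ℝ} (hf : Measurable f) {g : ℝ → ℝ}
    (hg : Integrable g M.ν) (hfg : ∀ u v, |f (u, v)| ≤ |g v|) {t : ℝ≥0} {A : Ω → ℝ}
    (hA : Measurable[M.F t] A)
    (hAe : ∀ᵐ ω ∂M.P₀, ∫ x, f x * likelihoodRatio M.μ x.1 x.2 t (M.path ω) ∂M.prior = A ω) :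
    M.P₀[fun ω => M.density t ω * f (M.θ ω, M.Λ ω) | M.F t] =ᵐ[M.P₀] A := by
  have hpair := (M.theta_meas.prodMk M.Lambda_meas).prodMk M.measurable_path
  have hprod := M.integrable_mul_likelihoodRatio hf hg hfg t
  have hint := M.integrable_mul_density hf hg hfg t
  have hAe' : (fun ω => ∫ x, f x * likelihoodRatio M.μ x.1 x.2 t (reg (M.path ω)) ∂M.prior)
      =ᵐ[M.P₀] A := by
    filter_upwards [hAe, M.ae_reg_path] with ω h1 h2
    rw [h2, h1]
  have hAint : Integrable A M.P₀ :=
    (hprod.integral_prod_right.comp_measurable M.measurable_path).congr hAe'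
  refine (ae_eq_condExp_of_forall_setIntegral_eq (M.F.le t)
    (hint.congr (ae_of_all _ fun ω => mul_comm _ _)) (fun s _ _ => hAint.integrableOn)
    (fun s hs _ => ?_) hA.aestronglyMeasurable).symm
  -- Up to a null event, an observable event is a path event; on it the joint law is prior times
  -- path law, and Fubini applies.
  obtain ⟨C, hC, hsC⟩ := M.exists_ae_eq_preimage hs
  rw [setIntegral_congr_set hsC, setIntegral_congr_set hsC,
    ← setIntegral_congr_ae (M.measurable_path hC) (hAe'.mono fun ω h _ => h)]
  have h1 : ∫ ω in M.path ⁻¹' C,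
      ∫ x, f x * likelihoodRatio M.μ x.1 x.2 t (reg (M.path ω)) ∂M.prior ∂M.P₀ =
      ∫ n in C, ∫ x, f x * likelihoodRatio M.μ x.1 x.2 t (reg n) ∂M.prior ∂M.pathLaw := by
    rw [pathLaw, setIntegral_map hC _ M.measurable_path.aemeasurable]
    exact hprod.integral_prod_right.aestronglyMeasurable
  have h2 : ∫ ω in M.path ⁻¹' C, M.density t ω * f (M.θ ω, M.Λ ω) ∂M.P₀ =
      ∫ p in Set.univ ×ˢ C, f p.1 * likelihoodRatio M.μ p.1.1 p.1.2 t (reg p.2)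
        ∂M.prior.prod M.pathLaw := by
    rw [← map_prior_path, setIntegral_map (MeasurableSet.univ.prod hC) _ hpair.aemeasurable]
    · have : (fun ω => ((M.θ ω, M.Λ ω), M.path ω)) ⁻¹' (Set.univ ×ˢ C) = M.path ⁻¹' C := by
        ext ω; simp
      rw [this]
      simp only [density, mul_comm]
    · rw [map_prior_path]; exact hprod.aestronglyMeasurable
  rw [h1, h2, ← Measure.prod_restrict, Measure.restrict_univ, integral_prod_symm]
  have := hprod.integrableOn (s := Set.univ ×ˢ C)
  rwa [IntegrableOn, ← Measure.prod_restrict, Measure.restrict_univ] at this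

end Model

/-! ### The explicit càdlàg version of the odds-ratio processes -/

lemma measurable_integral_mul_odds {μ lam a : ℝ} {ν : Measure ℝ} [SFinite ν] {g : ℝ → ℝ}
    (hg : Measurable g) (t : ℝ≥0) :
    Measurable fun n => ∫ v, g v * odds μ lam a v (reg n) t ∂ν := by
  have h : StronglyMeasurable (Function.uncurry fun (n : ℝ≥0 → ℕ) (v : ℝ) =>
      g v * odds μ lam a v (reg n) t) :=
    ((hg.comp measurable_snd).mul ((measurable_odds μ lam a).comp
      (by fun_prop : Measurable fun p : (ℝ≥0 → ℕ) × ℝ => (p.2, t, p.1)))).stronglyMeasurable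
  exact (h.integral_prod_right (ν := ν)).measurable

/-- The path stopped at time `t`. -/
def stopped (t : ℝ≥0) (n : ℝ≥0 → ℕ) (s : ℝ≥0) : ℕ := n (min s t)

lemma IsCountingPath.stopped {n : ℝ≥0 → ℕ} (hn : IsCountingPath n) (t : ℝ≥0) :
    IsCountingPath (stopped t n) := by
  refine ⟨fun s u hsu => hn.mono (min_le_min_right t hsu), fun s => ?_⟩
  have h2 : Tendsto (fun u => min u t) (𝓝[≥] s) (𝓝[≥] (min s t)) :=
    tendsto_nhdsWithin_iff.2 ⟨(by fun_prop : Continuous fun u => min u t).continuousWithinAt,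
      eventually_mem_nhdsWithin.mono fun u hu => min_le_min_right t (Set.mem_Ici.1 hu)⟩
  rw [ContinuousWithinAt, nhds_discrete, tendsto_pure]
  exact h2.eventually (hn.eventually_right (min s t))

namespace Model

variable {Ω : Type*} [mΩ : MeasurableSpace Ω] (M : Model Ω)

/-- Functionals of the path up to time `t` are observable at time `t`. -/
lemma measurable_F_functional {α : Type*} [MeasurableSpace α] {H : (ℝ≥0 → ℕ) → α} {t : ℝ≥0}
    (hH : Measurable fun n => H (reg n))
    (hloc : ∀ n n' : ℝ≥0 → ℕ, (∀ u ≤ t, n u = n' u) → H n = H n') :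
    Measurable[M.F t] fun ω => H (reg (M.path ω)) := by
  -- `reg` looks beyond time `t`. The stopped path is observable at `t`, is its own regularization
  -- almost surely, and agrees with the path up to `t`.
  have hs : Measurable[M.F t] fun ω => stopped t (M.path ω) :=
    @measurable_pi_lambda Ω _ _ (M.F t) _ _ fun s => M.measurable_N_F (min_le_right s t)
  have hg : Measurable[M.F t] fun ω => H (reg (stopped t (M.path ω))) := hH.comp hs
  refine M.measurable_F_of_ae_eq (hH.comp M.measurable_path)
    hg ?_
  filter_upwards [M.ae_path] with ω hω
  rw [(hω.1.stopped t).reg_eq, hω.1.reg_eq]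
  refine hloc _ _ fun u hu => ?_
  rw [stopped, min_eq_left hu]

/-- The explicit version of the weighted odds-ratio processes. -/
def oddsMoment (k : ℕ) (t : ℝ≥0) (ω : Ω) : ℝ :=
  momentOdds M.μ M.lam M.priorOdds M.ν k (reg (M.path ω)) t

lemma measurable_F_integral_mul_odds {g : ℝ → ℝ} (hg : Measurable g) (t : ℝ≥0) :
    Measurable[M.F t] fun ω =>
      ∫ v, g v * odds M.μ M.lam M.priorOdds v (reg (M.path ω)) t ∂M.ν :=
  M.measurable_F_functional (H := fun n => ∫ v, g v * odds M.μ M.lam M.priorOdds v n t ∂M.ν)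
    (measurable_integral_mul_odds hg t) fun n n' h => by simp only [odds_congr h]

lemma measurable_F_oddsMoment (k : ℕ) (t : ℝ≥0) : Measurable[M.F t] (M.oddsMoment k t) :=
  M.measurable_F_integral_mul_odds (by fun_prop) t

lemma oddsMoment_zero_nonneg (t : ℝ≥0) (ω : Ω) : 0 ≤ M.oddsMoment 0 t ω := by
  refine integral_nonneg_of_ae ?_
  filter_upwards [M.ae_ν_pos] with v hv
  rw [pow_zero, one_mul]
  exact odds_nonneg M.mu_pos hv M.lam_pos.le M.priorOdds_nonneg t

lemma isCadlag_oddsMoment (k : ℕ) (ω : Ω) : IsCadlag fun t => M.oddsMoment k t ω :=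
  isCadlag_momentOdds (ν := M.ν) (isCountingPath_reg _) M.moments M.mu_pos M.ae_ν_pos M.lam_pos.le
    M.priorOdds_nonneg k

lemma condExp_mul_density_le {g : ℝ → ℝ} (hgm : Measurable g) (hg : Integrable g M.ν) (t : ℝ≥0) :
    M.P₀[fun ω => M.density t ω * (Set.Iic (t : ℝ)).indicator (fun _ => g (M.Λ ω)) (M.θ ω)
      | M.F t] =ᵐ[M.P₀] fun ω => M.survival t *
        ∫ v, g v * odds M.μ M.lam M.priorOdds v (reg (M.path ω)) t ∂M.ν := by
  refine M.condExp_mul_density (f := fun x => (Set.Iic (t : ℝ)).indicator (fun _ => g x.2) x.1)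
    ((hgm.comp measurable_snd).indicator (measurable_fst measurableSet_Iic)) hg (fun u v => ?_)
    ((M.measurable_F_integral_mul_odds hgm t).const_mul _) ?_
  · by_cases h : u ∈ Set.Iic (t : ℝ)
    · simp only [Set.indicator_of_mem h, le_refl]
    · simp only [Set.indicator_of_notMem h, abs_zero, abs_nonneg]
  · filter_upwards [M.integral_mul_likelihoodRatio_le hgm hg t, M.ae_reg_path] with ω h1 h2
    rw [h1, h2]

lemma condExp_mul_density_gt {g : ℝ → ℝ} (hgm : Measurable g) (hg : Integrable g M.ν) (t : ℝ≥0) :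
    M.P₀[fun ω => M.density t ω * (Set.Ioi (t : ℝ)).indicator (fun _ => g (M.Λ ω)) (M.θ ω)
      | M.F t] =ᵐ[M.P₀] fun _ => M.survival t * ∫ v, g v ∂M.ν := by
  refine M.condExp_mul_density (f := fun x => (Set.Ioi (t : ℝ)).indicator (fun _ => g x.2) x.1)
    ((hgm.comp measurable_snd).indicator (measurable_fst measurableSet_Ioi)) hg (fun u v => ?_)
    measurable_const ?_
  · by_cases h : u ∈ Set.Ioi (t : ℝ)
    · simp only [Set.indicator_of_mem h, le_refl]
    · simp only [Set.indicator_of_notMem h, abs_zero, abs_nonneg]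
  · exact ae_of_all _ fun ω => M.integral_mul_likelihoodRatio_gt g t _

lemma condExp_density (t : ℝ≥0) : M.P₀[M.density t | M.F t] =ᵐ[M.P₀]
    fun ω => M.survival t * (1 + M.oddsMoment 0 t ω) := by
  have h1 := M.condExp_mul_density_le (g := fun _ => 1) measurable_const (integrable_const _) t
  have h2 := M.condExp_mul_density_gt (g := fun _ => 1) measurable_const (integrable_const _) t
  have hI : ∀ s : Set ℝ, MeasurableSet s →
      Integrable (fun ω => M.density t ω * s.indicator (fun _ => (1 : ℝ)) (M.θ ω)) M.P₀ := by
    intro s hs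
    refine (M.integrable_density t).mono ((M.measurable_density t).mul
      ((measurable_const.indicator hs).comp M.theta_meas)).aestronglyMeasurable
      (ae_of_all _ fun ω => ?_)
    by_cases h : M.θ ω ∈ s
    · simp [Set.indicator_of_mem h]
    · simp [Set.indicator_of_notMem h]
  have hsum : M.density t = (fun ω => M.density t ω * (Set.Iic (t : ℝ)).indicator
      (fun _ => (1 : ℝ)) (M.θ ω)) + fun ω => M.density t ω * (Set.Ioi (t : ℝ)).indicator
      (fun _ => (1 : ℝ)) (M.θ ω) := by
    funext ω
    rw [Pi.add_apply, ← mul_add]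
    by_cases h : M.θ ω ≤ t
    · rw [Set.indicator_of_mem (Set.mem_Iic.2 h), Set.indicator_of_notMem (by simpa using h)]
      simp
    · rw [Set.indicator_of_notMem (by simpa using h), Set.indicator_of_mem (by simpa using h)]
      simp
  have h3 := condExp_add (hI (Set.Iic (t : ℝ)) measurableSet_Iic)
    (hI (Set.Ioi (t : ℝ)) measurableSet_Ioi) (M.F t)
  rw [← hsum] at h3
  filter_upwards [h1, h2, h3] with ω e1 e2 e3
  rw [e3, Pi.add_apply, e1, e2, oddsMoment, momentOdds]
  simp
  ring

/-- The survival probability occurs in the numerator and, by `condExp_density`, in the denominator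
of Bayes' formula, and cancels. -/
lemma condExp_P {f : ℝ × ℝ → ℝ} (hf : Measurable f) {g : ℝ → ℝ}
    (hg : Integrable g M.ν) (hfg : ∀ u v, |f (u, v)| ≤ |g v|) {t : ℝ≥0} {A : Ω → ℝ}
    (hA : M.P₀[fun ω => M.density t ω * f (M.θ ω, M.Λ ω) | M.F t] =ᵐ[M.P₀]
      fun ω => M.survival t * A ω) :
    (M.P t)[fun ω => f (M.θ ω, M.Λ ω) | M.F t] =ᵐ[M.P₀] fun ω =>
      A ω / (1 + M.oddsMoment 0 t ω) := by
  have hint := M.integrable_P hf hg hfg t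
  rw [P_eq] at hint ⊢
  have h := condExp_withDensity (M.F.le t) (M.measurable_density t) (M.integrable_density t)
    ((M.density_pos t).mono fun ω h => h.le) hint
  filter_upwards [h, hA, M.condExp_density t] with ω h1 h2 h3
  rw [h2, h3] at h1
  have hs := M.survival_pos t
  have ho := M.oddsMoment_zero_nonneg t ω
  rw [eq_div_iff (by linarith)]
  have h4 : M.survival t * ((M.P₀.withDensity fun ω => ENNReal.ofReal (M.density t ω))[
      fun ω => f (M.θ ω, M.Λ ω) | M.F t] ω * (1 + M.oddsMoment 0 t ω)) = M.survival t * A ω := by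
    rw [← h1]; ring
  exact mul_left_cancel₀ hs.ne' h4

lemma condExp_P_le {g : ℝ → ℝ} (hgm : Measurable g) (hg : Integrable g M.ν) (t : ℝ≥0) :
    (M.P t)[Set.indicator {ω | M.θ ω ≤ t} (fun ω => g (M.Λ ω)) | M.F t] =ᵐ[M.P₀] fun ω =>
      (∫ v, g v * odds M.μ M.lam M.priorOdds v (reg (M.path ω)) t ∂M.ν) /
        (1 + M.oddsMoment 0 t ω) := by
  refine M.condExp_P (f := fun x => (Set.Iic (t : ℝ)).indicator (fun _ => g x.2) x.1)
    ((hgm.comp measurable_snd).indicator (measurable_fst measurableSet_Iic)) hg (fun u v => ?_)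
    (M.condExp_mul_density_le hgm hg t)
  by_cases h : u ∈ Set.Iic (t : ℝ)
  · simp only [Set.indicator_of_mem h, le_refl]
  · simp only [Set.indicator_of_notMem h, abs_zero, abs_nonneg]

lemma condExp_P_gt {g : ℝ → ℝ} (hgm : Measurable g) (hg : Integrable g M.ν) (t : ℝ≥0) :
    (M.P t)[Set.indicator {ω | (t : ℝ) < M.θ ω} (fun ω => g (M.Λ ω)) | M.F t] =ᵐ[M.P₀] fun ω =>
      (∫ v, g v ∂M.ν) / (1 + M.oddsMoment 0 t ω) := by
  refine M.condExp_P (f := fun x => (Set.Ioi (t : ℝ)).indicator (fun _ => g x.2) x.1)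
    ((hgm.comp measurable_snd).indicator (measurable_fst measurableSet_Ioi)) hg (fun u v => ?_)
    (M.condExp_mul_density_gt hgm hg t)
  by_cases h : u ∈ Set.Ioi (t : ℝ)
  · simp only [Set.indicator_of_mem h, le_refl]
  · simp only [Set.indicator_of_notMem h, abs_zero, abs_nonneg]

/-- With `Π = Φ^(0) / (1 + Φ^(0))`, dividing by `1 - Π` removes the normalization `1 + Φ^(0)`. -/
lemma oddsRatio_eq (k : ℕ) (t : ℝ≥0) : M.oddsRatio k t =ᵐ[M.P₀] M.oddsMoment k t := by
  have h1 := M.condExp_P_le (g := fun _ => 1) measurable_const (integrable_const _) t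
  have h2 := M.condExp_P_le (g := fun v => (v - M.μ) ^ k) (by fun_prop) (M.moments k) t
  filter_upwards [h1, h2] with ω e1 e2
  have ho := M.oddsMoment_zero_nonneg t ω
  have h3 : M.posterior t ω = M.oddsMoment 0 t ω / (1 + M.oddsMoment 0 t ω) := by
    rw [posterior, e1]
    simp only [oddsMoment, momentOdds, pow_zero]
  rw [oddsRatio, e2, h3]
  change M.oddsMoment k t ω / _ / _ = _
  have : 1 + M.oddsMoment 0 t ω ≠ 0 := by linarith
  field_simp
  simp

lemma isOddsRatioFamily_oddsMoment : M.IsOddsRatioFamily M.oddsMoment where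
  adapted k t := M.measurable_F_oddsMoment k t
  cadlag := ae_of_all _ fun ω k => M.isCadlag_oddsMoment k ω
  version k t := by
    rw [EventuallyEq, ae_P]
    exact (M.oddsRatio_eq k t).symm

/-- Two right-continuous paths that agree on a dense set of times agree. -/
lemma _root_.PoissonDisorder.IsCadlag.eq_of_denseSeq {f g : ℝ≥0 → ℝ} (hf : IsCadlag f)
    (hg : IsCadlag g) (h : ∀ i, f (TopologicalSpace.denseSeq ℝ≥0 i) =
      g (TopologicalSpace.denseSeq ℝ≥0 i)) : f = g := by
  funext t
  have hfr : Tendsto f (𝓝[>] t) (𝓝 (f t)) :=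
    (hf t).1.tendsto.mono_left (nhdsWithin_mono _ Set.Ioi_subset_Ici_self)
  have hgr : Tendsto g (𝓝[>] t) (𝓝 (g t)) :=
    (hg t).1.tendsto.mono_left (nhdsWithin_mono _ Set.Ioi_subset_Ici_self)
  refine tendsto_nhds_unique_of_frequently_eq hfr hgr ?_
  rw [frequently_iff]
  intro U hU
  obtain ⟨u, hu, hsub⟩ := (mem_nhdsGT_iff_exists_Ioo_subset' (lt_add_one t)).1 hU
  obtain ⟨i, hi, hi'⟩ := exists_denseSeq_btwn hu
  exact ⟨_, hsub ⟨hi, hi'⟩, h i⟩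

/-- For each order and each of countably many dense times equality holds almost surely;
right-continuity extends it to all times. Everything asserted of a family of versions is transferred
from the explicit one in this way. -/
lemma IsOddsRatioFamily.ae_eq_oddsMoment {Φ : ℕ → ℝ≥0 → Ω → ℝ} (hΦ : M.IsOddsRatioFamily Φ) :
    ∀ᵐ ω ∂M.P₀, ∀ k t, Φ k t ω = M.oddsMoment k t ω := by
  have h : ∀ k i, ∀ᵐ ω ∂M.P₀, Φ k (TopologicalSpace.denseSeq ℝ≥0 i) ω =
      M.oddsMoment k (TopologicalSpace.denseSeq ℝ≥0 i) ω := by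
    intro k i
    have h1 := hΦ.version k (TopologicalSpace.denseSeq ℝ≥0 i)
    rw [EventuallyEq, ae_P] at h1
    exact EventuallyEq.trans h1 (M.oddsRatio_eq k _)
  filter_upwards [hΦ.cadlag, ae_all_iff.2 fun k => ae_all_iff.2 (h k)] with ω h1 h2 k t
  exact congrFun ((h1 k).eq_of_denseSeq (M.isCadlag_oddsMoment k ω) (h2 k)) t

lemma IsOddsRatioFamily.solvesJumpEquations {Φ : ℕ → ℝ≥0 → Ω → ℝ} (hΦ : M.IsOddsRatioFamily Φ) :
    ∀ᵐ ω ∂M.P₀, M.SolvesJumpEquations Φ ω := by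
  filter_upwards [hΦ.ae_eq_oddsMoment, M.ae_path, M.poisson.ae_unitJumps] with ω h1 hn hu
  have h2 : ∀ k, (fun u => Φ k u ω) =
      momentOdds M.μ M.lam M.priorOdds M.ν k (M.path ω) := fun k => by
    funext u
    rw [h1, oddsMoment, hn.1.reg_eq]
  have h3 : ∀ k u, Φ k u ω = momentOdds M.μ M.lam M.priorOdds M.ν k (M.path ω) u :=
    fun k u => congrFun (h2 k) u
  intro k t
  rw [h2]
  simp only [h3]
  exact momentOdds_eq (ν := M.ν) hn.1 M.moments M.mu_pos M.ae_ν_pos M.lam_pos.le M.priorOdds_nonneg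
    hn.2 hu k t

end Model

/-! ### Finitely many rates: interpolation and the flow of the moments -/

section FiniteSupport

variable {μ lam a : ℝ} {ν : Measure ℝ} {n : ℝ≥0 → ℕ} {S : Finset ℝ} {k : ℕ}

/-- The polynomial in `v - μ` that interpolates a function on a finite set of rates. -/
def interpolant (μ : ℝ) (S : Finset ℝ) (φ : ℝ → ℝ) : ℝ[X] :=
  Lagrange.interpolate S (fun v => v - μ) φ

lemma eval_interpolant {φ : ℝ → ℝ} {v : ℝ} (hv : v ∈ S) :
    (interpolant μ S φ).eval (v - μ) = φ v := by
  rw [interpolant, Lagrange.eval_interpolate_at_node (v := fun v => v - μ) φ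
    (fun x _ y _ h => sub_left_injective h) hv]

lemma natDegree_interpolant_lt (hk : k ≠ 0) (hS : S.card ≤ k) (φ : ℝ → ℝ) :
    (interpolant μ S φ).natDegree < k := by
  have h : (interpolant μ S φ).degree < (k : WithBot ℕ) :=
    (Lagrange.degree_interpolate_lt φ fun x _ y _ h => sub_left_injective h).trans_le
      (by exact_mod_cast hS)
  rcases eq_or_ne (interpolant μ S φ) 0 with h0 | h0
  · rw [h0, natDegree_zero]
    exact Nat.pos_of_ne_zero hk
  · exact (natDegree_lt_iff_degree_lt h0).2 h

/-- The coefficients are linear in the finitely many values of `φ`, which makes `flow` measurable in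
the path. -/
lemma coeff_interpolant (φ : ℝ → ℝ) (j : ℕ) :
    (interpolant μ S φ).coeff j =
      ∑ v ∈ S, φ v * (Lagrange.basis S (fun v => v - μ) v).coeff j := by
  simp only [interpolant, Lagrange.interpolate_apply, finsetSum_coeff, coeff_C_mul]

variable (hn : IsCountingPath n) (hm : ∀ k : ℕ, Integrable (fun v => (v - μ) ^ k) ν)
  (hμ : 0 < μ) (hpos : ∀ᵐ v ∂ν, 0 < v) (hlam : 0 ≤ lam) (ha : 0 ≤ a)
include hn hm hμ hpos hlam ha

lemma integrable_eval_mul_odds (p : ℝ[X]) (t : ℝ≥0) :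
    Integrable (fun v => p.eval (v - μ) * odds μ lam a v n t) ν := by
  simp only [eval_eq_sum_range, Finset.sum_mul, mul_assoc]
  exact integrable_finsetSum _ fun i _ =>
    (integrable_pow_mul_odds hn hm hμ hpos hlam ha i t).const_mul _

lemma integral_eval_mul_odds {p : ℝ[X]} (hp : p.natDegree < k) (t : ℝ≥0) :
    ∫ v, p.eval (v - μ) * odds μ lam a v n t ∂ν =
      ∑ i : Fin k, p.coeff i * momentOdds μ lam a ν i n t := by
  simp only [eval_eq_sum_range' hp, Finset.sum_mul, mul_assoc]
  rw [integral_finsetSum _ fun i _ =>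
    (integrable_pow_mul_odds hn hm hμ hpos hlam ha i t).const_mul _,
    ← Fin.sum_univ_eq_sum_range (fun i => ∫ v, p.coeff i *
      ((v - μ) ^ i * odds μ lam a v n t) ∂ν)]
  simp only [integral_const_mul, momentOdds]

variable (hS : ∀ᵐ v ∂ν, v ∈ S)
include hS

lemma integrable_mul_odds_of_finite (φ : ℝ → ℝ) (t : ℝ≥0) :
    Integrable (fun v => φ v * odds μ lam a v n t) ν := by
  refine (integrable_eval_mul_odds hn hm hμ hpos hlam ha (interpolant μ S φ) t).congr ?_
  filter_upwards [hS] with v hv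
  rw [eval_interpolant hv]

/-- On at most `k` points `φ` coincides with a polynomial of degree less than `k` in `v - μ`, so the
first `k` moments determine the integral. -/
lemma integral_mul_odds_of_finite (hk : k ≠ 0) (hcard : S.card ≤ k) (φ : ℝ → ℝ) (t : ℝ≥0) :
    ∫ v, φ v * odds μ lam a v n t ∂ν =
      ∑ i : Fin k, (interpolant μ S φ).coeff i * momentOdds μ lam a ν i n t := by
  rw [← integral_eval_mul_odds hn hm hμ hpos hlam ha (natDegree_interpolant_lt hk hcard φ) t]
  refine integral_congr_ae ?_
  filter_upwards [hS] with v hv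
  rw [eval_interpolant hv]

end FiniteSupport

/-- The transition of the first `k` moments over a time `t` along the path `n` of future
increments. -/
def flow (μ lam : ℝ) (ν : Measure ℝ) (S : Finset ℝ) (k : ℕ) (t : ℝ≥0)
    (p : (Fin k → ℝ) × (ℝ≥0 → ℕ)) (i : Fin k) : ℝ :=
  ∑ j : Fin k, (interpolant μ S fun v => (v - μ) ^ (i : ℕ) * weight μ lam v (reg p.2) t).coeff j
      * p.1 j + momentOdds μ lam 0 ν i (reg p.2) t

lemma measurable_flow (μ lam : ℝ) (ν : Measure ℝ) [SFinite ν] (S : Finset ℝ) (k : ℕ) (t : ℝ≥0) :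
    Measurable (flow μ lam ν S k t) := by
  refine measurable_pi_lambda _ fun i => ?_
  unfold flow
  simp only [coeff_interpolant]
  refine Measurable.add (Finset.measurable_sum _ fun j _ => Measurable.mul
    (Finset.measurable_sum _ fun v _ => Measurable.mul_const (Measurable.const_mul ?_ _) _)
    (by fun_prop)) ?_
  · exact (measurable_weight μ lam).comp (by fun_prop :
      Measurable fun p : (Fin k → ℝ) × (ℝ≥0 → ℕ) => (v, t, p.2))
  · exact (measurable_integral_mul_odds (by fun_prop : Measurable fun v : ℝ =>
      (v - μ) ^ (i : ℕ)) t).comp measurable_snd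

/-- In `odds_add` the earlier odds are multiplied by a weight depending on `v`; interpolating `(v -
μ)^i` times that weight turns the result into a linear form in the moments at time `s`. -/
lemma momentOdds_add {μ lam a : ℝ} {ν : Measure ℝ} {n : ℝ≥0 → ℕ} {S : Finset ℝ} {k : ℕ}
    (hn : IsCountingPath n) (hm : ∀ k : ℕ, Integrable (fun v => (v - μ) ^ k) ν)
    (hμ : 0 < μ) (hpos : ∀ᵐ v ∂ν, 0 < v) (hlam : 0 ≤ lam) (ha : 0 ≤ a) (hS : ∀ᵐ v ∂ν, v ∈ S)
    (hk : k ≠ 0) (hcard : S.card ≤ k) (s t : ℝ≥0) (i : Fin k) :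
    momentOdds μ lam a ν i n (s + t) =
      flow μ lam ν S k t (fun j => momentOdds μ lam a ν j n s, shift s n) i := by
  rw [flow, (hn.shift s).reg_eq, ← integral_mul_odds_of_finite hn hm hμ hpos hlam ha hS hk hcard,
    momentOdds, momentOdds, ← integral_add
      (integrable_mul_odds_of_finite hn hm hμ hpos hlam ha hS _ _)
      (integrable_pow_mul_odds (hn.shift s) hm hμ hpos hlam le_rfl _ _)]
  refine integral_congr_ae ?_
  filter_upwards [hpos] with v hv
  rw [odds_add hn hμ hv]
  ring

/-! ### The Markov property and the posterior law -/

/-- A Markov kernel given by the image of a normalized weighted measure. -/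
lemma exists_isMarkovKernel {α β γ : Type*} [MeasurableSpace α] [MeasurableSpace β] [Nonempty β]
    [MeasurableSpace γ] (P : Measure γ) [SFinite P] {G : α × γ → β} (hG : Measurable G)
    {w : α × γ → ℝ≥0∞} (hw : Measurable w) :
    ∃ κ : Kernel α β, IsMarkovKernel κ ∧ ∀ y B, MeasurableSet B →
      ∫⁻ n, w (y, n) ∂P ≠ 0 → ∫⁻ n, w (y, n) ∂P ≠ ∞ →
      κ y B = (∫⁻ n, (G ⁻¹' B).indicator w (y, n) ∂P) / ∫⁻ n, w (y, n) ∂P := by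
  classical
  set T : α → ℝ≥0∞ := fun y => ∫⁻ n, w (y, n) ∂P with hT
  have hTm : Measurable T := hw.lintegral_prod_right'
  set E : Set α := {y | T y ≠ 0 ∧ T y ≠ ∞} with hE
  have hEm : MeasurableSet E :=
    (hTm (measurableSet_singleton 0).compl).inter (hTm (measurableSet_singleton ∞).compl)
  obtain ⟨b⟩ := ‹Nonempty β›
  -- Where the total mass is zero or infinite it cannot be normalized; a fixed Dirac mass keeps the
  -- kernel Markov there, and nothing is claimed at such points.
  set f : α → Measure β := fun y => if y ∈ E then
    (T y)⁻¹ • (P.withDensity fun n => w (y, n)).map (fun n => G (y, n)) else Measure.dirac b with hf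
  have hGy : ∀ y, Measurable fun n => G (y, n) := fun y => hG.comp measurable_prodMk_left
  have hval : ∀ y B, MeasurableSet B → y ∈ E →
      f y B = (∫⁻ n, (G ⁻¹' B).indicator w (y, n) ∂P) / T y := by
    intro y B hB hy
    rw [hf]
    simp only [if_pos hy]
    rw [Measure.smul_apply, Measure.map_apply (hGy y) hB, withDensity_apply _ (hGy y hB),
      ← lintegral_indicator (hGy y hB), smul_eq_mul, ENNReal.div_eq_inv_mul]
    rfl
  have hfm : Measurable f := by
    refine Measure.measurable_of_measurable_coe _ fun B hB => ?_
    have : (fun y => f y B) = fun y => if y ∈ E then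
        (∫⁻ n, (G ⁻¹' B).indicator w (y, n) ∂P) / T y else Measure.dirac b B := by
      funext y
      by_cases hy : y ∈ E
      · rw [hval y B hB hy, if_pos hy]
      · rw [hf]; simp only [if_neg hy]
    rw [this]
    exact Measurable.ite hEm (((hw.indicator (hG hB)).lintegral_prod_right').div hTm)
      measurable_const
  refine ⟨⟨f, hfm⟩, ⟨fun y => ⟨?_⟩⟩, fun y B hB h0 h1 => hval y B hB ⟨h0, h1⟩⟩
  change f y Set.univ = 1
  by_cases hy : y ∈ E
  · rw [hval y _ MeasurableSet.univ hy]
    simp only [Set.preimage_univ, Set.indicator_univ]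
    exact ENNReal.div_self hy.1 hy.2
  · rw [hf]; simp only [if_neg hy]; exact measure_univ

namespace Model

variable {Ω : Type*} [mΩ : MeasurableSpace Ω] (M : Model Ω)

/-- Given the events up to time `s`, the future increments still have the law of the path. -/
lemma condExp_shift {α : Type*} [MeasurableSpace α] {U : Ω → α} {s : ℝ≥0}
    (hU : Measurable[M.F s] U) {f : α × (ℝ≥0 → ℕ) → ℝ} (hf : Measurable f)
    (hint : Integrable (fun ω => f (U ω, shift s (M.path ω))) M.P₀) :
    M.P₀[fun ω => f (U ω, shift s (M.path ω)) | M.F s] =ᵐ[M.P₀]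
      fun ω => ∫ n, f (U ω, n) ∂M.pathLaw := by
  have hU' : Measurable U := hU.mono (M.F.le s) le_rfl
  have hsh : Measurable fun ω => shift s (M.path ω) := M.poisson.measurable_shift s
  have hlaw := (indepFun_iff_map_prod_eq_prod_map_map hU'.aemeasurable hsh.aemeasurable).1
    (M.indepFun_shift hU)
  rw [map_shift_path] at hlaw
  have hmeas : Measurable fun u => ∫ n, f (u, n) ∂M.pathLaw :=
    (hf.stronglyMeasurable.integral_prod_right' (ν := M.pathLaw)).measurable
  have hint1 : Integrable f ((M.P₀.map U).prod M.pathLaw) := by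
    rw [← hlaw]
    exact (integrable_map_measure hf.aestronglyMeasurable
      (hU'.prodMk hsh).aemeasurable).2 hint
  have hint2 : Integrable (fun ω => ∫ n, f (U ω, n) ∂M.pathLaw) M.P₀ :=
    hint1.integral_prod_left.comp_measurable hU'
  refine (ae_eq_condExp_of_forall_setIntegral_eq (M.F.le s) hint (fun _ _ _ => hint2.integrableOn)
    (fun A hA _ => ?_) (hmeas.comp hU).stronglyMeasurable.aestronglyMeasurable).symm
  have hA' := M.F.le s A hA
  -- Carrying the indicator of `A` as a further observable coordinate reduces integrals over `A` to
  -- the independence of the pair from the restarted path.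
  have hW : Measurable[M.F s] fun ω => (U ω, A.indicator (fun _ => (1 : ℝ)) ω) :=
    hU.prodMk (measurable_const.indicator hA)
  have hW' := hW.mono (M.F.le s) le_rfl
  have hlawW := (indepFun_iff_map_prod_eq_prod_map_map hW'.aemeasurable hsh.aemeasurable).1
    (M.indepFun_shift hW)
  rw [map_shift_path] at hlawW
  set g : (α × ℝ) × (ℝ≥0 → ℕ) → ℝ := fun p => p.1.2 * f (p.1.1, p.2) with hg
  have hgm : Measurable g := (measurable_snd.comp measurable_fst).mul (hf.comp (by fun_prop))
  have hgA : ∀ ω, g ((U ω, A.indicator (fun _ => (1 : ℝ)) ω), shift s (M.path ω)) =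
      A.indicator (fun ω => f (U ω, shift s (M.path ω))) ω := by
    intro ω
    by_cases h : ω ∈ A <;> simp [hg, h]
  have hgi : Integrable g ((M.P₀.map fun ω => (U ω, A.indicator (fun _ => (1 : ℝ)) ω)).prod
      M.pathLaw) := by
    rw [← hlawW, integrable_map_measure hgm.aestronglyMeasurable (hW'.prodMk hsh).aemeasurable]
    exact (hint.indicator hA').congr (ae_of_all _ fun ω => (hgA ω).symm)
  rw [← integral_indicator hA', ← integral_indicator hA']
  simp only [← hgA]
  rw [← integral_map (f := g) (hW'.prodMk hsh).aemeasurable hgm.aestronglyMeasurable, hlawW,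
    integral_prod _ hgi, integral_map hW'.aemeasurable
      (hgm.stronglyMeasurable.integral_prod_right' (ν := M.pathLaw)).aestronglyMeasurable]
  refine integral_congr_ae (ae_of_all _ fun ω => ?_)
  by_cases h : ω ∈ A <;> simp [hg, h]

end Model

/-- The conditional expectation of a positive function is positive. -/
lemma condExp_pos {Ω : Type*} {m m₀ : MeasurableSpace Ω} {P : Measure[m₀] Ω}
    [IsFiniteMeasure P] (hm : m ≤ m₀) {D : Ω → ℝ} (hDi : Integrable D P)
    (hD : ∀ᵐ ω ∂P, 0 < D ω) : ∀ᵐ ω ∂P, 0 < P[D | m] ω := by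
  set A : Set Ω := {ω | P[D | m] ω ≤ 0} with hA
  have hAm : MeasurableSet[m] A :=
    (stronglyMeasurable_condExp (μ := P) (f := D) (m := m)).measurable
      (measurableSet_Iic (a := (0 : ℝ)))
  have h1 : ∫ ω in A, D ω ∂P ≤ 0 := by
    rw [← setIntegral_condExp hm hDi hAm]
    exact setIntegral_nonpos (hm A hAm) fun ω hω => hω
  have hD' : ∀ᵐ ω ∂P.restrict A, 0 < D ω := ae_restrict_of_ae hD
  have h2 : ∫ ω in A, D ω ∂P = 0 :=
    le_antisymm h1 (integral_nonneg_of_ae (hD'.mono fun ω h => h.le))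
  rw [integral_eq_zero_iff_of_nonneg_ae (hD'.mono fun ω h => h.le) hDi.integrableOn] at h2
  have h3 : P A = 0 := by
    rw [← Measure.restrict_eq_zero, ← ae_eq_bot, ← Filter.eventually_false_iff_eq_bot]
    filter_upwards [h2, hD'] with ω e1 e2
    rw [e1] at e2
    exact lt_irrefl _ e2
  filter_upwards [measure_eq_zero_iff_ae_notMem.1 h3] with ω hω
  exact not_le.1 hω

namespace Model

variable {Ω : Type*} [mΩ : MeasurableSpace Ω] (M : Model Ω)

lemma monic_ratePoly {k : ℕ} (rates : Fin k → ℝ) : (M.ratePoly rates).Monic := by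
  refine monic_prod_of_monic _ _ fun i _ => ?_
  rw [sub_add, ← C_sub]
  exact monic_X_sub_C _

lemma natDegree_ratePoly {k : ℕ} (rates : Fin k → ℝ) : (M.ratePoly rates).natDegree = k := by
  have h : ∀ i, (X - C (rates i) + C M.μ : ℝ[X]) = X - C (rates i - M.μ) := fun i => by
    rw [sub_add, ← C_sub]
  rw [ratePoly]
  simp only [h]
  rw [natDegree_prod_of_monic _ _ fun i _ => monic_X_sub_C _]
  simp only [natDegree_X_sub_C, Finset.sum_const, Finset.card_univ, Fintype.card_fin, smul_eq_mul,
    mul_one]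

lemma eval_ratePoly {k : ℕ} (rates : Fin k → ℝ) {v : ℝ} (hv : v ∈ Set.range rates) :
    (M.ratePoly rates).eval (v - M.μ) = 0 := by
  obtain ⟨i, rfl⟩ := hv
  rw [ratePoly, eval_prod]
  exact Finset.prod_eq_zero (Finset.mem_univ i) (by simp)

lemma ae_mem_range {k : ℕ} {rates : Fin k → ℝ} (h : M.ν (Set.range rates) = 1) :
    ∀ᵐ v ∂M.ν, v ∈ Set.range rates :=
  (mem_ae_iff_prob_eq_one (Set.finite_range rates).measurableSet).2 h

/-- The polynomial vanishes at `v - μ` for `ν`-almost every `v`, so its integral against the odds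
ratio is zero; being monic of degree `k`, it can be solved for the moment of order `k`. -/
lemma oddsMoment_linear_relation {k : ℕ} {rates : Fin k → ℝ} (h : M.ν (Set.range rates) = 1)
    (t : ℝ≥0) (ω : Ω) :
    M.oddsMoment k t ω = -∑ i : Fin k, (M.ratePoly rates).coeff i * M.oddsMoment i t ω := by
  have h1 := integral_eval_mul_odds (ν := M.ν) (isCountingPath_reg (M.path ω)) M.moments
    M.mu_pos M.ae_ν_pos M.lam_pos.le M.priorOdds_nonneg (k := k + 1) (p := M.ratePoly rates)
    (by rw [natDegree_ratePoly]; exact k.lt_succ_self) t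
  have h2 : ∫ v, (M.ratePoly rates).eval (v - M.μ) *
      odds M.μ M.lam M.priorOdds v (reg (M.path ω)) t ∂M.ν = 0 := by
    refine integral_eq_zero_of_ae ?_
    filter_upwards [M.ae_mem_range h] with v hv
    rw [M.eval_ratePoly rates hv, zero_mul]
    rfl
  rw [h2, Fin.sum_univ_castSucc] at h1
  have h3 : (M.ratePoly rates).coeff k = 1 := by
    have := (M.monic_ratePoly rates).coeff_natDegree
    rwa [natDegree_ratePoly] at this
  simp only [Fin.val_castSucc, Fin.val_last, h3, one_mul] at h1
  exact eq_neg_of_add_eq_zero_right h1.symm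

/-- A process that moves by a measurable flow driven by the future increments of the observed
path is Markovian under every family of measures whose density processes, given the
observations, are proportional to a function of the process. -/
lemma isMarkov_of_flow {d : ℕ} {Q : ℝ≥0 → Measure Ω} {D : ℝ≥0 → Ω → ℝ}
    (hQ : ∀ t, Q t = M.P₀.withDensity fun ω => ENNReal.ofReal (D t ω))
    (hD : ∀ t, Measurable (D t)) (hDi : ∀ t, Integrable (D t) M.P₀)
    (hDpos : ∀ t, ∀ᵐ ω ∂M.P₀, 0 < D t ω) {Y : ℝ≥0 → Ω → Fin d → ℝ} (hY : Adapted M.F Y)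
    {G : ℝ≥0 → (Fin d → ℝ) × (ℝ≥0 → ℕ) → Fin d → ℝ} (hG : ∀ t, Measurable (G t))
    (hYG : ∀ s t, ∀ᵐ ω ∂M.P₀, Y (s + t) ω = G t (Y s ω, shift s (M.path ω)))
    {c : ℝ≥0 → ℝ} (hc : ∀ t, 0 < c t) {w : (Fin d → ℝ) → ℝ} (hw : Measurable w)
    (hw0 : ∀ y, 0 ≤ w y) (hwD : ∀ t, M.P₀[D t | M.F t] =ᵐ[M.P₀] fun ω => c t * w (Y t ω)) :
    M.IsMarkov Q Y := by
  have hwG : ∀ t, Measurable fun p => w (G t p) := fun t => hw.comp (hG t)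
  choose κ hκ hκB using fun t => exists_isMarkovKernel M.pathLaw (hG t) (hwG t).ennreal_ofReal
  refine ⟨κ, hκ, fun s t B hB => ?_⟩
  set A : Set Ω := Y (s + t) ⁻¹' B with hA
  have hAm : MeasurableSet[M.F (s + t)] A := hY (s + t) hB
  -- Numerator and denominator in Bayes' formula are `c (s + t)` times `R B` and `R univ` at `Y s`;
  -- the constant cancels, leaving the normalized kernel.
  set R : Set (Fin d → ℝ) → (Fin d → ℝ) → ℝ := fun B y =>
    ∫ n, (G t ⁻¹' B).indicator (fun p => w (G t p)) (y, n) ∂M.pathLaw with hR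
  have key : ∀ B, MeasurableSet B →
      M.P₀[fun ω => D (s + t) ω * (Y (s + t) ⁻¹' B).indicator (fun _ => (1 : ℝ)) ω | M.F s]
        =ᵐ[M.P₀] fun ω => c (s + t) * R B (Y s ω) := by
    intro B hB
    set A : Set Ω := Y (s + t) ⁻¹' B with hA
    have hAm : MeasurableSet[M.F (s + t)] A := hY (s + t) hB
    have hDA : Integrable (fun ω => D (s + t) ω * A.indicator (fun _ => (1 : ℝ)) ω) M.P₀ := by
      refine ((hDi (s + t)).indicator (M.F.le _ A hAm)).congr (ae_of_all _ fun ω => ?_)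
      by_cases h : ω ∈ A <;> simp [h]
    have h1 := condExp_condExp_of_le (μ := M.P₀)
      (f := fun ω => D (s + t) ω * A.indicator (fun _ => (1 : ℝ)) ω)
      (M.F.mono (le_self_add : s ≤ s + t)) (M.F.le (s + t))
    have h2 : M.P₀[fun ω => D (s + t) ω * A.indicator (fun _ => (1 : ℝ)) ω | M.F (s + t)]
        =ᵐ[M.P₀] fun ω => c (s + t) *
          (G t ⁻¹' B).indicator (fun p => w (G t p)) (Y s ω, shift s (M.path ω)) := by
      have hsm : StronglyMeasurable[M.F (s + t)] (A.indicator fun _ => (1 : ℝ)) :=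
        (measurable_const.indicator hAm).stronglyMeasurable
      filter_upwards [condExp_mul_of_stronglyMeasurable_right hsm hDA (hDi (s + t)),
        hwD (s + t), hYG s t] with ω e1 e2 e3
      refine e1.trans ?_
      rw [Pi.mul_apply, e2]
      have hmem : ω ∈ A ↔ (Y s ω, shift s (M.path ω)) ∈ G t ⁻¹' B := by
        rw [hA, Set.mem_preimage, Set.mem_preimage, e3]
      by_cases h : ω ∈ A
      · rw [Set.indicator_of_mem h, Set.indicator_of_mem (hmem.1 h), mul_one, e3]
      · rw [Set.indicator_of_notMem h, Set.indicator_of_notMem fun h' => h (hmem.2 h'), mul_zero,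
          mul_zero]
    have hint : Integrable (fun ω => c (s + t) *
        (G t ⁻¹' B).indicator (fun p => w (G t p)) (Y s ω, shift s (M.path ω))) M.P₀ :=
      integrable_condExp.congr h2
    have h3 := M.condExp_shift (hY s) (f := fun p => c (s + t) *
      (G t ⁻¹' B).indicator (fun p => w (G t p)) p)
      (((hwG t).indicator (hG t hB)).const_mul _) hint
    filter_upwards [h1.symm.trans (condExp_congr_ae h2), h3] with ω e1 e2
    rw [e1, e2, integral_const_mul]
  have hQi : Integrable (A.indicator fun _ => (1 : ℝ)) (Q (s + t)) := by
    rw [hQ]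
    have := isFiniteMeasure_withDensity_ofReal (hDi (s + t)).2
    exact (integrable_const _).indicator (M.F.le _ A hAm)
  rw [hQ] at hQi ⊢
  refine (withDensity_absolutelyContinuous _ _).ae_le ?_
  have hone : M.P₀[D (s + t) | M.F s] =ᵐ[M.P₀] fun ω => c (s + t) * R Set.univ (Y s ω) := by
    have := key Set.univ MeasurableSet.univ
    simpa only [Set.preimage_univ, Set.indicator_univ, mul_one] using this
  filter_upwards [condExp_withDensity (M.F.le s) (hD (s + t)) (hDi (s + t))
    ((hDpos (s + t)).mono fun ω h => h.le) hQi, key B hB, hone,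
    condExp_pos (M.F.le s) (hDi (s + t)) (hDpos (s + t))] with ω e1 e2 e3 e4
  have hRl : ∀ B, MeasurableSet B → R B (Y s ω) = (∫⁻ n, (G t ⁻¹' B).indicator
      (fun p => ENNReal.ofReal (w (G t p))) (Y s ω, n) ∂M.pathLaw).toReal := by
    intro B hB
    rw [hR]
    dsimp only
    rw [integral_eq_lintegral_of_nonneg_ae
      (ae_of_all _ fun n => Set.indicator_nonneg (fun p _ => hw0 _) _)
      (((hwG t).indicator (hG t hB)).comp measurable_prodMk_left).aestronglyMeasurable]
    congr 1
    refine lintegral_congr fun n => ?_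
    by_cases h : (Y s ω, n) ∈ G t ⁻¹' B <;> simp [h]
  rw [e3] at e4
  have hpos : 0 < R Set.univ (Y s ω) := pos_of_mul_pos_right e4 (hc _).le
  have hRu := hRl Set.univ MeasurableSet.univ
  simp only [Set.preimage_univ, Set.indicator_univ] at hRu
  -- Positivity of the real value excludes both zero and infinite total mass, so the kernel is given
  -- by its formula at `Y s ω`.
  have hT := ENNReal.toReal_pos_iff.1 (hRu ▸ hpos)
  rw [measureReal_def, hκB t _ B hB hT.1.ne' hT.2.ne, ENNReal.toReal_div, ← hRl B hB, ← hRu,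
    eq_div_iff hpos.ne']
  rw [e2, e3] at e1
  refine mul_left_cancel₀ (hc (s + t)).ne' ?_
  rw [← e1]
  ring

section FiniteSupport

variable {k : ℕ} {rates : Fin k → ℝ} (h : M.ν (Set.range rates) = 1)
include h

lemma ne_zero_of_ν_range : k ≠ 0 := by
  rintro rfl
  rw [Set.range_eq_empty, measure_empty] at h
  exact zero_ne_one h

lemma ae_mem_image : ∀ᵐ v ∂M.ν, v ∈ Finset.univ.image rates :=
  (M.ae_mem_range h).mono fun v hv => by simpa using hv

omit h in
lemma card_image_le : (Finset.univ.image rates).card ≤ k :=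
  Finset.card_image_le.trans (by simp)

lemma oddsMoment_add (s t : ℝ≥0) : ∀ᵐ ω ∂M.P₀, (fun i : Fin k => M.oddsMoment i (s + t) ω) =
    flow M.μ M.lam M.ν (Finset.univ.image rates) k t
      (fun i => M.oddsMoment i s ω, shift s (M.path ω)) := by
  filter_upwards [M.ae_path] with ω hω
  funext i
  simp only [oddsMoment, hω.1.reg_eq]
  exact momentOdds_add (ν := M.ν) hω.1 M.moments M.mu_pos M.ae_ν_pos M.lam_pos.le
    M.priorOdds_nonneg (M.ae_mem_image h) (M.ne_zero_of_ν_range h) card_image_le s t i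

variable {Φ : ℕ → ℝ≥0 → Ω → ℝ} (hΦ : M.IsOddsRatioFamily Φ)
include hΦ

omit h in
lemma IsOddsRatioFamily.adapted_fin : Adapted M.F fun t ω (i : Fin k) => Φ i t ω :=
  fun t => @measurable_pi_lambda Ω _ _ (M.F t) _ _ fun i => hΦ.adapted i t

omit h in
lemma IsOddsRatioFamily.ae_eq_fin : ∀ᵐ ω ∂M.P₀, ∀ t,
    (fun i : Fin k => Φ i t ω) = fun i : Fin k => M.oddsMoment i t ω :=
  hΦ.ae_eq_oddsMoment.mono fun _ h t => funext fun i => h i t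

lemma IsOddsRatioFamily.flow (s t : ℝ≥0) : ∀ᵐ ω ∂M.P₀, (fun i : Fin k => Φ i (s + t) ω) =
    flow M.μ M.lam M.ν (Finset.univ.image rates) k t
      (fun i => Φ i s ω, shift s (M.path ω)) := by
  filter_upwards [hΦ.ae_eq_fin M (k := k), M.oddsMoment_add h s t] with ω h1 h2
  rw [h1, h1, h2]

lemma IsOddsRatioFamily.isMarkov_ref :
    M.IsMarkov (fun _ => M.P₀) fun t ω (i : Fin k) => Φ i t ω :=
  M.isMarkov_of_flow (D := fun _ _ => 1) (fun t => by simp) (fun _ => measurable_const)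
    (fun _ => integrable_const _) (fun _ => ae_of_all _ fun _ => one_pos) (hΦ.adapted_fin M)
    (measurable_flow M.μ M.lam M.ν _ k) (hΦ.flow M h) (c := fun _ => 1) (fun _ => one_pos)
    (w := fun _ => 1) measurable_const (fun _ => zero_le_one)
    fun t => by rw [condExp_const (M.F.le t)]; simp

lemma IsOddsRatioFamily.isMarkov : M.IsMarkov M.P fun t ω (i : Fin k) => Φ i t ω := by
  refine M.isMarkov_of_flow (D := M.density) M.P_eq M.measurable_density M.integrable_density
    M.density_pos (hΦ.adapted_fin M) (measurable_flow M.μ M.lam M.ν _ k) (hΦ.flow M h)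
    M.survival_pos
    -- The maximum makes the weight nonnegative on all of the state space; along the process it is
    -- inactive, since the odds ratio of order zero is nonnegative.
    (w := fun y => max (1 + y ⟨0, Nat.pos_of_ne_zero (M.ne_zero_of_ν_range h)⟩) 0)
    (by fun_prop) (fun _ => le_max_right _ _) fun t => ?_
  filter_upwards [hΦ.ae_eq_oddsMoment, M.condExp_density t] with ω h1 h2
  rw [h2, h1, max_eq_left]
  have := M.oddsMoment_zero_nonneg t ω
  linarith

/-- Both posteriors have denominator `1 + Φ^(0)`. On `θ ≤ t` the numerator is the integral of the
indicator of `B` against the odds ratio, linear in the state by interpolation; on `θ > t` it is the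
constant `ν(B)`. -/
lemma IsOddsRatioFamily.posterior_fin {B : Set ℝ} (hB : MeasurableSet B) :
    ∃ q₁ q₀ : (Fin k → ℝ) → ℝ, Measurable q₁ ∧ Measurable q₀ ∧ ∀ t : ℝ≥0,
      (M.P t)⟦{ω | M.θ ω ≤ t ∧ M.Λ ω ∈ B} | M.F t⟧
        =ᵐ[M.P t] (fun ω => q₁ fun i => Φ i t ω) ∧
      (M.P t)⟦{ω | (t : ℝ) < M.θ ω ∧ M.Λ ω ∈ B} | M.F t⟧
        =ᵐ[M.P t] (fun ω => q₀ fun i => Φ i t ω) := by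
  have hk := M.ne_zero_of_ν_range h
  set z : Fin k := ⟨0, Nat.pos_of_ne_zero hk⟩ with hz
  set φ : ℝ → ℝ := B.indicator fun _ => 1 with hφ
  have hφm : Measurable φ := measurable_const.indicator hB
  have hφi : Integrable φ M.ν := (integrable_const _).indicator hB
  have hind : ∀ (C : Set Ω), {ω | ω ∈ C ∧ M.Λ ω ∈ B}.indicator (fun _ => (1 : ℝ)) =
      C.indicator fun ω => φ (M.Λ ω) := by
    intro C
    funext ω
    by_cases h1 : ω ∈ C <;> by_cases h2 : M.Λ ω ∈ B <;> simp [h1, h2, hφ]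
  refine ⟨fun y => (∑ i : Fin k,
    (interpolant M.μ (Finset.univ.image rates) φ).coeff i * y i) / (1 + y z),
    fun y => (∫ v, φ v ∂M.ν) / (1 + y z), by fun_prop, by fun_prop, fun t => ⟨?_, ?_⟩⟩
  · rw [EventuallyEq, ae_P]
    have h1 := M.condExp_P_le hφm hφi t
    rw [← hind {ω | M.θ ω ≤ t}] at h1
    filter_upwards [h1, hΦ.ae_eq_oddsMoment] with ω e1 e2
    refine e1.trans ?_
    rw [integral_mul_odds_of_finite (ν := M.ν) (isCountingPath_reg _) M.moments M.mu_pos M.ae_ν_pos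
      M.lam_pos.le M.priorOdds_nonneg (M.ae_mem_image h) hk card_image_le]
    simp only [e2]
    rfl
  · rw [EventuallyEq, ae_P]
    have h1 := M.condExp_P_gt hφm hφi t
    rw [← hind {ω | (t : ℝ) < M.θ ω}] at h1
    filter_upwards [h1, hΦ.ae_eq_oddsMoment] with ω e1 e2
    refine e1.trans ?_
    simp only [e2]
    rfl

end FiniteSupport

end Model

/-! ### The Bayes risk as a discounted running cost -/

/-- The times of an interval `[0, b)` whose end may be infinite. -/
def timesBefore (b : ℝ≥0∞) : Set ℝ := {t : ℝ | 0 ≤ t ∧ ENNReal.ofReal t < b}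

lemma measurableSet_timesBefore (b : ℝ≥0∞) : MeasurableSet (timesBefore b) :=
  (measurableSet_le measurable_const measurable_id).inter
    (measurableSet_lt ENNReal.measurable_ofReal measurable_const)

lemma measurableSet_timesBefore_prod {Ω : Type*} [MeasurableSpace Ω] {τ : Ω → ℝ≥0∞}
    (hτ : Measurable τ) : MeasurableSet {p : Ω × ℝ | p.2 ∈ timesBefore (τ p.1)} :=
  (measurableSet_le measurable_const measurable_snd).inter
    (measurableSet_lt (ENNReal.measurable_ofReal.comp measurable_snd) (hτ.comp measurable_fst))

lemma expMeasure_timesBefore {r : ℝ} (b : ℝ≥0∞) :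
    expMeasure r (timesBefore b) =
      ∫⁻ t in timesBefore b, ENNReal.ofReal (r * Real.exp (-(r * t))) := by
  rw [expMeasure, gammaMeasure, withDensity_apply _ (measurableSet_timesBefore b)]
  refine setLIntegral_congr_fun (measurableSet_timesBefore b) fun t ht => ?_
  have := exponentialPDF_eq r t
  rw [exponentialPDF] at this
  rw [gammaPDF, ← exponentialPDFReal, this, if_pos ht.1]

/-- An exponential time falls before or after any given time. -/
lemma expMeasure_lt_add_timesBefore {r : ℝ} (hr : 0 < r) (b : ℝ≥0∞) :
    expMeasure r {u | b < ENNReal.ofReal u} + expMeasure r (timesBefore b) = 1 := by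
  have := isProbabilityMeasure_expMeasure hr
  have hac : expMeasure r ≪ volume := withDensity_absolutelyContinuous _ _
  have hneg : expMeasure r (Set.Iio 0) = 0 := by
    rw [expMeasure, gammaMeasure, withDensity_apply _ measurableSet_Iio]
    exact lintegral_gammaPDF_of_nonpos le_rfl
  have hm : MeasurableSet {u : ℝ | b < ENNReal.ofReal u} :=
    measurableSet_lt measurable_const ENNReal.measurable_ofReal
  rw [← prob_add_prob_compl (μ := expMeasure r) hm]
  congr 1
  refine measure_congr ?_
  have hend : expMeasure r {u : ℝ | 0 ≤ u ∧ ENNReal.ofReal u = b} = 0 := by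
    refine hac (Set.Subsingleton.measure_zero ?_ _)
    rintro x ⟨hx, rfl⟩ y ⟨hy, h⟩
    exact ((ENNReal.ofReal_eq_ofReal_iff hy hx).1 h).symm
  filter_upwards [measure_eq_zero_iff_ae_notMem.1 hneg, measure_eq_zero_iff_ae_notMem.1 hend]
    with u h1 h2
  have h1' : 0 ≤ u := not_lt.1 h1
  have h2' : ENNReal.ofReal u ≠ b := fun h => h2 ⟨h1', h⟩
  refine propext ⟨fun h => (not_lt.2 h.2.le : ¬ b < ENNReal.ofReal u), fun h => ?_⟩
  exact ⟨h1', lt_of_le_of_ne (not_lt.1 h) h2'⟩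

lemma volume_Ici_inter_timesBefore {u : ℝ} (hu : 0 ≤ u) {b : ℝ≥0∞} (hb : b ≠ ∞) :
    volume (Set.Ici u ∩ timesBefore b) = b - ENNReal.ofReal u := by
  have : Set.Ici u ∩ timesBefore b = Set.Ico u b.toReal := by
    ext t
    constructor
    · rintro ⟨h1, h2, h3⟩
      exact ⟨h1, (ENNReal.ofReal_lt_iff_lt_toReal h2 hb).1 h3⟩
    · rintro ⟨h1, h2⟩
      have h0 := hu.trans h1
      exact ⟨h1, h0, (ENNReal.ofReal_lt_iff_lt_toReal h0 hb).2 h2⟩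
  rw [this, Real.volume_Ico, ENNReal.ofReal_sub _ hu, ENNReal.ofReal_toReal hb]

lemma likelihoodRatio_self {μ u v : ℝ} (hu : 0 ≤ u) (n : ℝ≥0 → ℕ) :
    likelihoodRatio μ u v u.toNNReal n = 1 := by
  rw [likelihoodRatio, Real.coe_toNNReal _ hu]
  simp

namespace Model

variable {Ω : Type*} [mΩ : MeasurableSpace Ω] (M : Model Ω)

lemma lintegral_prior_path {f : (ℝ × ℝ) × (ℝ≥0 → ℕ) → ℝ≥0∞} (hf : Measurable f) :
    ∫⁻ ω, f ((M.θ ω, M.Λ ω), M.path ω) ∂M.P₀ =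
      ∫⁻ x, ∫⁻ ω, f (x, M.path ω) ∂M.P₀ ∂M.prior := by
  rw [← lintegral_map hf ((M.theta_meas.prodMk M.Lambda_meas).prodMk M.measurable_path),
    map_prior_path, lintegral_prod _ hf.aemeasurable]
  refine lintegral_congr fun x => ?_
  exact lintegral_map (f := fun y => f (x, y)) (hf.comp measurable_prodMk_left) M.measurable_path

lemma lintegral_P {f : (ℝ × ℝ) × (ℝ≥0 → ℕ) → ℝ≥0∞} (hf : Measurable f) (t : ℝ≥0) :
    ∫⁻ ω, f ((M.θ ω, M.Λ ω), M.path ω) ∂M.P t =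
      ∫⁻ x, ∫⁻ ω, f (x, M.path ω) *
        ENNReal.ofReal (likelihoodRatio M.μ x.1 x.2 t (M.path ω)) ∂M.P₀ ∂M.prior := by
  have hfm : Measurable fun ω => f ((M.θ ω, M.Λ ω), M.path ω) :=
    hf.comp ((M.theta_meas.prodMk M.Lambda_meas).prodMk M.measurable_path)
  rw [P_eq, lintegral_withDensity_eq_lintegral_mul _ (M.measurable_density t).ennreal_ofReal hfm]
  have h := M.lintegral_prior_path (f := fun p => f p *
    ENNReal.ofReal (likelihoodRatio M.μ p.1.1 p.1.2 t (reg p.2)))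
    (hf.mul (measurable_likelihoodRatio M.μ t).ennreal_ofReal)
  simp only [Pi.mul_apply, density, mul_comm (ENNReal.ofReal _)]
  rw [h]
  refine lintegral_congr fun x => lintegral_congr_ae ?_
  filter_upwards [M.ae_reg_path] with ω hω
  simp only [hω]

lemma ae_prior : ∀ᵐ x ∂M.prior, 0 ≤ x.1 ∧ 0 < x.2 := by
  refine (ae_map_iff (M.theta_meas.prodMk M.Lambda_meas).aemeasurable
    ((measurableSet_le measurable_const measurable_fst).inter
      (measurableSet_lt measurable_const measurable_snd))).2 ?_
  filter_upwards [M.ae_theta_nonneg, M.Lambda_pos] with ω h1 h2 using ⟨h1, h2⟩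

section StoppingTime

variable {τ : Ω → ℝ≥0∞} (hτ : IsStoppingTime M.F τ)
include hτ

lemma measurableSet_F_le (t : ℝ≥0) : MeasurableSet[M.F t] {ω | τ ω ≤ t} := hτ t

lemma measurableSet_F_gt (t : ℝ≥0) : MeasurableSet[M.F t] {ω | (t : ℝ≥0∞) < τ ω} := by
  have : {ω | (t : ℝ≥0∞) < τ ω} = {ω | τ ω ≤ t}ᶜ := by ext; simp
  rw [this]
  exact (M.measurableSet_F_le hτ t).compl

lemma measurableSet_F_lt (t : ℝ≥0) : MeasurableSet[M.F t] {ω | τ ω < t} :=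
  hτ.measurableSet_lt t

/-- A stopping time is almost surely a function of the observed path. -/
lemma exists_ae_eq_comp_path : ∃ T : (ℝ≥0 → ℕ) → ℝ≥0∞, Measurable T ∧
    ∀ᵐ ω ∂M.P₀, τ ω = T (M.path ω) := by
  classical
  choose C hC hCe using fun i => M.exists_ae_eq_preimage
    (M.measurableSet_F_le hτ (TopologicalSpace.denseSeq ℝ≥0 i))
  refine ⟨fun n => ⨅ i, if n ∈ C i then ((TopologicalSpace.denseSeq ℝ≥0 i : ℝ≥0) : ℝ≥0∞) else ∞,
    Measurable.iInf fun i => Measurable.ite (hC i) measurable_const measurable_const, ?_⟩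
  filter_upwards [ae_all_iff.2 fun i => (hCe i).mem_iff] with ω hω
  have h : ∀ i, M.path ω ∈ C i ↔ τ ω ≤ TopologicalSpace.denseSeq ℝ≥0 i := fun i => (hω i).symm
  simp only [h]
  apply le_antisymm
  · refine le_iInf fun i => ?_
    split_ifs with hi
    · exact hi
    · exact le_top
  · refine le_of_forall_gt fun b hb => ?_
    obtain ⟨x, hx1, hx2⟩ := ENNReal.lt_iff_exists_nnreal_btwn.1 hb
    obtain ⟨y, hy1, hy2⟩ := ENNReal.lt_iff_exists_nnreal_btwn.1 hx2
    obtain ⟨i, hi1, hi2⟩ := exists_denseSeq_btwn (ENNReal.coe_lt_coe.1 hy1)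
    refine iInf_lt_iff.2 ⟨i, ?_⟩
    rw [if_pos (hx1.le.trans (ENNReal.coe_le_coe.2 hi1.le))]
    exact (ENNReal.coe_lt_coe.2 hi2).trans hy2

/-- Whether `τ < u` is known at time `u`, when the likelihood ratio of a disorder at `u` still
equals one; by the martingale property the physical and the reference probability of `τ < θ ≤ n`
coincide. Under `P₀` the alarm is independent of `θ`, and the atom of `θ` at zero contributes
nothing. -/
lemma falseAlarm_eq : M.falseAlarm τ = ENNReal.ofReal (1 - M.π₀) *
    ∫⁻ ω, expMeasure M.lam {u | τ ω < ENNReal.ofReal u} ∂M.P₀ := by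
  obtain ⟨T, hT, hτT⟩ := M.exists_ae_eq_comp_path hτ
  set E : ℕ → Set ((ℝ × ℝ) × (ℝ≥0 → ℕ)) :=
    fun n => {p | T p.2 < ENNReal.ofReal p.1.1 ∧ p.1.1 ≤ n} with hE
  have hEm : ∀ n, MeasurableSet (E n) := fun n =>
    (measurableSet_lt (hT.comp measurable_snd) (ENNReal.measurable_ofReal.comp
      (measurable_fst.comp measurable_fst))).inter
      (measurableSet_le (measurable_fst.comp measurable_fst) measurable_const)
  have hpair : Measurable fun ω => ((M.θ ω, M.Λ ω), M.path ω) :=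
    (M.theta_meas.prodMk M.Lambda_meas).prodMk M.measurable_path
  have hae : ∀ n : ℕ, {ω | τ ω < ENNReal.ofReal (M.θ ω) ∧ M.θ ω ≤ n} =ᵐ[M.P₀]
      (fun ω => ((M.θ ω, M.Λ ω), M.path ω)) ⁻¹' E n := by
    intro n
    filter_upwards [hτT] with ω hω
    refine propext ⟨fun h => ?_, fun h => ?_⟩
    · exact (⟨hω ▸ h.1, h.2⟩ : T (M.path ω) < ENNReal.ofReal (M.θ ω) ∧ M.θ ω ≤ n)
    · have h' : T (M.path ω) < ENNReal.ofReal (M.θ ω) ∧ M.θ ω ≤ n := h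
      exact (⟨hω ▸ h'.1, h'.2⟩ : τ ω < ENNReal.ofReal (M.θ ω) ∧ M.θ ω ≤ n)
  have h1 : ∀ n : ℕ, M.P n {ω | τ ω < ENNReal.ofReal (M.θ ω) ∧ M.θ ω ≤ n} =
      M.P₀ {ω | τ ω < ENNReal.ofReal (M.θ ω) ∧ M.θ ω ≤ n} := by
    intro n
    have hae' : {ω | τ ω < ENNReal.ofReal (M.θ ω) ∧ M.θ ω ≤ n} =ᵐ[M.P n]
        (fun ω => ((M.θ ω, M.Λ ω), M.path ω)) ⁻¹' E n := by
      have := hae n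
      rwa [← M.ae_P n] at this
    rw [measure_congr hae', measure_congr (hae n), ← lintegral_indicator_one (hpair (hEm n)),
      ← lintegral_indicator_one (hpair (hEm n))]
    have h2 := M.lintegral_P (f := (E n).indicator 1) (measurable_one.indicator (hEm n)) n
    have h3 := M.lintegral_prior_path (f := (E n).indicator 1) (measurable_one.indicator (hEm n))
    refine (h2.trans ?_).trans h3.symm
    refine lintegral_congr_ae ?_
    filter_upwards [M.ae_prior] with x hx
    rcases lt_or_ge (n : ℝ) x.1 with hn | hn
    · simp [hE, not_le.2 hn]
    have hset : MeasurableSet[M.F x.1.toNNReal] {ω | τ ω < (x.1.toNNReal : ℝ≥0∞)} :=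
      M.measurableSet_F_lt hτ _
    have hle : x.1.toNNReal ≤ (n : ℝ≥0) := Real.toNNReal_le_iff_le_coe.2 (by simpa using hn)
    have hmart := M.setLIntegral_likelihoodRatio (u := x.1) hx.2 hle hset
    simp only [likelihoodRatio_self hx.1] at hmart
    rw [← lintegral_indicator (M.F.le _ _ hset), ← lintegral_indicator (M.F.le _ _ hset)] at hmart
    have hind : ∀ᵐ ω ∂M.P₀, ∀ r : ℝ≥0∞,
        (E n).indicator (1 : (ℝ × ℝ) × (ℝ≥0 → ℕ) → ℝ≥0∞) (x, M.path ω) * r =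
        {ω | τ ω < (x.1.toNNReal : ℝ≥0∞)}.indicator (fun _ => r) ω := by
      filter_upwards [hτT] with ω hω r
      by_cases h : τ ω < (x.1.toNNReal : ℝ≥0∞)
      · rw [Set.indicator_of_mem (show ω ∈ {ω | τ ω < (x.1.toNNReal : ℝ≥0∞)} from h),
          Set.indicator_of_mem (show (x, M.path ω) ∈ E n from ⟨hω ▸ h, hn⟩), Pi.one_apply, one_mul]
      · rw [Set.indicator_of_notMem (show ω ∉ {ω | τ ω < (x.1.toNNReal : ℝ≥0∞)} from h),
          Set.indicator_of_notMem (show (x, M.path ω) ∉ E n from fun h' => h (hω ▸ h'.1)),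
          zero_mul]
    refine Eq.trans (lintegral_congr_ae ?_) (hmart.trans (lintegral_congr_ae ?_))
    · filter_upwards [hind] with ω hω
      rw [hω]
      rfl
    · filter_upwards [hind] with ω hω
      have := hω 1
      rw [mul_one] at this
      rw [this, ENNReal.ofReal_one]
  have h2 : M.falseAlarm τ = M.P₀ {ω | τ ω < ENNReal.ofReal (M.θ ω)} := by
    have hmono : Monotone fun n : ℕ => {ω | τ ω < ENNReal.ofReal (M.θ ω) ∧ M.θ ω ≤ n} :=
      fun a b hab ω h => ⟨h.1, h.2.trans (by exact_mod_cast hab)⟩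
    rw [falseAlarm]
    simp only [h1]
    rw [← hmono.measure_iUnion]
    congr 1
    ext ω
    simp only [Set.mem_iUnion, Set.mem_ofPred_eq, exists_and_left, and_iff_left_iff_imp]
    exact fun _ => exists_nat_ge _
  set E' : Set ((ℝ × ℝ) × (ℝ≥0 → ℕ)) := {p | T p.2 < ENNReal.ofReal p.1.1} with hE'
  have hEm' : MeasurableSet E' := measurableSet_lt (hT.comp measurable_snd)
    (ENNReal.measurable_ofReal.comp (measurable_fst.comp measurable_fst))
  have h3 : M.P₀ {ω | τ ω < ENNReal.ofReal (M.θ ω)} =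
      M.P₀ ((fun ω => ((M.θ ω, M.Λ ω), M.path ω)) ⁻¹' E') := by
    refine measure_congr ?_
    filter_upwards [hτT] with ω hω
    change (τ ω < _) = (T (M.path ω) < _)
    rw [hω]
  have hsec : ∀ b : ℝ≥0∞, M.prior {x | b < ENNReal.ofReal x.1} =
      ENNReal.ofReal (1 - M.π₀) * expMeasure M.lam {u | b < ENNReal.ofReal u} := by
    intro b
    have hm : MeasurableSet {u : ℝ | b < ENNReal.ofReal u} :=
      measurableSet_lt measurable_const ENNReal.measurable_ofReal
    have : M.prior {x | b < ENNReal.ofReal x.1} = M.thetaLaw {u | b < ENNReal.ofReal u} := by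
      have h := Measure.map_apply (μ := M.prior) measurable_fst hm
      rw [prior_eq, Measure.map_fst_prod, measure_univ, one_smul] at h
      rw [h, prior_eq]
      rfl
    rw [this, thetaLaw_eq, Measure.add_apply, Measure.smul_apply, Measure.smul_apply,
      Measure.dirac_apply' _ hm]
    simp
  rw [h2, h3, ← Measure.map_apply hpair hEm', map_prior_path, Measure.prod_apply_symm hEm', pathLaw,
    lintegral_map (measurable_measure_prodMk_right hEm') M.measurable_path,
    ← lintegral_const_mul' _ _ ENNReal.ofReal_ne_top]
  refine lintegral_congr_ae ?_
  filter_upwards [hτT] with ω hω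
  rw [← hsec, hω]
  rfl

end StoppingTime

end Model

namespace Model

variable {Ω : Type*} [mΩ : MeasurableSpace Ω] (M : Model Ω)

lemma measurable_oddsMoment_prod (k : ℕ) :
    Measurable fun p : Ω × ℝ => M.oddsMoment k p.2.toNNReal p.1 := by
  have h : StronglyMeasurable (Function.uncurry fun (p : Ω × ℝ) (v : ℝ) =>
      (v - M.μ) ^ k * odds M.μ M.lam M.priorOdds v (reg (M.path p.1)) p.2.toNNReal) :=
    ((by fun_prop : Measurable fun p : (Ω × ℝ) × ℝ => (p.2 - M.μ) ^ k).mul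
      ((measurable_odds M.μ M.lam M.priorOdds).comp
        (measurable_snd.prodMk ((measurable_real_toNNReal.comp
          (measurable_snd.comp measurable_fst)).prodMk
          (M.measurable_path.comp (measurable_fst.comp measurable_fst)))))).stronglyMeasurable
  exact (h.integral_prod_right (ν := M.ν)).measurable

lemma lintegral_prior_Iic_likelihoodRatio (t : ℝ≥0) : ∀ᵐ ω ∂M.P₀,
    ∫⁻ x, (Set.Iic (t : ℝ)).indicator 1 x.1 *
        ENNReal.ofReal (likelihoodRatio M.μ x.1 x.2 t (M.path ω)) ∂M.prior =
      ENNReal.ofReal (M.survival t * M.oddsMoment 0 t ω) := by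
  filter_upwards [M.ae_path] with ω hω
  have hL : Measurable fun x : ℝ × ℝ =>
      ENNReal.ofReal (likelihoodRatio M.μ x.1 x.2 t (M.path ω)) := by
    have := ((measurable_likelihoodRatio M.μ t).comp
      (by fun_prop : Measurable fun x : ℝ × ℝ => (x, M.path ω))).ennreal_ofReal
    simpa only [Function.comp_def, hω.1.reg_eq] using this
  have hI : Measurable fun x : ℝ × ℝ => (Set.Iic (t : ℝ)).indicator (1 : ℝ → ℝ≥0∞) x.1 :=
    (measurable_one.indicator measurableSet_Iic).comp measurable_fst
  have hprod : Measurable fun x : ℝ × ℝ => (Set.Iic (t : ℝ)).indicator (1 : ℝ → ℝ≥0∞) x.1 *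
      ENNReal.ofReal (likelihoodRatio M.μ x.1 x.2 t (M.path ω)) := hI.mul hL
  rw [prior_eq, lintegral_prod_symm' _ hprod, oddsMoment, momentOdds, ← integral_const_mul,
    ofReal_integral_eq_lintegral_ofReal]
  · refine lintegral_congr_ae ?_
    filter_upwards [M.ae_ν_pos] with v hv
    rw [hω.1.reg_eq, pow_zero, one_mul, ← M.lintegral_likelihoodRatio_thetaLaw hv hω.1 hω.2,
      ← lintegral_indicator measurableSet_Iic]
    refine lintegral_congr fun u => ?_
    by_cases h : u ∈ Set.Iic (t : ℝ)
    · simp [Set.indicator_of_mem h]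
    · simp [Set.indicator_of_notMem h]
  · exact (integrable_pow_mul_odds (ν := M.ν) (isCountingPath_reg _) M.moments M.mu_pos M.ae_ν_pos
      M.lam_pos.le M.priorOdds_nonneg 0 t).const_mul _
  · filter_upwards [M.ae_ν_pos] with v hv
    rw [pow_zero, one_mul]
    exact mul_nonneg (M.survival_pos t).le
      (odds_nonneg M.mu_pos hv M.lam_pos.le M.priorOdds_nonneg t)

section StoppingTime

variable {τ : Ω → ℝ≥0∞} (hτ : IsStoppingTime M.F τ)
include hτ

/-- The probability that the disorder has happened but no alarm has been given at time `t`. -/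
lemma P_delayed {t n : ℝ≥0} (htn : t ≤ n) :
    M.P n {ω | M.θ ω ≤ t ∧ (t : ℝ≥0∞) < τ ω} =
      ∫⁻ ω in {ω | (t : ℝ≥0∞) < τ ω}, ENNReal.ofReal (M.survival t * M.oddsMoment 0 t ω)
        ∂M.P₀ := by
  obtain ⟨T, hT, hτT⟩ := M.exists_ae_eq_comp_path hτ
  have hset := M.measurableSet_F_gt hτ t
  have hset' := M.F.le _ _ hset
  set A : Set Ω := {ω | (t : ℝ≥0∞) < τ ω} with hA
  set C : Set (ℝ≥0 → ℕ) := {p | (t : ℝ≥0∞) < T p} with hC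
  have hCm : MeasurableSet C := measurableSet_lt measurable_const hT
  set f : (ℝ × ℝ) × (ℝ≥0 → ℕ) → ℝ≥0∞ :=
    fun p => (Set.Iic (t : ℝ)).indicator 1 p.1.1 * C.indicator 1 p.2 with hf
  have hIm : Measurable fun x : ℝ × ℝ => (Set.Iic (t : ℝ)).indicator (1 : ℝ → ℝ≥0∞) x.1 :=
    (measurable_one.indicator measurableSet_Iic).comp measurable_fst
  have hfm : Measurable f := (hIm.comp measurable_fst).mul
    ((measurable_one.indicator hCm).comp measurable_snd)
  have hmem : ∀ᵐ ω ∂M.P₀, (M.path ω ∈ C ↔ ω ∈ A) := by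
    filter_upwards [hτT] with ω hω
    change _ < T (M.path ω) ↔ _ < τ ω
    rw [hω]
  have h1 : M.P n {ω | M.θ ω ≤ t ∧ ω ∈ A} =
      ∫⁻ ω, f ((M.θ ω, M.Λ ω), M.path ω) ∂M.P n := by
    have hm : MeasurableSet {ω | M.θ ω ≤ t ∧ ω ∈ A} :=
      (measurableSet_le M.theta_meas measurable_const).inter hset'
    rw [← lintegral_indicator_one hm]
    refine lintegral_congr_ae ?_
    rw [← M.ae_P n] at hmem
    filter_upwards [hmem] with ω hω
    by_cases h1 : M.θ ω ≤ t <;> by_cases h2 : ω ∈ A <;>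
      simp [hf, h1, h2, hω.2, Set.indicator, hω]
  have hLm : Measurable fun p : (ℝ × ℝ) × Ω => f (p.1, M.path p.2) *
      ENNReal.ofReal (likelihoodRatio M.μ p.1.1 p.1.2 t (reg (M.path p.2))) :=
    (hfm.mul (measurable_likelihoodRatio M.μ t).ennreal_ofReal).comp
      (measurable_fst.prodMk (M.measurable_path.comp measurable_snd))
  have h2 : ∀ r : ℝ≥0, ∀ x : ℝ × ℝ, ∫⁻ ω, f (x, M.path ω) *
      ENNReal.ofReal (likelihoodRatio M.μ x.1 x.2 r (M.path ω)) ∂M.P₀ =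
      (Set.Iic (t : ℝ)).indicator 1 x.1 *
        ∫⁻ ω in A, ENNReal.ofReal (likelihoodRatio M.μ x.1 x.2 r (M.path ω)) ∂M.P₀ := by
    intro r x
    rw [← lintegral_indicator hset', ← lintegral_const_mul']
    · refine lintegral_congr_ae ?_
      filter_upwards [hmem] with ω hω
      by_cases h2 : ω ∈ A <;> simp [hf, h2, Set.indicator, hω]
    · by_cases h : x.1 ∈ Set.Iic (t : ℝ) <;> simp [Set.indicator, h]
  have h3 : ∫⁻ ω, f ((M.θ ω, M.Λ ω), M.path ω) ∂M.P n = ∫⁻ x, ∫⁻ ω, f (x, M.path ω) *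
      ENNReal.ofReal (likelihoodRatio M.μ x.1 x.2 t (reg (M.path ω))) ∂M.P₀ ∂M.prior := by
    rw [M.lintegral_P hfm]
    refine lintegral_congr_ae ?_
    filter_upwards [M.ae_prior] with x hx
    -- The event `τ > t` is known at time `t`, so the martingale property lowers the horizon from
    -- `n` to `t`.
    rw [h2, M.setLIntegral_likelihoodRatio hx.2 htn hset, ← h2]
    refine lintegral_congr_ae ?_
    filter_upwards [M.ae_reg_path] with ω hω
    rw [hω]
  rw [show {ω | M.θ ω ≤ t ∧ (t : ℝ≥0∞) < τ ω} = {ω | M.θ ω ≤ t ∧ ω ∈ A} from rfl, h1, h3,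
    lintegral_lintegral_swap hLm.aemeasurable, ← lintegral_indicator hset']
  refine lintegral_congr_ae ?_
  filter_upwards [hmem, M.lintegral_prior_Iic_likelihoodRatio t, M.ae_reg_path] with ω e1 e2 e3
  by_cases h : ω ∈ A
  · rw [Set.indicator_of_mem h, ← e2]
    refine lintegral_congr fun x => ?_
    simp [hf, Set.indicator_of_mem (e1.2 h), e3]
  · rw [Set.indicator_of_notMem h]
    simp [hf, Set.indicator_of_notMem (fun h' => h (e1.1 h'))]

lemma measurable_of_isStoppingTime : Measurable τ := by
  refine measurable_of_Iic fun b => ?_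
  induction b with
  | top => simp
  | coe b => exact M.F.le b _ (M.measurableSet_F_le hτ b)

/-- The delay is the length of `[θ, τ ∧ n)`, so Tonelli expresses its mean as the integral over `t <
n` of the probability of `θ ≤ t < τ`, known from `P_delayed`. Monotone convergence removes `n`. -/
lemma expectedDelay_eq : M.expectedDelay τ = ENNReal.ofReal (1 - M.π₀) *
    ∫⁻ ω, (∫⁻ t in timesBefore (τ ω),
      ENNReal.ofReal (Real.exp (-M.lam * t) * M.oddsMoment 0 t.toNNReal ω)) ∂M.P₀ := by
  have hτm := M.measurable_of_isStoppingTime hτ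
  set K : ℝ → ℝ≥0∞ := fun t => ∫⁻ ω, {p : Ω × ℝ | p.2 ∈ timesBefore (τ p.1)}.indicator
    (fun p => ENNReal.ofReal (Real.exp (-M.lam * p.2) * M.oddsMoment 0 p.2.toNNReal p.1)) (ω, t)
    ∂M.P₀ with hK
  have hEm := measurableSet_timesBefore_prod hτm
  have hGm : Measurable fun p : Ω × ℝ =>
      ENNReal.ofReal (Real.exp (-M.lam * p.2) * M.oddsMoment 0 p.2.toNNReal p.1) :=
    ((by fun_prop : Measurable fun p : Ω × ℝ => Real.exp (-M.lam * p.2)).mul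
      (M.measurable_oddsMoment_prod 0)).ennreal_ofReal
  have hdelay : ∀ n : ℕ, ∫⁻ ω, (min (τ ω) n - ENNReal.ofReal (M.θ ω)) ∂M.P n =
      ∫⁻ t in timesBefore n, ENNReal.ofReal (1 - M.π₀) * K t := by
    intro n
    set E : Set (Ω × ℝ) := {p | M.θ p.1 ≤ p.2 ∧ p.2 ∈ timesBefore (min (τ p.1) n)} with hE
    have hEm' : MeasurableSet E := (measurableSet_le (M.theta_meas.comp measurable_fst)
      measurable_snd).inter (measurableSet_timesBefore_prod (hτm.min measurable_const))
    have h1 : ∫⁻ ω, (min (τ ω) n - ENNReal.ofReal (M.θ ω)) ∂M.P n =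
        ∫⁻ ω, (∫⁻ t, E.indicator 1 (ω, t)) ∂M.P n := by
      refine lintegral_congr_ae ?_
      have := M.ae_theta_nonneg
      rw [← M.ae_P n] at this
      filter_upwards [this] with ω hω
      rw [← volume_Ici_inter_timesBefore hω
        ((min_le_right _ _).trans_lt (ENNReal.natCast_lt_top n)).ne,
        ← lintegral_indicator_one (measurableSet_Ici.inter (measurableSet_timesBefore _))]
      rfl
    rw [h1, lintegral_lintegral_swap (f := fun ω t => E.indicator 1 (ω, t))
      (measurable_one.indicator hEm').aemeasurable,
      ← lintegral_indicator (measurableSet_timesBefore _)]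
    refine lintegral_congr fun t => ?_
    by_cases ht : t ∈ timesBefore n
    · rw [Set.indicator_of_mem ht]
      have ht0 : 0 ≤ t := ht.1
      have hcoe : (t.toNNReal : ℝ) = t := Real.coe_toNNReal _ ht0
      have htn : t.toNNReal ≤ (n : ℝ≥0) := by
        refine ENNReal.coe_le_coe.1 ?_
        rw [ENNReal.coe_natCast]
        exact ht.2.le
      have h2 := M.P_delayed hτ htn
      have h3 : ∫⁻ ω, E.indicator 1 (ω, t) ∂M.P n =
          M.P n {ω | M.θ ω ≤ t.toNNReal ∧ (t.toNNReal : ℝ≥0∞) < τ ω} := by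
        rw [← lintegral_indicator_one]
        · refine lintegral_congr fun ω => ?_
          have : (ω, t) ∈ E ↔ ω ∈ {ω | M.θ ω ≤ t.toNNReal ∧ (t.toNNReal : ℝ≥0∞) < τ ω} := by
            rw [hcoe]
            exact ⟨fun h => ⟨h.1, h.2.2.trans_le (min_le_left _ _)⟩,
              fun h => ⟨h.1, ht0, lt_min h.2 ht.2⟩⟩
          by_cases h : (ω, t) ∈ E
          · rw [Set.indicator_of_mem h, Set.indicator_of_mem (this.1 h)]; rfl
          · rw [Set.indicator_of_notMem h, Set.indicator_of_notMem fun h' => h (this.2 h')]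
        · exact (measurableSet_le M.theta_meas measurable_const).inter
            (measurableSet_lt measurable_const hτm)
      rw [h3, h2, hK, ← lintegral_const_mul' _ _ ENNReal.ofReal_ne_top,
        ← lintegral_indicator (measurableSet_lt measurable_const hτm)]
      refine lintegral_congr fun ω => ?_
      have : ω ∈ {ω | (t.toNNReal : ℝ≥0∞) < τ ω} ↔
          (ω, t) ∈ {p : Ω × ℝ | p.2 ∈ timesBefore (τ p.1)} :=
        ⟨fun h => ⟨ht0, h⟩, fun h => h.2⟩
      by_cases h : ω ∈ {ω | (t.toNNReal : ℝ≥0∞) < τ ω}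
      · rw [Set.indicator_of_mem h, Set.indicator_of_mem (this.1 h), survival, hcoe, mul_assoc,
          ENNReal.ofReal_mul M.one_sub_pi_pos.le, neg_mul]
      · rw [Set.indicator_of_notMem h, Set.indicator_of_notMem fun h' => h (this.2 h'), mul_zero]
    · rw [Set.indicator_of_notMem ht]
      have : ∀ ω, E.indicator (1 : Ω × ℝ → ℝ≥0∞) (ω, t) = 0 := fun ω =>
        Set.indicator_of_notMem (fun h => ht ⟨h.2.1, h.2.2.trans_le (min_le_right _ _)⟩) _
      simp only [this, lintegral_zero]
  have hmono : Monotone fun n : ℕ => timesBefore n := fun a b hab t ht =>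
    ⟨ht.1, ht.2.trans_le (by exact_mod_cast hab)⟩
  rw [expectedDelay]
  simp only [hdelay]
  rw [← setLIntegral_iUnion_of_directed _ hmono.directed_le]
  have hU : (⋃ n : ℕ, timesBefore n) = Set.Ici 0 := by
    ext t
    simp only [Set.mem_iUnion, Set.mem_Ici]
    refine ⟨fun ⟨n, h⟩ => h.1, fun h => ?_⟩
    obtain ⟨n, hn⟩ := ENNReal.exists_nat_gt (ENNReal.ofReal_ne_top (r := t))
    exact ⟨n, h, hn⟩
  rw [hU, lintegral_const_mul' _ _ ENNReal.ofReal_ne_top]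
  congr 1
  have hswap := lintegral_lintegral_swap (μ := M.P₀) (ν := volume)
    (f := fun ω t => {p : Ω × ℝ | p.2 ∈ timesBefore (τ p.1)}.indicator (fun p =>
      ENNReal.ofReal (Real.exp (-M.lam * p.2) * M.oddsMoment 0 p.2.toNNReal p.1)) (ω, t))
    (hGm.indicator hEm).aemeasurable
  have h4 : ∫⁻ t in Set.Ici 0, K t = ∫⁻ t, K t := by
    rw [← lintegral_indicator measurableSet_Ici]
    refine lintegral_congr fun t => ?_
    by_cases ht : t ∈ Set.Ici (0 : ℝ)
    · rw [Set.indicator_of_mem ht]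
    · rw [Set.indicator_of_notMem ht, hK]
      have : ∀ ω, (ω, t) ∉ {p : Ω × ℝ | p.2 ∈ timesBefore (τ p.1)} := fun ω h => ht h.1
      simp only [Set.indicator_of_notMem (this _), lintegral_zero]
  rw [h4]
  refine hswap.symm.trans (lintegral_congr fun ω => ?_)
  rw [← lintegral_indicator (measurableSet_timesBefore _)]
  rfl

end StoppingTime

end Model

namespace Model

variable {Ω : Type*} [mΩ : MeasurableSpace Ω] (M : Model Ω)

lemma discountedPosCost_congr {E F : Type*} {g : E → ℝ} {g' : F → ℝ} {Y : ℝ≥0 → Ω → E}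
    {Y' : ℝ≥0 → Ω → F} (h : ∀ᵐ ω ∂M.P₀, ∀ t, g (Y t ω) = g' (Y' t ω)) (τ : Ω → ℝ≥0∞) :
    M.discountedPosCost g Y τ = M.discountedPosCost g' Y' τ := by
  refine lintegral_congr_ae ?_
  filter_upwards [h] with ω hω
  simp only [hω]

variable {τ : Ω → ℝ≥0∞}

lemma lintegral_expMeasure_add (hτ : IsStoppingTime M.F τ) :
    (∫⁻ ω, expMeasure M.lam {u | τ ω < ENNReal.ofReal u} ∂M.P₀) +
      ∫⁻ ω, (∫⁻ t in timesBefore (τ ω), ENNReal.ofReal (M.lam * Real.exp (-M.lam * t))) ∂M.P₀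
      = 1 := by
  have hτm := M.measurable_of_isStoppingTime hτ
  have := isProbabilityMeasure_expMeasure M.lam_pos
  have hm : MeasurableSet {p : Ω × ℝ | τ p.1 < ENNReal.ofReal p.2} :=
    measurableSet_lt (hτm.comp measurable_fst) (ENNReal.measurable_ofReal.comp measurable_snd)
  have h1 : Measurable fun ω => expMeasure M.lam {u | τ ω < ENNReal.ofReal u} :=
    (measurable_measure_prodMk_left (ν := expMeasure M.lam) hm :)
  rw [← lintegral_add_left h1]
  have h2 : ∀ ω, expMeasure M.lam {u | τ ω < ENNReal.ofReal u} +
      (∫⁻ t in timesBefore (τ ω), ENNReal.ofReal (M.lam * Real.exp (-M.lam * t))) = 1 := by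
    intro ω
    have h := expMeasure_lt_add_timesBefore M.lam_pos (τ ω)
    rw [expMeasure_timesBefore] at h
    simpa only [neg_mul] using h
  rw [lintegral_congr h2, lintegral_one, measure_univ]

lemma measurable_lintegral_timesBefore (hτ : IsStoppingTime M.F τ) {f : Ω × ℝ → ℝ≥0∞}
    (hf : Measurable f) : Measurable fun ω => ∫⁻ t in timesBefore (τ ω), f (ω, t) := by
  have hEm := measurableSet_timesBefore_prod (M.measurable_of_isStoppingTime hτ)
  have h := (hf.indicator hEm).lintegral_prod_right' (ν := volume)
  refine (congrArg Measurable (funext fun ω => ?_)).mp h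
  rw [← lintegral_indicator (measurableSet_timesBefore _)]
  rfl

/-- The running cost of the optimal stopping problem, in terms of the odds ratio. -/
lemma bayesRisk_eq {c : ℝ} (hc : 0 < c) (hτ : IsStoppingTime M.F τ) :
    M.discountedPosCost (fun y => -(y - M.lam / c)) (M.oddsMoment 0) τ < ∞ ∧
    M.bayesRisk c τ + ENNReal.ofReal (c * (1 - M.π₀)) *
        M.discountedPosCost (fun y => -(y - M.lam / c)) (M.oddsMoment 0) τ
      = ENNReal.ofReal (1 - M.π₀) + ENNReal.ofReal (c * (1 - M.π₀)) *
        M.discountedPosCost (fun y => y - M.lam / c) (M.oddsMoment 0) τ := by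
  have hlam := M.lam_pos
  have hsum := M.lintegral_expMeasure_add hτ
  set L := ∫⁻ ω, (∫⁻ t in timesBefore (τ ω),
    ENNReal.ofReal (M.lam * Real.exp (-M.lam * t))) ∂M.P₀ with hL
  set V := ∫⁻ ω, (∫⁻ t in timesBefore (τ ω),
    ENNReal.ofReal (Real.exp (-M.lam * t) * M.oddsMoment 0 t.toNNReal ω)) ∂M.P₀ with hV
  set S := ∫⁻ ω, expMeasure M.lam {u | τ ω < ENNReal.ofReal u} ∂M.P₀ with hS
  set Neg := M.discountedPosCost (fun y => -(y - M.lam / c)) (M.oddsMoment 0) τ with hNeg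
  set Pos := M.discountedPosCost (fun y => y - M.lam / c) (M.oddsMoment 0) τ with hPos
  have hexp : Measurable fun p : Ω × ℝ => Real.exp (-M.lam * p.2) := by fun_prop
  have hX := M.measurable_oddsMoment_prod 0
  -- Because the odds ratio is nonnegative, `c` times the negative part of the cost is at most
  -- `lam`, and the total discounted `lam` is at most one.
  have hcL : ENNReal.ofReal c * Neg ≤ L := by
    rw [hNeg, hL, discountedPosCost, ← lintegral_const_mul' _ _ ENNReal.ofReal_ne_top]
    refine lintegral_mono fun ω => ?_
    rw [← lintegral_const_mul' _ _ ENNReal.ofReal_ne_top]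
    refine lintegral_mono fun t => ?_
    rw [← ENNReal.ofReal_mul hc.le]
    refine ENNReal.ofReal_le_ofReal ?_
    have h1 := Real.exp_pos (-M.lam * t)
    have h2 := mul_nonneg h1.le (M.oddsMoment_zero_nonneg t.toNNReal ω)
    have h3 : c * (Real.exp (-M.lam * t) * -(M.oddsMoment 0 t.toNNReal ω - M.lam / c)) =
        M.lam * Real.exp (-M.lam * t) -
          c * (Real.exp (-M.lam * t) * M.oddsMoment 0 t.toNNReal ω) := by
      field_simp
      ring
    rw [h3]
    linarith [mul_nonneg hc.le h2]
  -- This is `(y - r)⁺ + r = y + (y - r)⁻` with `r = lam / c`, integrated; in this form no infinite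
  -- quantity is subtracted.
  have hbal : ENNReal.ofReal c * Pos + L = ENNReal.ofReal c * V + ENNReal.ofReal c * Neg := by
    have hmP : Measurable fun p : Ω × ℝ => ENNReal.ofReal (Real.exp (-M.lam * p.2) *
        (M.oddsMoment 0 p.2.toNNReal p.1 - M.lam / c)) :=
      (hexp.mul (hX.sub_const _)).ennreal_ofReal
    have hmV : Measurable fun p : Ω × ℝ => ENNReal.ofReal (Real.exp (-M.lam * p.2) *
        M.oddsMoment 0 p.2.toNNReal p.1) := (hexp.mul hX).ennreal_ofReal
    have hcost : ∀ g : ℝ → ℝ, M.discountedPosCost g (M.oddsMoment 0) τ =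
        ∫⁻ ω, (∫⁻ t in timesBefore (τ ω), ENNReal.ofReal (Real.exp (-M.lam * t) *
          g (M.oddsMoment 0 t.toNNReal ω))) ∂M.P₀ := fun _ => rfl
    rw [← mul_add, hPos, hL, hV, hNeg, hcost, hcost,
      ← lintegral_const_mul' _ _ ENNReal.ofReal_ne_top,
      ← lintegral_add_left ((M.measurable_lintegral_timesBefore hτ hmP).const_mul _),
      ← lintegral_add_left (M.measurable_lintegral_timesBefore hτ hmV),
      ← lintegral_const_mul' _ _ ENNReal.ofReal_ne_top]
    refine lintegral_congr fun ω => ?_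
    have hmP' : Measurable fun t : ℝ => ENNReal.ofReal (Real.exp (-M.lam * t) *
        (M.oddsMoment 0 t.toNNReal ω - M.lam / c)) := hmP.comp measurable_prodMk_left
    have hmV' : Measurable fun t : ℝ => ENNReal.ofReal (Real.exp (-M.lam * t) *
        M.oddsMoment 0 t.toNNReal ω) := hmV.comp measurable_prodMk_left
    dsimp only
    rw [← lintegral_const_mul' _ _ ENNReal.ofReal_ne_top, ← lintegral_add_left (hmP'.const_mul _),
      ← lintegral_add_left hmV',
      ← lintegral_const_mul' _ _ ENNReal.ofReal_ne_top]
    refine lintegral_congr fun t => ?_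
    have h1 := Real.exp_pos (-M.lam * t)
    have h0 := M.oddsMoment_zero_nonneg t.toNNReal ω
    generalize M.oddsMoment 0 t.toNNReal ω = y at *
    generalize Real.exp (-M.lam * t) = e at *
    have hle : M.lam * e = c * (e * (M.lam / c)) := by field_simp
    rw [hle, ENNReal.ofReal_mul hc.le, ← mul_add]
    congr 1
    have hr : 0 < M.lam / c := by positivity
    generalize M.lam / c = r at *
    rcases le_total r y with h | h
    · rw [ENNReal.ofReal_of_nonpos (p := e * -(y - r)) (by nlinarith), add_zero,
        ← ENNReal.ofReal_add (by nlinarith) (by positivity)]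
      congr 1
      ring
    · rw [ENNReal.ofReal_of_nonpos (p := e * (y - r)) (by nlinarith), zero_add,
        ← ENNReal.ofReal_add (by positivity) (by nlinarith)]
      congr 1
      ring
  have hc0 : ENNReal.ofReal c ≠ 0 := (ENNReal.ofReal_pos.2 hc).ne'
  refine ⟨?_, ?_⟩
  · have hL1 : L ≤ 1 := hsum ▸ le_add_self
    by_contra h
    rw [not_lt, top_le_iff] at h
    rw [h, ENNReal.mul_top hc0] at hcL
    exact absurd (hcL.trans hL1) (by simp)
  · rw [bayesRisk, M.falseAlarm_eq hτ, M.expectedDelay_eq hτ, ENNReal.ofReal_mul hc.le]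
    calc _ = ENNReal.ofReal (1 - M.π₀) * (S + (ENNReal.ofReal c * V + ENNReal.ofReal c * Neg)) := by
          ring
      _ = ENNReal.ofReal (1 - M.π₀) * ((S + L) + ENNReal.ofReal c * Pos) := by
          rw [← hbal]; ring
      _ = _ := by rw [hsum]; ring

lemma IsOddsRatioFamily.isMarkovSufficientStatistic {k : ℕ} {rates : Fin k → ℝ}
    (h : M.ν (Set.range rates) = 1) {Φ : ℕ → ℝ≥0 → Ω → ℝ} (hΦ : M.IsOddsRatioFamily Φ) :
    M.IsMarkovSufficientStatistic fun t ω (i : Fin k) => Φ i t ω where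
  adapted := hΦ.adapted_fin M
  markov_ref := hΦ.isMarkov_ref M h
  markov := hΦ.isMarkov M h
  posterior _ hB := hΦ.posterior_fin M h hB
  risk c hc := by
    have hk := Nat.pos_of_ne_zero (M.ne_zero_of_ν_range h)
    -- Waiting costs `c Φ^(0)` through the delay and saves `lam` through the false alarm
    -- probability; dividing by `c` gives `g`.
    refine ⟨fun y => y ⟨0, hk⟩ - M.lam / c, by fun_prop, fun τ hτ => ?_⟩
    have hcost : ∀ g : ℝ → ℝ, M.discountedPosCost (fun y => g (y ⟨0, hk⟩))
        (fun t ω (i : Fin k) => Φ i t ω) τ = M.discountedPosCost g (M.oddsMoment 0) τ := fun g =>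
      M.discountedPosCost_congr (hΦ.ae_eq_oddsMoment.mono fun ω h t => by simp only [h]) τ
    have h := M.bayesRisk_eq hc hτ
    rwa [← hcost, ← hcost] at h

end Model

end PoissonDisorder

end

theorem corollary3p3 {Ω : Type*} [MeasurableSpace Ω] (M : PoissonDisorder.Model Ω) :
    (∃ Φ, M.IsOddsRatioFamily Φ) ∧
    ∀ Φ, M.IsOddsRatioFamily Φ →
      (∀ᵐ ω ∂M.P₀, M.SolvesJumpEquations Φ ω) ∧
      ∀ (k : ℕ) (rates : Fin k → ℝ), (∀ i, 0 < rates i) → M.ν (Set.range rates) = 1 →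
        (∀ᵐ ω ∂M.P₀, ∀ t,
          Φ k t ω = -∑ i : Fin k, (M.ratePoly rates).coeff i * Φ i t ω) ∧
        M.IsMarkovSufficientStatistic (fun t ω (i : Fin k) => Φ i t ω) := by
  refine ⟨⟨_, M.isOddsRatioFamily_oddsMoment⟩, fun Φ hΦ => ⟨hΦ.solvesJumpEquations,
    fun k rates _ hν => ⟨?_, hΦ.isMarkovSufficientStatistic M hν⟩⟩⟩
  filter_upwards [hΦ.ae_eq_oddsMoment] with ω h t
  simp only [h]
  exact M.oddsMoment_linear_relation hν t ω
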